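/- Let $\mathbb{K}\in\{\mathbb{R},\mathbb{C}\}$, let $n\ge 2$ and $m\ge 1$ be integers, and let $0<a_1<\dots<a_m$ be real numbers. Put $\Omega=\mathbb{R}^{n-1}\times(0,a_m)$, $\Sigma_0=\mathbb{R}^{n-1}\times\{0\}$ and $\Sigma_\ell=\mathbb{R}^{n-1}\times\{a_\ell\}$ for $1\le\ell\le m$; functions on $\Sigma_\ell$ are identified with functions on $\mathbb{R}^{n-1}$. Write $\hat g(\xi)=\int g(x)e^{-2\pi i x\cdot\xi}\,dx$ for the Fourier transform on $\mathbb{R}^{n-1}$, extended to $L^2$, and set $$\|g\|_{H^{1/2}}^2=\int_{\mathbb{R}^{n-1}}(1+|\xi|^2)^{1/2}|\hat g(\xi)|^2\,d\xi,\qquad [g]_{\dot H^{-1}}^2=\int_{\mathbb{R}^{n-1}}|\xi|^{-2}|\hat g(\xi)|^2\,d\xi .$$ Let ${}_0H^1(\Omega;\mathbb{K}^n)$ be the space of $u\in H^1(\Omega;\mathbb{K}^n)$ with $\mathrm{Tr}_{\Sigma_0}u=0$, with the norm $\|u\|^2=\|u\|_{L^2}^2+\sum_{j=1}^n\|\partial_ju\|_{L^2}^2$.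 Let $\mathfrak{X}^m(\alpha)$, $\alpha=\{a_\ell\}_{\ell=1}^m$, be the space of all $(f,(g_\ell)_{\ell=1}^m)\in L^2(\Omega;\mathbb{K})\times\prod_{\ell=1}^mH^{1/2}(\Sigma_\ell;\mathbb{K})$ for which the norm given by $$\|(f,(g_\ell)_{\ell=1}^m)\|_{\mathfrak{X}^m(\alpha)}^2=\|f\|_{L^2}^2+\sum_{\ell=1}^m\Big(\|g_\ell\|_{H^{1/2}}^2+\Big[g_\ell-\int_{(0,a_\ell)}f(\cdot,y)\,dy\Big]_{\dot H^{-1}}^2\Big)$$ is finite. Then $\mathfrak{X}^m(\alpha)$ is a Hilbert space, and there exists a bounded $\mathbb{K}$-linear map $Q_m:\mathfrak{X}^m(\alpha)\to{}_0H^1(\Omega;\mathbb{K}^n)$ such that, for all $(f,(g_\ell)_{\ell=1}^m)\in\mathfrak{X}^m(\alpha)$, the field $u=Q_m(f,(g_\ell)_{\ell=1}^m)$, which vanishes on $\Sigma_0$ in the sense of traces, satisfies $\nabla\cdot u=f$ in $\Omega$ and $\mathrm{Tr}_{\Sigma_\ell}u\cdot e_n=g_\ell$ for every $\ell\in\{1,\dots,m\}$.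 -/

import Mathlib

open MeasureTheory Set Filter
open scoped ENNReal ContDiff FourierTransform

noncomputable section

namespace Multilayer

/-! Points of `ℝⁿ = ℝⁿ⁻¹ × ℝ` are pairs `(x, y)`; throughout `d = n - 1`. -/

/-- The horizontal space `ℝᵈ`, with its Euclidean norm. -/
abbrev Horiz (d : ℕ) := EuclideanSpace ℝ (Fin d)

/-- The horizontal slab `ℝᵈ × (0, h)`. -/
def slab (d : ℕ) (h : ℝ) : Set (Horiz d × ℝ) := univ ×ˢ Ioo 0 h

/-- `L²(ℝᵈ × (0, h); V)`. -/
abbrev L2Slab (d : ℕ) (h : ℝ) (V : Type*) [NormedAddCommGroup V] :=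
  Lp V 2 ((volume : Measure (Horiz d × ℝ)).restrict (slab d h))

/-- `L²(ℝᵈ; V)`. -/
abbrev L2Horiz (d : ℕ) (V : Type*) [NormedAddCommGroup V] :=
  Lp V 2 (volume : Measure (Horiz d))

/-- The coordinate directions `e_1, …, e_n` of `ℝᵈ × ℝ`, the last one being vertical. -/
def dir (d : ℕ) : Fin (d + 1) → Horiz d × ℝ :=
  Fin.lastCases (0, 1) (fun i => (EuclideanSpace.single i 1, 0))

/-- `w` is the weak (distributional) derivative of `u` in the direction `v` in the open
set `U`. -/
def HasWeakDeriv {d : ℕ} {V : Type*} [NormedAddCommGroup V] [NormedSpace ℝ V]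
    (U : Set (Horiz d × ℝ)) (v : Horiz d × ℝ) (u w : Horiz d × ℝ → V) : Prop :=
  ∀ φ : Horiz d × ℝ → ℝ, ContDiff ℝ ∞ φ → HasCompactSupport φ → tsupport φ ⊆ U →
    ∫ p in U, (fderiv ℝ φ p v) • u p = - ∫ p in U, φ p • w p

/-- `g` is the trace on the hyperplane `ℝᵈ × {b}` of the function `u` on `ℝᵈ × (0, h)`: `u` has a
representative that is absolutely continuous on `[0, h]` along almost every vertical line, and
whose restriction to the hyperplane is `g`. (For `h > 0`, every `H¹` function on the slab has
such a representative, and any two of them agree on the closure of almost every vertical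
line, so that the trace is unique.) -/
def HasTrace {d : ℕ} {V : Type*} [NormedAddCommGroup V] (h b : ℝ)
    (u : Horiz d × ℝ → V) (g : Horiz d → V) : Prop :=
  ∃ u' : Horiz d × ℝ → V,
    u =ᵐ[volume.restrict (slab d h)] u' ∧
    (∀ᵐ x : Horiz d, AbsolutelyContinuousOnInterval (fun y => u' (x, y)) 0 h) ∧
    ∀ᵐ x : Horiz d, u' (x, b) = g x

section H1

variable (𝕂 : Type*) [RCLike 𝕂]

/-- The space `𝕂ⁿ` of values of vector fields. -/
abbrev Vec (d : ℕ) := EuclideanSpace 𝕂 (Fin (d + 1))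

/-- `L²(ℝᵈ × (0, h); 𝕂ⁿ) × L²(ℝᵈ × (0, h); 𝕂ⁿ)ⁿ` with its Hilbert space norm; the home of the
pairs `(u, (∂_1 u, …, ∂_n u))`. -/
abbrev Jet (d : ℕ) (h : ℝ) :=
  WithLp 2 (L2Slab d h (Vec 𝕂 d) × PiLp 2 (fun _ : Fin (d + 1) => L2Slab d h (Vec 𝕂 d)))

variable {𝕂}

section WeakDerivative

variable {d : ℕ} {h : ℝ} {V : Type*} [NormedAddCommGroup V] [NormedSpace ℝ V]

lemma isOpen_slab (d : ℕ) (h : ℝ) : IsOpen (slab d h) := isOpen_univ.prod isOpen_Ioo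

lemma integrable_test_smul (u : L2Slab d h V) {ψ : Horiz d × ℝ → ℝ} (hψ : Continuous ψ)
    (hc : HasCompactSupport ψ) :
    Integrable (fun p => ψ p • u p) (volume.restrict (slab d h)) :=
  memLp_one_iff_integrable.mp
    ((Lp.memLp u).smul (hψ.memLp_of_hasCompactSupport hc : MemLp ψ 2 _))

lemma integrable_dtest_smul (u : L2Slab d h V) {φ : Horiz d × ℝ → ℝ} (hφ : ContDiff ℝ ∞ φ)
    (hc : HasCompactSupport φ) (v : Horiz d × ℝ) :
    Integrable (fun p => (fderiv ℝ φ p v) • u p) (volume.restrict (slab d h)) :=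
  integrable_test_smul u ((hφ.continuous_fderiv (by simp)).clm_apply continuous_const)
    (hc.fderiv_apply (𝕜 := ℝ) v)

lemma HasWeakDeriv.congr {U : Set (Horiz d × ℝ)} {v : Horiz d × ℝ} {u u' w w' : Horiz d × ℝ → V}
    (H : HasWeakDeriv U v u w) (hu : u' =ᵐ[volume.restrict U] u)
    (hw : w' =ᵐ[volume.restrict U] w) : HasWeakDeriv U v u' w' := by
  intro φ h1 h2 h3
  have e1 : ∫ p in U, (fderiv ℝ φ p v) • u' p = ∫ p in U, (fderiv ℝ φ p v) • u p :=
    integral_congr_ae (by filter_upwards [hu] with p hp; rw [hp])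
  have e2 : ∫ p in U, φ p • w' p = ∫ p in U, φ p • w p :=
    integral_congr_ae (by filter_upwards [hw] with p hp; rw [hp])
  rw [e1, e2]
  exact H φ h1 h2 h3

lemma hasWeakDeriv_zero (v : Horiz d × ℝ) :
    HasWeakDeriv (slab d h) v ((0 : L2Slab d h V) : Horiz d × ℝ → V)
      ((0 : L2Slab d h V) : Horiz d × ℝ → V) := by
  have H : HasWeakDeriv (slab d h) v (0 : Horiz d × ℝ → V) (0 : Horiz d × ℝ → V) := by
    intro φ _ _ _
    simp
  exact H.congr (Lp.coeFn_zero _ _ _) (Lp.coeFn_zero _ _ _)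

lemma HasWeakDeriv.add {v : Horiz d × ℝ} {u u' w w' : L2Slab d h V}
    (H : HasWeakDeriv (slab d h) v u w) (H' : HasWeakDeriv (slab d h) v u' w') :
    HasWeakDeriv (slab d h) v (u + u' : L2Slab d h V) (w + w' : L2Slab d h V) := by
  refine HasWeakDeriv.congr (u := ⇑u + ⇑u') (w := ⇑w + ⇑w') ?_ (Lp.coeFn_add u u')
    (Lp.coeFn_add w w')
  intro φ h1 h2 h3
  simp only [Pi.add_apply, smul_add]
  rw [integral_add (integrable_dtest_smul u h1 h2 v) (integrable_dtest_smul u' h1 h2 v),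
    integral_add (integrable_test_smul w h1.continuous h2)
      (integrable_test_smul w' h1.continuous h2), H φ h1 h2 h3, H' φ h1 h2 h3, neg_add]

lemma HasWeakDeriv.smul [NormedSpace 𝕂 V] [SMulCommClass ℝ 𝕂 V] (c : 𝕂)
    {v : Horiz d × ℝ} {u w : L2Slab d h V} (H : HasWeakDeriv (slab d h) v u w) :
    HasWeakDeriv (slab d h) v (c • u : L2Slab d h V) (c • w : L2Slab d h V) := by
  refine HasWeakDeriv.congr (u := c • ⇑u) (w := c • ⇑w) ?_ (Lp.coeFn_smul c u)
    (Lp.coeFn_smul c w)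
  intro φ h1 h2 h3
  simp only [Pi.smul_apply, smul_comm _ c]
  rw [integral_smul, integral_smul, H φ h1 h2 h3, smul_neg]

/-- A weak derivative in `L²` is unique. -/
lemma HasWeakDeriv.unique [CompleteSpace V] {v : Horiz d × ℝ} {u w w' : L2Slab d h V}
    (H : HasWeakDeriv (slab d h) v u w) (H' : HasWeakDeriv (slab d h) v u w') : w = w' := by
  have hloc : ∀ f : L2Slab d h V, LocallyIntegrableOn f (slab d h) := fun f => by
    exact locallyIntegrableOn_of_locallyIntegrable_restrict
      ((Lp.memLp f).locallyIntegrable (by norm_num))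
  have key := (isOpen_slab d h).ae_eq_zero_of_integral_contDiff_smul_eq_zero
    (μ := (volume : Measure (Horiz d × ℝ))) (f := fun p => w p - w' p)
    ((hloc w).sub (hloc w')) (by
      intro φ h1 h2 h3
      have hsub : ∫ p, φ p • (w p - w' p) = ∫ p in slab d h, φ p • (w p - w' p) := by
        refine (setIntegral_eq_integral_of_forall_compl_eq_zero fun p hp => ?_).symm
        rw [image_eq_zero_of_notMem_tsupport (fun hh => hp (h3 hh)), zero_smul]
      rw [hsub]
      simp only [smul_sub]
      rw [integral_sub (integrable_test_smul w h1.continuous h2)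
        (integrable_test_smul w' h1.continuous h2)]
      have e1 := H φ h1 h2 h3
      have e2 := H' φ h1 h2 h3
      rw [e1] at e2
      rw [neg_injective e2, sub_self])
  refine Lp.ext ?_
  rw [EventuallyEq, ae_restrict_iff' (isOpen_slab d h).measurableSet]
  filter_upwards [key] with p hp hmem
  exact sub_eq_zero.mp (hp hmem)

end WeakDerivative

section Trace

variable {d : ℕ} {h b : ℝ} {V : Type*} [NormedAddCommGroup V]

lemma HasTrace.congr {u v : Horiz d × ℝ → V} {g k : Horiz d → V} (H : HasTrace h b u g)
    (huv : v =ᵐ[volume.restrict (slab d h)] u) (hg : g =ᵐ[volume] k) : HasTrace h b v k := by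
  obtain ⟨u', h1, h2, h3⟩ := H
  refine ⟨u', huv.trans h1, h2, ?_⟩
  filter_upwards [h3, hg] with x hx hx'
  rw [hx, hx']

lemma hasTrace_zero : HasTrace h b (0 : Horiz d × ℝ → V) 0 := by
  refine ⟨0, EventuallyEq.rfl, ?_, by simp⟩
  filter_upwards with x
  exact (LipschitzWith.const (0 : V)).lipschitzOnWith.absolutelyContinuousOnInterval

lemma HasTrace.add {u v : Horiz d × ℝ → V} {g k : Horiz d → V} (H : HasTrace h b u g)
    (H' : HasTrace h b v k) : HasTrace h b (u + v) (g + k) := by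
  obtain ⟨u', h1, h2, h3⟩ := H
  obtain ⟨v', h1', h2', h3'⟩ := H'
  refine ⟨u' + v', h1.add h1', ?_, ?_⟩
  · filter_upwards [h2, h2'] with x hx hx'
    exact hx.add hx'
  · filter_upwards [h3, h3'] with x hx hx'
    simp [hx, hx']

lemma HasTrace.smul [NormedSpace 𝕂 V] (c : 𝕂) {u : Horiz d × ℝ → V} {g : Horiz d → V}
    (H : HasTrace h b u g) : HasTrace h b (c • u) (c • g) := by
  obtain ⟨u', h1, h2, h3⟩ := H
  refine ⟨c • u', h1.const_smul c, ?_, ?_⟩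
  · filter_upwards [h2] with x hx
    exact hx.const_smul c
  · filter_upwards [h3] with x hx
    simp [hx]

end Trace

variable (𝕂)

/-- `₀H¹(ℝᵈ × (0, h); 𝕂ⁿ)`: the fields `u ∈ L²` whose weak partial derivatives `∂_j u` are
all in `L²` and whose trace on the lower boundary `ℝᵈ × {0}` vanishes. A field `u` is stored together
with its weak derivatives, which it determines (`HasWeakDeriv.unique`), so that the norm
inherited from `Jet` is `‖u‖² = ‖u‖²_{L²} + ∑_j ‖∂_j u‖²_{L²}`. -/
def ZeroH1 (d : ℕ) (h : ℝ) : Submodule 𝕂 (Jet 𝕂 d h) where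
  carrier := {U | (∀ j, HasWeakDeriv (slab d h) (dir d j) U.fst (U.snd j)) ∧
    HasTrace h 0 U.fst 0}
  zero_mem' := ⟨fun _ => hasWeakDeriv_zero _, hasTrace_zero.congr (Lp.coeFn_zero _ _ _) .rfl⟩
  add_mem' := fun {A B} hA hB => ⟨fun j => (hA.1 j).add (hB.1 j),
    (hA.2.add hB.2).congr (Lp.coeFn_add A.fst B.fst) (by simp)⟩
  smul_mem' := fun c A hA => ⟨fun j => (hA.1 j).smul c,
    (hA.2.smul c).congr (Lp.coeFn_smul c A.fst) (by simp)⟩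

variable {𝕂}

namespace ZeroH1

variable {d : ℕ} {h : ℝ}

/-- The vector field underlying an element of `₀H¹`. -/
def field (U : ZeroH1 𝕂 d h) : L2Slab d h (Vec 𝕂 d) := U.1.fst

/-- The weak partial derivative `∂_j u`. -/
def partialDeriv (U : ZeroH1 𝕂 d h) (j : Fin (d + 1)) : L2Slab d h (Vec 𝕂 d) := U.1.snd j

/-- The divergence `∇ · u = ∑_j ∂_j u_j`. -/
def divergence (U : ZeroH1 𝕂 d h) (p : Horiz d × ℝ) : 𝕂 := ∑ j, (partialDeriv U j) p j

lemma norm_sq_eq (U : ZeroH1 𝕂 d h) :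
    ‖U‖ ^ 2 = ‖field U‖ ^ 2 + ∑ j, ‖partialDeriv U j‖ ^ 2 := by
  rw [Submodule.coe_norm, WithLp.prod_norm_sq_eq_of_L2, PiLp.norm_sq_eq_of_L2]
  rfl

end ZeroH1

end H1

section Data

variable {𝕂 : Type*} [RCLike 𝕂] {d : ℕ}

/-- The Fourier transform `ĝ ∈ L²(ℝᵈ; ℂ)` of `g ∈ L²(ℝᵈ; 𝕂)`, where `𝕂 = ℝ` or `ℂ` is mapped
to `ℂ` in the obvious way; `ĝ(ξ) = ∫ g(x) exp(-2πi x·ξ) dx` for integrable `g`. -/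
def hat (g : L2Horiz d 𝕂) : L2Horiz d ℂ := 𝓕 ((RCLike.map 𝕂 ℂ).compLp g)

/-- `‖g‖_{H^s} = (∫ (1 + |ξ|²)^s |ĝ(ξ)|² dξ)^{1/2}` (possibly infinite). For `s ≥ 0`, the space
`H^s(ℝᵈ; 𝕂)` consists of the `g ∈ L²` for which this is finite. -/
def sobolevNorm (s : ℝ) (g : L2Horiz d 𝕂) : ℝ≥0∞ :=
  eLpNorm (fun ξ => (1 + ‖ξ‖ ^ 2) ^ (s / 2) • hat g ξ) 2 volume

/-- `[g]_{Ḣ^s} = (∫ |ξ|^{2s} |ĝ(ξ)|² dξ)^{1/2}` (possibly infinite), for `g ∈ L²`. -/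
def homSeminorm (s : ℝ) (g : L2Horiz d 𝕂) : ℝ≥0∞ :=
  eLpNorm (fun ξ => ‖ξ‖ ^ s • hat g ξ) 2 volume

lemma hat_add (g k : L2Horiz d 𝕂) : hat (g + k) = hat g + hat k := by
  have : (RCLike.map 𝕂 ℂ).compLp (g + k) =
      (RCLike.map 𝕂 ℂ).compLp g + (RCLike.map 𝕂 ℂ).compLp k :=
    ((RCLike.map 𝕂 ℂ).compLpL 2 volume).map_add g k
  rw [hat, this, FourierTransform.fourier_add]
  rfl

lemma map_mul_complex (c z : 𝕂) : RCLike.map 𝕂 ℂ (c * z) = RCLike.map 𝕂 ℂ c * RCLike.map 𝕂 ℂ z := by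
  apply Complex.ext <;> simp [RCLike.map_apply]

lemma norm_map_complex (c : 𝕂) : ‖RCLike.map 𝕂 ℂ c‖ = ‖c‖ := by
  rw [← sq_eq_sq₀ (norm_nonneg _) (norm_nonneg _), ← RCLike.normSq_eq_def', ← RCLike.normSq_eq_def',
    RCLike.normSq_apply, RCLike.normSq_apply]
  simp [RCLike.map_apply]

lemma hat_smul (c : 𝕂) (g : L2Horiz d 𝕂) : hat (c • g) = (RCLike.map 𝕂 ℂ c) • hat g := by
  have : (RCLike.map 𝕂 ℂ).compLp (c • g) =
      (RCLike.map 𝕂 ℂ c) • ((RCLike.map 𝕂 ℂ).compLp g) := by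
    refine Lp.ext ?_
    filter_upwards [(RCLike.map 𝕂 ℂ).coeFn_compLp (c • g), (RCLike.map 𝕂 ℂ).coeFn_compLp g,
      Lp.coeFn_smul c g, Lp.coeFn_smul (RCLike.map 𝕂 ℂ c) ((RCLike.map 𝕂 ℂ).compLp g)]
      with x h1 h2 h3 h4
    rw [h1, h4, h3, Pi.smul_apply, Pi.smul_apply, h2, smul_eq_mul, smul_eq_mul, map_mul_complex]
  rw [hat, this, FourierTransform.fourier_smul]
  rfl

lemma hat_eq_zero {g : L2Horiz d 𝕂} (H : hat g = 0) : g = 0 := by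
  have h0 : (RCLike.map 𝕂 ℂ).compLp g = 0 := by
    rw [← norm_eq_zero, ← Lp.norm_fourier_eq]
    rw [hat] at H
    rw [H, norm_zero]
  refine Lp.ext ?_
  filter_upwards [(RCLike.map 𝕂 ℂ).coeFn_compLp g, Lp.coeFn_zero 𝕂 2 (volume : Measure (Horiz d)),
    Lp.coeFn_zero ℂ 2 (volume : Measure (Horiz d))] with x h1 h2 h3
  rw [h0, h3] at h1
  rw [h2, Pi.zero_apply, ← norm_eq_zero, ← norm_map_complex, ← h1]
  simp

section Weight

/-- The weighted `L²` norm on the Fourier side, common to both Sobolev norms. -/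
def weightedNorm (wt : Horiz d → ℝ) (g : L2Horiz d 𝕂) : ℝ≥0∞ :=
  eLpNorm (fun ξ => wt ξ • hat g ξ) 2 volume

variable {wt : Horiz d → ℝ}

lemma weightedNorm_add_le (hwt : Measurable wt) (g k : L2Horiz d 𝕂) :
    weightedNorm wt (g + k) ≤ weightedNorm wt g + weightedNorm wt k := by
  have hm : ∀ f : L2Horiz d ℂ, AEStronglyMeasurable (fun ξ => wt ξ • f ξ) volume := fun f =>
    hwt.aestronglyMeasurable.smul (Lp.aestronglyMeasurable f)
  refine le_trans (le_of_eq ?_) (eLpNorm_add_le (hm (hat g)) (hm (hat k)) (by norm_num))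
  refine eLpNorm_congr_ae ?_
  rw [hat_add]
  filter_upwards [Lp.coeFn_add (hat g) (hat k)] with ξ hξ
  change wt ξ • (hat g + hat k) ξ = wt ξ • hat g ξ + wt ξ • hat k ξ
  rw [hξ, Pi.add_apply, smul_add]

lemma weightedNorm_smul (c : 𝕂) (g : L2Horiz d 𝕂) :
    weightedNorm wt (c • g) = ‖c‖ₑ * weightedNorm wt g := by
  have h1 : weightedNorm wt (c • g) =
      eLpNorm ((RCLike.map 𝕂 ℂ c) • (fun ξ => wt ξ • hat g ξ)) 2 volume := by
    refine eLpNorm_congr_ae ?_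
    rw [hat_smul]
    filter_upwards [Lp.coeFn_smul (RCLike.map 𝕂 ℂ c) (hat g)] with ξ hξ
    simp only [hξ, Pi.smul_apply]
    rw [smul_comm]
  rw [h1, eLpNorm_const_smul]
  congr 1
  rw [← ofReal_norm, norm_map_complex, ofReal_norm]

lemma weightedNorm_eq_zero (hwt : Measurable wt) (hpos : ∀ ξ, wt ξ ≠ 0) {g : L2Horiz d 𝕂}
    (H : weightedNorm wt g = 0) : g = 0 := by
  have hm : AEStronglyMeasurable (fun ξ => wt ξ • hat g ξ) volume :=
    hwt.aestronglyMeasurable.smul (Lp.aestronglyMeasurable _)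
  rw [weightedNorm, eLpNorm_eq_zero_iff hm (by norm_num)] at H
  refine hat_eq_zero (Lp.ext ?_)
  filter_upwards [H, Lp.coeFn_zero ℂ 2 (volume : Measure (Horiz d))] with ξ h1 h2
  rw [h2]
  exact (smul_eq_zero.mp h1).resolve_left (hpos ξ)

lemma sobolevWeight_measurable (s : ℝ) :
    Measurable (fun ξ : Horiz d => (1 + ‖ξ‖ ^ 2) ^ (s / 2)) := by fun_prop

lemma homWeight_measurable (s : ℝ) : Measurable (fun ξ : Horiz d => ‖ξ‖ ^ s) := by fun_prop

end Weight

section VerticalIntegral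

variable {h : ℝ}

lemma volume_restrict_slab (d : ℕ) (h : ℝ) :
    (volume : Measure (Horiz d × ℝ)).restrict (slab d h) =
      (volume : Measure (Horiz d)).prod (volume.restrict (Ioo 0 h)) := by
  rw [slab, Measure.volume_eq_prod, ← Measure.prod_restrict, Measure.restrict_univ]

lemma aesm_slab (f : L2Slab d h 𝕂) : AEStronglyMeasurable f
    ((volume : Measure (Horiz d)).prod (volume.restrict (Ioo 0 h))) := by
  rw [← volume_restrict_slab]; exact Lp.aestronglyMeasurable f

lemma lintegral_slab_lt_top (f : L2Slab d h 𝕂) :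
    ∫⁻ x : Horiz d, ∫⁻ y in Ioo 0 h, ‖f (x, y)‖ₑ ^ (2 : ℝ) < ⊤ := by
  have h0 := lintegral_rpow_enorm_lt_top_of_eLpNorm_lt_top (p := 2) (by norm_num) (by norm_num)
    (Lp.memLp f).2
  have h1 : ∫⁻ p, ‖f p‖ₑ ^ (2 : ℝ) ∂((volume : Measure (Horiz d)).prod
      (volume.restrict (Ioo 0 h))) < ⊤ := by
    rw [← volume_restrict_slab]; simpa using h0
  rw [lintegral_prod _ ((aesm_slab f).enorm.pow_const _)] at h1
  simpa using h1

lemma memLp_slice (f : L2Slab d h 𝕂) :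
    ∀ᵐ x : Horiz d, MemLp (fun y => f (x, y)) 2 (volume.restrict (Ioo 0 h)) := by
  have hm := ((aesm_slab f).enorm.pow_const (2 : ℝ)).lintegral_prod_right'
  filter_upwards [ae_lt_top' hm (lintegral_slab_lt_top f).ne, (aesm_slab f).prodMk_left]
    with x h1 h2
  refine ⟨h2, ?_⟩
  rw [eLpNorm_lt_top_iff_lintegral_rpow_enorm_lt_top (by norm_num) (by norm_num)]
  simpa using h1

lemma integrable_slice (b : ℝ) (f : L2Slab d h 𝕂) :
    ∀ᵐ x : Horiz d, Integrable (fun y => f (x, y)) (volume.restrict (Ioo 0 (min b h))) := by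
  filter_upwards [memLp_slice f] with x hx
  exact (hx.integrable (by norm_num)).mono_measure
    (Measure.restrict_mono (Ioo_subset_Ioo_right (min_le_right _ _)) le_rfl)

lemma memLp_vertInt (b : ℝ) (f : L2Slab d h 𝕂) :
    MemLp (fun x : Horiz d => ∫ y in Ioo 0 (min b h), f (x, y)) 2 volume := by
  have hle : (volume.restrict (Ioo 0 (min b h)) : Measure ℝ) ≤ volume.restrict (Ioo 0 h) :=
    Measure.restrict_mono (Ioo_subset_Ioo_right (min_le_right _ _)) le_rfl
  have hm : AEStronglyMeasurable f
      ((volume : Measure (Horiz d)).prod (volume.restrict (Ioo 0 (min b h)))) :=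
    (aesm_slab f).mono_measure (Measure.prod_mono le_rfl hle)
  refine ⟨hm.integral_prod_right', ?_⟩
  rw [eLpNorm_lt_top_iff_lintegral_rpow_enorm_lt_top (by norm_num) (by norm_num)]
  have hbound : ∀ᵐ x : Horiz d, ‖∫ y in Ioo 0 (min b h), f (x, y)‖ₑ ^ (2 : ℝ) ≤
      ENNReal.ofReal (min b h) * ∫⁻ y in Ioo 0 h, ‖f (x, y)‖ₑ ^ (2 : ℝ) := by
    filter_upwards [memLp_slice f] with x hx
    have h1 : ‖∫ y in Ioo 0 (min b h), f (x, y)‖ₑ ≤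
        eLpNorm (fun y => f (x, y)) 1 (volume.restrict (Ioo 0 (min b h))) := by
      rw [eLpNorm_one_eq_lintegral_enorm]
      exact enorm_integral_le_lintegral_enorm _
    have h2 := eLpNorm_le_eLpNorm_mul_rpow_measure_univ (p := 1) (q := 2) (by norm_num)
      (hx.mono_measure hle).1
    have h3 := ENNReal.rpow_le_rpow (h1.trans h2) (z := 2) (by norm_num)
    refine h3.trans ?_
    rw [ENNReal.mul_rpow_of_nonneg _ _ (by norm_num), mul_comm]
    refine mul_le_mul' (le_of_eq ?_) ?_
    · rw [← ENNReal.rpow_mul]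
      norm_num
    · rw [eLpNorm_eq_lintegral_rpow_enorm_toReal (by norm_num) (by norm_num), ← ENNReal.rpow_mul]
      norm_num
      exact lintegral_mono' hle le_rfl
  simp only [ENNReal.toReal_ofNat]
  refine (lintegral_mono_ae hbound).trans_lt ?_
  have := lintegral_slab_lt_top f
  rw [lintegral_const_mul' _ _ ENNReal.ofReal_ne_top]
  exact ENNReal.mul_lt_top ENNReal.ofReal_lt_top this

/-- The vertical integral `x ↦ ∫_{(0, b)} f(x, y) dy ∈ L²(ℝᵈ; 𝕂)` of `f ∈ L²(ℝᵈ × (0, h); 𝕂)`, for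
`0 ≤ b ≤ h` (for `b > h` the function is cut off at the top of the slab). -/
def vertInt (b : ℝ) : L2Slab d h 𝕂 →ₗ[𝕂] L2Horiz d 𝕂 where
  toFun f := (memLp_vertInt b f).toLp _
  map_add' f g := by
    have hab : (volume.restrict (Ioo 0 (min b h)) : Measure ℝ) ≤ volume.restrict (Ioo 0 h) :=
      Measure.restrict_mono (Ioo_subset_Ioo_right (min_le_right _ _)) le_rfl
    have key : ∀ᵐ p ∂((volume : Measure (Horiz d)).prod (volume.restrict (Ioo 0 h))),
        (f + g) p = f p + g p := by
      rw [← volume_restrict_slab]; exact Lp.coeFn_add f g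
    rw [← MemLp.toLp_add]
    refine MemLp.toLp_congr _ _ ?_
    filter_upwards [Measure.ae_ae_of_ae_prod key, integrable_slice b f, integrable_slice b g]
      with x hx h1 h2
    rw [Pi.add_apply, ← integral_add h1 h2]
    exact integral_congr_ae (ae_mono hab hx)
  map_smul' c f := by
    have hab : (volume.restrict (Ioo 0 (min b h)) : Measure ℝ) ≤ volume.restrict (Ioo 0 h) :=
      Measure.restrict_mono (Ioo_subset_Ioo_right (min_le_right _ _)) le_rfl
    have key : ∀ᵐ p ∂((volume : Measure (Horiz d)).prod (volume.restrict (Ioo 0 h))),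
        (c • f) p = c • f p := by
      rw [← volume_restrict_slab]; exact Lp.coeFn_smul c f
    rw [RingHom.id_apply, ← MemLp.toLp_const_smul]
    refine MemLp.toLp_congr _ _ ?_
    filter_upwards [Measure.ae_ae_of_ae_prod key] with x hx
    rw [Pi.smul_apply, ← integral_smul]
    exact integral_congr_ae (ae_mono hab hx)

end VerticalIntegral

variable (𝕂 d) {m : ℕ}

/-- The pairs `(f, (g_ℓ)_ℓ)` in `L²(Ω; 𝕂) × ∏_ℓ H^{1/2}(ℝᵈ; 𝕂)` with
`g_ℓ - ∫_{(0, a_ℓ)} f ∈ Ḣ^{-1}(ℝᵈ; 𝕂)` for every `ℓ`, where `Ω` is the slab whose height is the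
largest depth parameter. The list `a` has `m + 1 ≥ 1` entries. -/
def dataSubmodule (a : Fin (m + 1) → ℝ) :
    Submodule 𝕂 (L2Slab d (a (Fin.last m)) 𝕂 × (Fin (m + 1) → L2Horiz d 𝕂)) where
  carrier := {x | ∀ ℓ, sobolevNorm (1 / 2) (x.2 ℓ) < ⊤ ∧
    homSeminorm (-1) (x.2 ℓ - vertInt (a ℓ) x.1) < ⊤}
  zero_mem' := fun ℓ => by
    have h0 : ∀ wt : Horiz d → ℝ, weightedNorm wt (0 : L2Horiz d 𝕂) = 0 := fun wt => by
      simpa using weightedNorm_smul (wt := wt) (0 : 𝕂) (0 : L2Horiz d 𝕂)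
    refine ⟨?_, ?_⟩
    · exact (h0 _).trans_lt ENNReal.zero_lt_top
    · simp only [Prod.snd_zero, Prod.fst_zero, Pi.zero_apply, map_zero, sub_zero]
      exact (h0 _).trans_lt ENNReal.zero_lt_top
  add_mem' := fun {x y} hx hy ℓ => by
    refine ⟨(weightedNorm_add_le (sobolevWeight_measurable _) _ _).trans_lt
      (ENNReal.add_lt_top.mpr ⟨(hx ℓ).1, (hy ℓ).1⟩), ?_⟩
    have e : (x + y).2 ℓ - vertInt (a ℓ) (x + y).1 =
        (x.2 ℓ - vertInt (a ℓ) x.1) + (y.2 ℓ - vertInt (a ℓ) y.1) := by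
      simp only [Prod.snd_add, Prod.fst_add, Pi.add_apply, map_add]; abel
    rw [e]
    exact (weightedNorm_add_le (homWeight_measurable _) _ _).trans_lt
      (ENNReal.add_lt_top.mpr ⟨(hx ℓ).2, (hy ℓ).2⟩)
  smul_mem' := fun c x hx ℓ => by
    refine ⟨(weightedNorm_smul c _).trans_lt (ENNReal.mul_lt_top enorm_lt_top (hx ℓ).1), ?_⟩
    have e : (c • x).2 ℓ - vertInt (a ℓ) (c • x).1 = c • (x.2 ℓ - vertInt (a ℓ) x.1) := by
      simp only [Prod.smul_snd, Prod.smul_fst, Pi.smul_apply, map_smul, smul_sub]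
    rw [e]
    exact (weightedNorm_smul c _).trans_lt (ENNReal.mul_lt_top enorm_lt_top (hx ℓ).2)

/-- The data space `𝔛(a)`. -/
def DataSpace (a : Fin (m + 1) → ℝ) : Type _ := dataSubmodule 𝕂 d a

namespace DataSpace

variable {𝕂 d} {a : Fin (m + 1) → ℝ}

instance instAddCommGroup : AddCommGroup (DataSpace 𝕂 d a) :=
  inferInstanceAs (AddCommGroup (dataSubmodule 𝕂 d a))

instance instModule : Module 𝕂 (DataSpace 𝕂 d a) :=
  inferInstanceAs (Module 𝕂 (dataSubmodule 𝕂 d a))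

/-- The prescribed divergence `f`. -/
def f (x : DataSpace 𝕂 d a) : L2Slab d (a (Fin.last m)) 𝕂 := x.1.1

/-- The prescribed normal traces `g_ℓ`. -/
def g (x : DataSpace 𝕂 d a) (ℓ : Fin (m + 1)) : L2Horiz d 𝕂 := x.1.2 ℓ

/-- `g_ℓ - ∫_{(0, a_ℓ)} f`. -/
def defect (x : DataSpace 𝕂 d a) (ℓ : Fin (m + 1)) : L2Horiz d 𝕂 := x.g ℓ - vertInt (a ℓ) x.f

/-- The norm of the data space:
`‖(f, g)‖² = ‖f‖²_{L²} + ∑_ℓ (‖g_ℓ‖²_{H^{1/2}} + [g_ℓ - ∫_{(0, a_ℓ)} f]²_{Ḣ^{-1}})`. -/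
instance instNorm : Norm (DataSpace 𝕂 d a) where
  norm x := √(‖x.f‖ ^ 2 + ∑ ℓ, ((sobolevNorm (1 / 2) (x.g ℓ)).toReal ^ 2 +
    (homSeminorm (-1) (x.defect ℓ)).toReal ^ 2))

lemma norm_def (x : DataSpace 𝕂 d a) : ‖x‖ = √(‖x.f‖ ^ 2 +
    ∑ ℓ, ((sobolevNorm (1 / 2) (x.g ℓ)).toReal ^ 2 +
      (homSeminorm (-1) (x.defect ℓ)).toReal ^ 2)) := rfl

lemma f_add (x y : DataSpace 𝕂 d a) : (x + y).f = x.f + y.f := rfl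
lemma g_add (x y : DataSpace 𝕂 d a) (ℓ) : (x + y).g ℓ = x.g ℓ + y.g ℓ := rfl
lemma f_smul (c : 𝕂) (x : DataSpace 𝕂 d a) : (c • x).f = c • x.f := rfl
lemma g_smul (c : 𝕂) (x : DataSpace 𝕂 d a) (ℓ) : (c • x).g ℓ = c • x.g ℓ := rfl

lemma defect_add (x y : DataSpace 𝕂 d a) (ℓ) :
    (x + y).defect ℓ = x.defect ℓ + y.defect ℓ := by
  simp only [defect, f_add, g_add, map_add]; abel

lemma defect_smul (c : 𝕂) (x : DataSpace 𝕂 d a) (ℓ) :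
    (c • x).defect ℓ = c • x.defect ℓ := by
  simp only [defect, f_smul, g_smul, map_smul, smul_sub]

/-- The norm as the Euclidean norm of the vector of its ingredients. -/
def ingredients (x : DataSpace 𝕂 d a) :
    EuclideanSpace ℝ (Option (Fin (m + 1) ⊕ Fin (m + 1))) :=
  WithLp.toLp 2 fun i => match i with
    | none => ‖x.f‖
    | some (.inl ℓ) => (sobolevNorm (1 / 2) (x.g ℓ)).toReal
    | some (.inr ℓ) => (homSeminorm (-1) (x.defect ℓ)).toReal

lemma norm_eq (x : DataSpace 𝕂 d a) : ‖x‖ = ‖x.ingredients‖ := by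
  rw [EuclideanSpace.norm_eq, norm_def]
  simp [ingredients, Fintype.sum_option, Finset.sum_add_distrib]

lemma ingredients_nonneg (x : DataSpace 𝕂 d a) (i) : 0 ≤ x.ingredients i := by
  rcases i with _ | ℓ | ℓ <;> simp [ingredients]

lemma normCore : NormedSpace.Core 𝕂 (DataSpace 𝕂 d a) where
  norm_nonneg x := Real.sqrt_nonneg _
  norm_smul c x := by
    have h : (c • x).ingredients = ‖c‖ • x.ingredients := by
      ext i
      rcases i with _ | ℓ | ℓ
      · simp [ingredients, f_smul, norm_smul]
      · have := weightedNorm_smul (wt := fun ξ => (1 + ‖ξ‖ ^ 2) ^ ((1 / 2 : ℝ) / 2)) c (x.g ℓ)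
        change (weightedNorm _ _).toReal = ‖c‖ * (weightedNorm _ _).toReal
        rw [g_smul, this, ENNReal.toReal_mul, toReal_enorm]
      · have := weightedNorm_smul (wt := fun ξ => ‖ξ‖ ^ (-1 : ℝ)) c (x.defect ℓ)
        change (weightedNorm _ _).toReal = ‖c‖ * (weightedNorm _ _).toReal
        rw [defect_smul, this, ENNReal.toReal_mul, toReal_enorm]
    rw [norm_eq, norm_eq, h, norm_smul, norm_norm]
  norm_triangle x y := by
    rw [norm_eq, norm_eq, norm_eq]
    refine le_trans ?_ (norm_add_le _ _)
    rw [EuclideanSpace.norm_eq, EuclideanSpace.norm_eq]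
    refine Real.sqrt_le_sqrt (Finset.sum_le_sum fun i _ => ?_)
    have hle : (x + y).ingredients i ≤ (x.ingredients + y.ingredients) i := by
      rcases i with _ | ℓ | ℓ
      · simpa [ingredients, f_add] using norm_add_le x.f y.f
      · refine (ENNReal.toReal_mono ?_ (g_add x y ℓ ▸
          weightedNorm_add_le (sobolevWeight_measurable (1 / 2)) (x.g ℓ) (y.g ℓ))).trans
          ENNReal.toReal_add_le
        exact (ENNReal.add_lt_top.mpr ⟨(x.2 ℓ).1, (y.2 ℓ).1⟩).ne
      · refine (ENNReal.toReal_mono ?_ (defect_add x y ℓ ▸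
          weightedNorm_add_le (homWeight_measurable (-1)) (x.defect ℓ) (y.defect ℓ))).trans
          ENNReal.toReal_add_le
        exact (ENNReal.add_lt_top.mpr ⟨(x.2 ℓ).2, (y.2 ℓ).2⟩).ne
    have h0 := ingredients_nonneg (x + y) i
    rw [Real.norm_of_nonneg h0, Real.norm_of_nonneg (h0.trans hle)]
    exact pow_le_pow_left₀ h0 hle 2
  norm_eq_zero_iff x := by
    refine ⟨fun hx => ?_, fun hx => ?_⟩
    · rw [norm_eq, norm_eq_zero] at hx
      have hi : ∀ i, x.ingredients i = 0 := fun i => by rw [hx]; rfl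
      have hf : x.f = 0 := norm_eq_zero.mp (hi none)
      have hg : ∀ ℓ, x.g ℓ = 0 := fun ℓ => by
        have := hi (some (.inl ℓ))
        refine weightedNorm_eq_zero (sobolevWeight_measurable (1 / 2)) (fun ξ => ?_)
          (((ENNReal.toReal_eq_zero_iff _).mp this).resolve_right (x.2 ℓ).1.ne)
        positivity
      exact Subtype.ext (Prod.ext hf (funext hg))
    · have : x.ingredients = 0 := by
        ext i
        have hd : ∀ wt : Horiz d → ℝ, weightedNorm wt (0 : L2Horiz d 𝕂) = 0 := fun wt => by
          simpa using weightedNorm_smul (wt := wt) (0 : 𝕂) (0 : L2Horiz d 𝕂)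
        subst hx
        rcases i with _ | ℓ | ℓ
        · exact norm_zero
        · exact congrArg ENNReal.toReal (hd _)
        · have : (0 : DataSpace 𝕂 d a).defect ℓ = 0 := by
            have := defect_smul (0 : 𝕂) (0 : DataSpace 𝕂 d a) ℓ
            simpa using this
          exact congrArg ENNReal.toReal ((congrArg _ this).trans (hd _))
      rw [norm_eq, this, norm_zero]

instance instNormedAddCommGroup : NormedAddCommGroup (DataSpace 𝕂 d a) :=
  NormedAddCommGroup.ofCore normCore

instance instNormedSpace : NormedSpace 𝕂 (DataSpace 𝕂 d a) :=
  NormedSpace.ofCore normCore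

end DataSpace

end Data

end Multilayer

end

/-!
The problem is solved frequency by frequency. After a Fourier transform in the horizontal
variable, write `k = 2π|ξ|`, `F = f̂(ξ, ·)`, and look for a field whose horizontal part is
`-i (ξ/|ξ|) v` and whose vertical part is `w`. The divergence equation and the boundary conditions
become
`k v + w' = F`, `v(0) = w(0) = 0`, `w(a_ℓ) = ĝ_ℓ`.

Duhamel's integral `E(y) = ∫_{(0, y)} exp(-k (y - s)) F(s) ds` satisfies `E' = F - k E` and
`E(0) = 0`, so `v = w = E` solves everything except the conditions at the heights `a_ℓ`. These are
met by adding boundary layers, which do not contribute to the divergence: with `K = 1 + k`, a bump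
function `θ` such that `θ(0) = 1`, and `δ` so small that layers at different heights do not
interfere,
`w = E + ∑_ℓ k K^{-3/2} θ(K (y - a_ℓ) / δ) ρ_ℓ`,
`v = E - ∑_ℓ K^{-1/2} δ⁻¹ θ'(K (y - a_ℓ) / δ) ρ_ℓ`.
A layer has thickness `1 / K`, so that its first derivatives are bounded in `L²` by its amplitude
`ρ_ℓ` (`exists_layer`, `exists_component`); the derivatives of `E` are bounded by Schur's test
(`exists_volterra`). This gives `exists_fourier_solution`.

It remains to bound the amplitude, `ρ_ℓ = k⁻¹ K^{3/2} (ĝ_ℓ - E(a_ℓ))`, in `L²`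
(`exists_amplitude`). For `k ≥ 1` the factor `k⁻¹ K^{3/2}` is of size `k^{1/2}`, and the `H^{1/2}`
norm of `g_ℓ` and the Cauchy–Schwarz inequality in `E(a_ℓ)` suffice. For `k < 1` the factor is of
size `k⁻¹`, and `ĝ_ℓ - E(a_ℓ) = (ĝ_ℓ - ∫_{(0, a_ℓ)} F) + ∫_{(0, a_ℓ)} (1 - exp(-k (a_ℓ - s))) F(s)
ds`: the first term is controlled by the `Ḣ^{-1}` seminorm in the norm of the data space, and the
second one is of size `k`.

The horizontal Fourier transform of a function on the slab is obtained by letting a bounded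
operator on `L²(ℝᵈ)` act on horizontal slices (`sliceMap`); such operators commute with vertical
integration (`vertInt_sliceMap`). Every component of the solution is a vertical primitive
(`primitive`), from which its traces (`hasTrace_primitive`) and its vertical derivative
(`hasWeakDeriv_primitive`) are read off; its horizontal derivatives come from Parseval's identity
(`hasWeakDeriv_fourierInvSlice`). For `𝕂 = ℝ` the solution for complexified data is followed by
taking real parts.

The norm of the data space is the `ℓ²` norm of finitely many `L²` norms of functions that depend
additively on the data, which yields the parallelogram law; completeness holds because
multiplication by a weight is a closed operator in `L²` (`ae_eq_smul_of_tendsto`).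
-/

noncomputable section

namespace Multilayer

/-! ### Operators on `L²` given by pointwise formulas -/

section Operators

variable {α β : Type*} [MeasurableSpace α] [MeasurableSpace β]

lemma eLpNorm_two_sq {E : Type*} [NormedAddCommGroup E] (f : α → E) (μ : Measure α) :
    eLpNorm f 2 μ ^ 2 = ∫⁻ x, ‖f x‖ₑ ^ 2 ∂μ := by
  have h := eLpNorm_nnreal_pow_eq_lintegral (f := f) (μ := μ) (p := 2) (by norm_num)
  simpa using h

lemma lintegral_mul_sq_le (μ : Measure α) {f g : α → ℝ≥0∞} (hf : AEMeasurable f μ)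
    (hg : AEMeasurable g μ) :
    (∫⁻ x, f x * g x ∂μ) ^ 2 ≤ (∫⁻ x, f x ^ 2 ∂μ) * ∫⁻ x, g x ^ 2 ∂μ := by
  have h := ENNReal.lintegral_mul_le_Lp_mul_Lq μ Real.HolderConjugate.two_two hf hg
  simp only [Pi.mul_apply, ENNReal.rpow_ofNat] at h
  have h2 := pow_le_pow_left' h 2
  refine h2.trans (le_of_eq ?_)
  rw [mul_pow, ← ENNReal.rpow_natCast, ← ENNReal.rpow_natCast, ← ENNReal.rpow_mul,
    ← ENNReal.rpow_mul]
  norm_num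

lemma enorm_integral_mul_sq_le (μ : Measure α) {f g : α → ℂ} (hf : AEStronglyMeasurable f μ)
    (hg : AEStronglyMeasurable g μ) :
    ‖∫ x, f x * g x ∂μ‖ₑ ^ 2 ≤ (∫⁻ x, ‖f x‖ₑ ^ 2 ∂μ) * ∫⁻ x, ‖g x‖ₑ ^ 2 ∂μ := by
  refine (pow_le_pow_left' (enorm_integral_le_lintegral_enorm _) 2).trans ?_
  simp only [enorm_mul]
  exact lintegral_mul_sq_le μ hf.enorm hg.enorm

/-- The Cauchy–Schwarz inequality for the measure `|f| μ`. -/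
lemma enorm_integral_mul_sq_le_weighted (μ : Measure α) {f g : α → ℂ}
    (hf : AEStronglyMeasurable f μ) (hg : AEStronglyMeasurable g μ) :
    ‖∫ x, f x * g x ∂μ‖ₑ ^ 2 ≤ (∫⁻ x, ‖f x‖ₑ ∂μ) * ∫⁻ x, ‖f x‖ₑ * ‖g x‖ₑ ^ 2 ∂μ := by
  refine (pow_le_pow_left' (enorm_integral_le_lintegral_enorm _) 2).trans ?_
  have hs : ∀ a : ℝ≥0∞, (a ^ (1 / 2 : ℝ)) ^ 2 = a := fun a => by
    rw [← ENNReal.rpow_natCast, ← ENNReal.rpow_mul]; norm_num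
  have h := lintegral_mul_sq_le μ (f := fun x => ‖f x‖ₑ ^ (1 / 2 : ℝ))
    (g := fun x => ‖f x‖ₑ ^ (1 / 2 : ℝ) * ‖g x‖ₑ) (hf.enorm.pow_const _)
    ((hf.enorm.pow_const _).mul hg.enorm)
  simp only [mul_pow, hs] at h
  refine le_trans (le_of_eq ?_) h
  congr 1
  refine lintegral_congr fun x => ?_
  rw [enorm_mul, ← mul_assoc, ← sq, hs]

variable {μ : Measure α} {ν : Measure β}

/-- A pointwise formula that is additive, homogeneous and bounded in `L²` defines a bounded
operator. -/
lemma exists_clm_of_pointwise (T : Lp ℂ 2 μ → β → ℂ) (C : ℝ)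
    (hm : ∀ f, AEStronglyMeasurable (T f) ν)
    (hadd : ∀ f g, T (f + g) =ᵐ[ν] T f + T g) (hsmul : ∀ (c : ℂ) f, T (c • f) =ᵐ[ν] c • T f)
    (hb : ∀ f, ∫⁻ y, ‖T f y‖ₑ ^ 2 ∂ν ≤ ENNReal.ofReal C * ∫⁻ x, ‖f x‖ₑ ^ 2 ∂μ) :
    ∃ A : Lp ℂ 2 μ →L[ℂ] Lp ℂ 2 ν, ∀ f, A f =ᵐ[ν] T f := by
  have hb' : ∀ f, eLpNorm (T f) 2 ν ≤ ENNReal.ofReal (√C) * eLpNorm f 2 μ := fun f => by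
    have h := hb f
    rw [← eLpNorm_two_sq, ← eLpNorm_two_sq] at h
    rw [← ENNReal.pow_le_pow_left_iff (n := 2) two_ne_zero, mul_pow]
    refine h.trans (le_of_eq ?_)
    rcases le_total 0 C with hC | hC
    · rw [← ENNReal.ofReal_pow (Real.sqrt_nonneg _), Real.sq_sqrt hC]
    · simp [ENNReal.ofReal_of_nonpos hC, Real.sqrt_eq_zero_of_nonpos hC]
  have hL : ∀ f, MemLp (T f) 2 ν := fun f =>
    ⟨hm f, (hb' f).trans_lt (ENNReal.mul_lt_top ENNReal.ofReal_lt_top (Lp.memLp f).2)⟩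
  let A₀ : Lp ℂ 2 μ →ₗ[ℂ] Lp ℂ 2 ν :=
    { toFun := fun f => (hL f).toLp
      map_add' := fun f g => by
        rw [← MemLp.toLp_add]; exact MemLp.toLp_congr _ _ (hadd f g)
      map_smul' := fun c f => by
        rw [RingHom.id_apply, ← MemLp.toLp_const_smul]; exact MemLp.toLp_congr _ _ (hsmul c f) }
  refine ⟨A₀.mkContinuous (√C) fun f => ?_, fun f => (hL f).coeFn_toLp⟩
  change ‖(hL f).toLp‖ ≤ _
  rw [Lp.norm_toLp, Lp.norm_def, ← ENNReal.toReal_ofReal (Real.sqrt_nonneg C),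
    ← ENNReal.toReal_mul]
  exact ENNReal.toReal_mono (ENNReal.mul_ne_top ENNReal.ofReal_ne_top (Lp.memLp f).2.ne) (hb' f)

end Operators

/-! ### Tonelli on the slab and kernel operators -/

section Slab

variable {d : ℕ} {h : ℝ}

lemma ae_slab_right {P : Horiz d × ℝ → Prop} (H : ∀ᵐ p ∂(volume.restrict (slab d h)), P p) :
    ∀ᵐ x : Horiz d, ∀ᵐ y ∂(volume.restrict (Ioo 0 h)), P (x, y) := by
  rw [volume_restrict_slab] at H
  exact Measure.ae_ae_of_ae_prod H

lemma ae_slab_left {P : Horiz d × ℝ → Prop} (H : ∀ᵐ p ∂(volume.restrict (slab d h)), P p) :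
    ∀ᵐ y ∂(volume.restrict (Ioo 0 h)), ∀ᵐ x : Horiz d, P (x, y) := by
  rw [volume_restrict_slab, ← Measure.prod_swap] at H
  exact Measure.ae_ae_of_ae_prod (ae_of_ae_map measurable_swap.aemeasurable H)

lemma ae_slab_fst {P : Horiz d → Prop} (H : ∀ᵐ x, P x) :
    ∀ᵐ p ∂(volume.restrict (slab d h)), P p.1 := by
  rw [volume_restrict_slab]
  exact Measure.quasiMeasurePreserving_fst.ae H

lemma lintegral_slab {g : Horiz d × ℝ → ℝ≥0∞} (hg : Measurable g) :
    ∫⁻ p in slab d h, g p = ∫⁻ x : Horiz d, ∫⁻ y in Ioo 0 h, g (x, y) := by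
  rw [volume_restrict_slab, lintegral_prod _ hg.aemeasurable]

lemma lintegral_slab_symm {g : Horiz d × ℝ → ℝ≥0∞} (hg : Measurable g) :
    ∫⁻ p in slab d h, g p = ∫⁻ y in Ioo 0 h, ∫⁻ x : Horiz d, g (x, y) := by
  rw [volume_restrict_slab, lintegral_prod_symm _ hg.aemeasurable]

lemma integral_slab {g : Horiz d × ℝ → ℂ} (hg : Integrable g (volume.restrict (slab d h))) :
    ∫ p in slab d h, g p = ∫ x : Horiz d, ∫ y in Ioo 0 h, g (x, y) := by
  rw [volume_restrict_slab] at hg ⊢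
  exact integral_prod _ hg

lemma integral_slab_symm {g : Horiz d × ℝ → ℂ}
    (hg : Integrable g (volume.restrict (slab d h))) :
    ∫ p in slab d h, g p = ∫ y in Ioo 0 h, ∫ x : Horiz d, g (x, y) := by
  rw [volume_restrict_slab] at hg ⊢
  exact integral_prod_symm _ hg

lemma measurable_enorm_sq (f : L2Slab d h ℂ) : Measurable fun p => ‖f p‖ₑ ^ 2 :=
  (Lp.stronglyMeasurable f).measurable.enorm.pow_const 2

lemma integrable_slice_left (f : L2Slab d h ℂ) :
    ∀ᵐ x : Horiz d, Integrable (fun y => f (x, y)) (volume.restrict (Ioo 0 h)) := by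
  filter_upwards [memLp_slice f] with x hx
  exact hx.integrable (by norm_num)

/-- Multiplication by a bounded function. -/
lemma exists_mul_clm {α : Type*} [MeasurableSpace α] {μ : Measure α} {c : α → ℂ}
    (hc : Measurable c) {C : ℝ} (hC : ∀ x, ‖c x‖ ≤ C) :
    ∃ A : Lp ℂ 2 μ →L[ℂ] Lp ℂ 2 μ, ∀ f, A f =ᵐ[μ] fun x => c x * f x := by
  refine exists_clm_of_pointwise (fun f x => c x * f x) (C ^ 2) (fun f => ?_) (fun f g => ?_)
    (fun a f => ?_) (fun f => ?_)
  · exact hc.aestronglyMeasurable.mul (Lp.aestronglyMeasurable f)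
  · filter_upwards [Lp.coeFn_add f g] with x hx
    rw [Pi.add_apply, hx, Pi.add_apply, mul_add]
  · filter_upwards [Lp.coeFn_smul a f] with x hx
    rw [Pi.smul_apply, hx, Pi.smul_apply, smul_eq_mul, smul_eq_mul]; ring
  · rw [← lintegral_const_mul' _ _ ENNReal.ofReal_ne_top]
    refine lintegral_mono fun x => ?_
    have h0 : 0 ≤ C := (norm_nonneg _).trans (hC x)
    rw [enorm_mul, mul_pow, ENNReal.ofReal_pow h0]
    gcongr
    rw [← ofReal_norm]
    exact ENNReal.ofReal_le_ofReal (hC x)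

/-- The operator `φ ↦ m(x, y) φ(x)` from `L²(ℝᵈ)` to `L²` of the slab, for a kernel that is square
integrable in `y`, uniformly in `x`. -/
lemma exists_kernelMul {m : Horiz d × ℝ → ℂ} (hm : Measurable m) {C : ℝ}
    (hC : ∀ x, ∫⁻ y in Ioo 0 h, ‖m (x, y)‖ₑ ^ 2 ≤ ENNReal.ofReal C) :
    ∃ A : L2Horiz d ℂ →L[ℂ] L2Slab d h ℂ,
      ∀ φ, A φ =ᵐ[volume.restrict (slab d h)] fun p => m p * φ p.1 := by
  refine exists_clm_of_pointwise (fun φ p => m p * φ p.1) C (fun φ => ?_) (fun f g => ?_)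
    (fun a f => ?_) (fun f => ?_)
  · exact (hm.mul ((Lp.stronglyMeasurable φ).measurable.comp measurable_fst)).aestronglyMeasurable
  · filter_upwards [ae_slab_fst (Lp.coeFn_add f g)] with p hp
    rw [Pi.add_apply, hp, Pi.add_apply, mul_add]
  · filter_upwards [ae_slab_fst (Lp.coeFn_smul a f)] with p hp
    rw [Pi.smul_apply, hp, Pi.smul_apply, smul_eq_mul, smul_eq_mul]; ring
  · have hf := (Lp.stronglyMeasurable f).measurable
    rw [lintegral_slab (g := fun p => ‖m p * f p.1‖ₑ ^ 2)
        ((hm.mul (hf.comp measurable_fst)).enorm.pow_const 2),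
      ← lintegral_const_mul' _ _ ENNReal.ofReal_ne_top]
    refine lintegral_mono fun x => ?_
    simp only [enorm_mul, mul_pow]
    rw [lintegral_mul_const' _ _ (by finiteness)]
    gcongr
    exact hC x

/-- The operator `f ↦ ∫ m(x, s) f(x, s) ds` from `L²` of the slab to `L²(ℝᵈ)`, for a kernel that is
square integrable in `s`, uniformly in `x`. -/
lemma exists_kernelInt {m : Horiz d × ℝ → ℂ} (hm : Measurable m) {C : ℝ}
    (hC : ∀ x, ∫⁻ y in Ioo 0 h, ‖m (x, y)‖ₑ ^ 2 ≤ ENNReal.ofReal C) :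
    ∃ A : L2Slab d h ℂ →L[ℂ] L2Horiz d ℂ,
      ∀ f, A f =ᵐ[volume] fun x => ∫ s in Ioo 0 h, m (x, s) * f (x, s) := by
  have hmx : ∀ x, Measurable fun y => m (x, y) := fun x => hm.comp measurable_prodMk_left
  have hL : ∀ x, MemLp (fun y => m (x, y)) 2 (volume.restrict (Ioo 0 h)) := fun x => by
    refine ⟨(hmx x).aestronglyMeasurable, ?_⟩
    refine (ENNReal.pow_lt_top_iff (n := 2)).mp ?_ |>.resolve_right two_ne_zero
    rw [eLpNorm_two_sq]
    exact (hC x).trans_lt ENNReal.ofReal_lt_top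
  have hi : ∀ f : L2Slab d h ℂ, ∀ᵐ x : Horiz d,
      Integrable (fun y => m (x, y) * f (x, y)) (volume.restrict (Ioo 0 h)) := fun f => by
    filter_upwards [memLp_slice f] with x hx
    exact MemLp.integrable_mul (hL x) hx
  refine exists_clm_of_pointwise (fun f x => ∫ s in Ioo 0 h, m (x, s) * f (x, s)) C (fun f => ?_)
    (fun f g => ?_) (fun a f => ?_) (fun f => ?_)
  · exact (StronglyMeasurable.integral_prod_right' (ν := volume.restrict (Ioo 0 h))
      (f := fun p => m p * f p)
      (hm.stronglyMeasurable.mul (Lp.stronglyMeasurable f))).aestronglyMeasurable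
  · filter_upwards [hi f, hi g, ae_slab_right (Lp.coeFn_add f g)] with x h1 h2 h3
    rw [Pi.add_apply, ← integral_add h1 h2]
    refine integral_congr_ae ?_
    filter_upwards [h3] with y hy
    rw [hy, Pi.add_apply, mul_add]
  · filter_upwards [ae_slab_right (Lp.coeFn_smul a f)] with x h3
    rw [Pi.smul_apply, ← integral_smul]
    refine integral_congr_ae ?_
    filter_upwards [h3] with y hy
    rw [hy, Pi.smul_apply, smul_eq_mul, smul_eq_mul]; ring
  · rw [lintegral_slab (measurable_enorm_sq f), ← lintegral_const_mul' _ _ ENNReal.ofReal_ne_top]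
    refine lintegral_mono fun x => ?_
    refine (enorm_integral_mul_sq_le _ (hmx x).aestronglyMeasurable
      ((Lp.stronglyMeasurable f).measurable.comp
        measurable_prodMk_left).aestronglyMeasurable).trans ?_
    exact mul_le_mul_left (hC x) _

/-- Schur's test for the operator `f ↦ ∫ κ(x, y, s) f(x, s) ds` on `L²` of the slab. -/
lemma exists_schur {κ : Horiz d → ℝ → ℝ → ℂ} (hκ : Measurable fun q : (Horiz d × ℝ) × ℝ =>
      κ q.1.1 q.1.2 q.2) (hb : ∀ x, ∃ B, ∀ y s, ‖κ x y s‖ ≤ B) {C : ℝ}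
    (hC : 0 ≤ C)
    (h1 : ∀ x, ∀ y ∈ Ioo 0 h, ∫⁻ s in Ioo 0 h, ‖κ x y s‖ₑ ≤ ENNReal.ofReal C)
    (h2 : ∀ x, ∀ s ∈ Ioo 0 h, ∫⁻ y in Ioo 0 h, ‖κ x y s‖ₑ ≤ ENNReal.ofReal C) :
    ∃ A : L2Slab d h ℂ →L[ℂ] L2Slab d h ℂ,
      ∀ f, A f =ᵐ[volume.restrict (slab d h)]
        fun p => ∫ s in Ioo 0 h, κ p.1 p.2 s * f (p.1, s) := by
  have hκx : ∀ x, Measurable fun q : ℝ × ℝ => κ x q.1 q.2 := fun x => by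
    have : Measurable fun q : ℝ × ℝ => (((x, q.1), q.2) : (Horiz d × ℝ) × ℝ) := by fun_prop
    exact hκ.comp this
  have hfx : ∀ (f : L2Slab d h ℂ) x, Measurable fun s => f (x, s) := fun f x =>
    (Lp.stronglyMeasurable f).measurable.comp measurable_prodMk_left
  have hmeas : ∀ f : L2Slab d h ℂ, StronglyMeasurable
      fun p : Horiz d × ℝ => ∫ s in Ioo 0 h, κ p.1 p.2 s * f (p.1, s) := fun f => by
    refine StronglyMeasurable.integral_prod_right' (ν := volume.restrict (Ioo 0 h))
      (f := fun q : (Horiz d × ℝ) × ℝ => κ q.1.1 q.1.2 q.2 * f (q.1.1, q.2)) ?_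
    refine (hκ.mul ((Lp.stronglyMeasurable f).measurable.comp ?_)).stronglyMeasurable
    fun_prop
  have hi : ∀ f : L2Slab d h ℂ, ∀ᵐ x : Horiz d, ∀ y,
      Integrable (fun s => κ x y s * f (x, s)) (volume.restrict (Ioo 0 h)) := fun f => by
    filter_upwards [integrable_slice_left f] with x hx y
    obtain ⟨B, hB⟩ := hb x
    exact hx.bdd_mul ((hκx x).comp measurable_prodMk_left).aestronglyMeasurable (c := B)
      (Eventually.of_forall fun s => hB y s)
  refine exists_clm_of_pointwise
    (fun f (p : Horiz d × ℝ) => ∫ s in Ioo 0 h, κ p.1 p.2 s * f (p.1, s)) (C * C)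
    (fun f => (hmeas f).aestronglyMeasurable) (fun f g => ?_) (fun a f => ?_) (fun f => ?_)
  · filter_upwards [ae_slab_fst (hi f), ae_slab_fst (hi g),
      ae_slab_fst (ae_slab_right (Lp.coeFn_add f g))] with p h1 h2 h3
    rw [Pi.add_apply, ← integral_add (h1 _) (h2 _)]
    refine integral_congr_ae ?_
    filter_upwards [h3] with y hy
    rw [hy, Pi.add_apply, mul_add]
  · filter_upwards [ae_slab_fst (ae_slab_right (Lp.coeFn_smul a f))] with p h3
    rw [Pi.smul_apply, ← integral_smul]
    refine integral_congr_ae ?_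
    filter_upwards [h3] with y hy
    rw [hy, Pi.smul_apply, smul_eq_mul, smul_eq_mul]; ring
  -- Cauchy–Schwarz for the measure `|κ| ds` uses the row bound; Tonelli's theorem then brings in
  -- the column bound
  · rw [lintegral_slab ((hmeas f).measurable.enorm.pow_const 2),
      lintegral_slab (measurable_enorm_sq f), ← lintegral_const_mul' _ _ ENNReal.ofReal_ne_top]
    refine lintegral_mono fun x => ?_
    have step : ∀ y ∈ Ioo 0 h, ‖∫ s in Ioo 0 h, κ x y s * f (x, s)‖ₑ ^ 2 ≤
        ENNReal.ofReal C * ∫⁻ s in Ioo 0 h, ‖κ x y s‖ₑ * ‖f (x, s)‖ₑ ^ 2 := fun y hy => by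
      refine (enorm_integral_mul_sq_le_weighted _
        ((hκx x).comp measurable_prodMk_left).aestronglyMeasurable
        (hfx f x).aestronglyMeasurable).trans ?_
      exact mul_le_mul_left (h1 x y hy) _
    refine (setLIntegral_mono' measurableSet_Ioo step).trans ?_
    rw [lintegral_const_mul' _ _ ENNReal.ofReal_ne_top, ENNReal.ofReal_mul hC, mul_assoc]
    gcongr
    rw [lintegral_lintegral_swap, ← lintegral_const_mul' _ _ ENNReal.ofReal_ne_top]
    · refine setLIntegral_mono' measurableSet_Ioo fun s hs => ?_
      rw [lintegral_mul_const]
      · gcongr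
        exact h2 x s hs
      · exact ((hκx x).comp measurable_prodMk_right).enorm
    · exact ((hκx x).enorm.mul (((hfx f x).comp measurable_snd).enorm.pow_const 2)).aemeasurable

end Slab

/-! ### Horizontal slices and operators acting slicewise -/

section Slices

variable {d : ℕ} {h : ℝ}

/-- The horizontal slice `f(·, y) ∈ L²(ℝᵈ)` of `f` in `L²` of the slab; it is defined for almost
every `y` and set to zero otherwise. -/
def slice (f : L2Slab d h ℂ) (y : ℝ) : L2Horiz d ℂ :=
  open Classical in
  if H : MemLp (fun x => f (x, y)) 2 (volume : Measure (Horiz d)) then H.toLp else 0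

lemma coeFn_slice (f : L2Slab d h ℂ) :
    ∀ᵐ y ∂(volume.restrict (Ioo 0 h)), slice f y =ᵐ[volume] fun x => f (x, y) := by
  have hm : ∀ y, Measurable fun x => f (x, y) := fun y =>
    (Lp.stronglyMeasurable f).measurable.comp measurable_prodMk_right
  have h0 : ∫⁻ y in Ioo 0 h, ∫⁻ x : Horiz d, ‖f (x, y)‖ₑ ^ 2 ≠ ⊤ := by
    rw [← lintegral_slab_symm (measurable_enorm_sq f), ← eLpNorm_two_sq]
    exact ENNReal.pow_ne_top (Lp.memLp f).2.ne
  filter_upwards [ae_lt_top (measurable_enorm_sq f).lintegral_prod_left' h0] with y hy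
  have H : MemLp (fun x => f (x, y)) 2 (volume : Measure (Horiz d)) := by
    refine ⟨(hm y).aestronglyMeasurable, (ENNReal.pow_lt_top_iff (n := 2)).mp ?_ |>.resolve_right
      two_ne_zero⟩
    rwa [eLpNorm_two_sq]
  rw [slice, dif_pos H]
  exact H.coeFn_toLp

lemma slice_ae_eq {f : L2Slab d h ℂ} {g : Horiz d × ℝ → ℂ}
    (H : f =ᵐ[volume.restrict (slab d h)] g) :
    ∀ᵐ y ∂(volume.restrict (Ioo 0 h)), slice f y =ᵐ[volume] fun x => g (x, y) := by
  filter_upwards [coeFn_slice f, ae_slab_left H] with y h1 h2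
  exact h1.trans h2

lemma slice_add (f g : L2Slab d h ℂ) :
    ∀ᵐ y ∂(volume.restrict (Ioo 0 h)), slice (f + g) y = slice f y + slice g y := by
  filter_upwards [coeFn_slice f, coeFn_slice g, slice_ae_eq (Lp.coeFn_add f g)] with y h1 h2 h3
  refine Lp.ext ?_
  filter_upwards [h1, h2, h3, Lp.coeFn_add (slice f y) (slice g y)] with x e1 e2 e3 e4
  rw [e3, e4, Pi.add_apply, Pi.add_apply, e1, e2]

lemma slice_smul (c : ℂ) (f : L2Slab d h ℂ) :
    ∀ᵐ y ∂(volume.restrict (Ioo 0 h)), slice (c • f) y = c • slice f y := by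
  filter_upwards [coeFn_slice f, slice_ae_eq (Lp.coeFn_smul c f)] with y h1 h3
  refine Lp.ext ?_
  filter_upwards [h1, h3, Lp.coeFn_smul c (slice f y)] with x e1 e3 e4
  rw [e3, e4, Pi.smul_apply, Pi.smul_apply, e1]

lemma lintegral_enorm_slice (f : L2Slab d h ℂ) :
    ∫⁻ y in Ioo 0 h, ‖slice f y‖ₑ ^ 2 = ‖f‖ₑ ^ 2 := by
  rw [Lp.enorm_def, eLpNorm_two_sq, lintegral_slab_symm (measurable_enorm_sq f)]
  refine lintegral_congr_ae ?_
  filter_upwards [coeFn_slice f] with y hy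
  rw [Lp.enorm_def, eLpNorm_two_sq]
  refine lintegral_congr_ae ?_
  filter_upwards [hy] with x hx
  rw [hx]

lemma eq_zero_of_slice {f : L2Slab d h ℂ}
    (H : ∀ᵐ y ∂(volume.restrict (Ioo 0 h)), slice f y = 0) : f = 0 := by
  have h0 := lintegral_enorm_slice f
  rw [lintegral_congr_ae (g := 0) (by filter_upwards [H] with y hy; simp [hy])] at h0
  simpa using h0.symm

lemma eq_of_slice {f g : L2Slab d h ℂ}
    (H : ∀ᵐ y ∂(volume.restrict (Ioo 0 h)), slice f y = slice g y) : f = g := by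
  rw [← sub_eq_zero]
  refine eq_zero_of_slice ?_
  filter_upwards [H, slice_add f ((-1 : ℂ) • g), slice_smul (-1) g] with y h1 h2 h3
  rw [sub_eq_add_neg, ← neg_one_smul ℂ g, h2, h3, h1, neg_one_smul, add_neg_cancel]

lemma lintegral_indicator_enorm_sq_le (B : Set ℝ) (h : ℝ) :
    ∫⁻ y in Ioo 0 h, ‖B.indicator (fun _ => (1 : ℂ)) y‖ₑ ^ 2 ≤ ENNReal.ofReal h := by
  calc ∫⁻ y in Ioo 0 h, ‖B.indicator (fun _ => (1 : ℂ)) y‖ₑ ^ 2 ≤ ∫⁻ y in Ioo 0 h, 1 := by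
        refine lintegral_mono fun y => ?_
        by_cases hy : y ∈ B <;> simp [hy]
    _ ≤ ENNReal.ofReal h := by simp

lemma exists_tensor (d : ℕ) (h : ℝ) {B : Set ℝ} (hB : MeasurableSet B) :
    ∃ A : L2Horiz d ℂ →L[ℂ] L2Slab d h ℂ, ∀ φ, A φ =ᵐ[volume.restrict (slab d h)]
      fun p => B.indicator (fun _ => (1 : ℂ)) p.2 * φ p.1 :=
  exists_kernelMul (m := fun p => B.indicator (fun _ => (1 : ℂ)) p.2) (C := h)
    ((measurable_const.indicator hB).comp measurable_snd)
    (fun _ => lintegral_indicator_enorm_sq_le B h)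

/-- The elementary tensor `(x, y) ↦ 1_B(y) φ(x)`. -/
def tensor {B : Set ℝ} (hB : MeasurableSet B) : L2Horiz d ℂ →L[ℂ] L2Slab d h ℂ :=
  (exists_tensor d h hB).choose

lemma coeFn_tensor {B : Set ℝ} (hB : MeasurableSet B) (φ : L2Horiz d ℂ) :
    (tensor hB φ : L2Slab d h ℂ) =ᵐ[volume.restrict (slab d h)]
      fun p => B.indicator (fun _ => (1 : ℂ)) p.2 * φ p.1 :=
  (exists_tensor d h hB).choose_spec φ

lemma slice_tensor {B : Set ℝ} (hB : MeasurableSet B) (φ : L2Horiz d ℂ) :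
    ∀ᵐ y ∂(volume.restrict (Ioo 0 h)), slice (tensor hB φ : L2Slab d h ℂ) y =
      B.indicator (fun _ => (1 : ℂ)) y • φ := by
  filter_upwards [slice_ae_eq (coeFn_tensor (h := h) hB φ)] with y hy
  refine Lp.ext ?_
  filter_upwards [hy, Lp.coeFn_smul (B.indicator (fun _ => (1 : ℂ)) y) φ] with x h1 h2
  rw [h1, h2, Pi.smul_apply, smul_eq_mul]

lemma integrable_inner_slab (f g : L2Slab d h ℂ) :
    Integrable (fun p => inner ℂ (f p) (g p))
      ((volume : Measure (Horiz d)).prod (volume.restrict (Ioo 0 h))) := by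
  rw [← volume_restrict_slab]; exact L2.integrable_inner f g

lemma inner_slice (f g : L2Slab d h ℂ) :
    ∀ᵐ y ∂(volume.restrict (Ioo 0 h)),
      inner ℂ (slice f y) (slice g y) = ∫ x : Horiz d, inner ℂ (f (x, y)) (g (x, y)) := by
  filter_upwards [coeFn_slice f, coeFn_slice g] with y h1 h2
  rw [L2.inner_def]
  refine integral_congr_ae ?_
  filter_upwards [h1, h2] with x e1 e2
  rw [e1, e2]

lemma integrable_inner_slice (f g : L2Slab d h ℂ) :
    Integrable (fun y => inner ℂ (slice f y) (slice g y)) (volume.restrict (Ioo 0 h)) := by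
  refine (integrable_inner_slab f g).integral_prod_right.congr ?_
  filter_upwards [inner_slice f g] with y hy
  exact hy.symm

lemma inner_eq_integral_slice (f g : L2Slab d h ℂ) :
    inner ℂ f g = ∫ y in Ioo 0 h, inner ℂ (slice f y) (slice g y) := by
  rw [L2.inner_def, integral_slab_symm (L2.integrable_inner f g)]
  exact integral_congr_ae ((inner_slice f g).mono fun y hy => hy.symm)

lemma integrable_inner_const_slice (φ : L2Horiz d ℂ) (f : L2Slab d h ℂ) :
    Integrable (fun y => inner ℂ φ (slice f y)) (volume.restrict (Ioo 0 h)) := by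
  refine (integrable_inner_slice (tensor MeasurableSet.univ φ) f).congr ?_
  filter_upwards [slice_tensor (h := h) MeasurableSet.univ φ] with y hy
  rw [hy]; simp

lemma inner_tensor {B : Set ℝ} (hB : MeasurableSet B) (φ : L2Horiz d ℂ) (f : L2Slab d h ℂ) :
    inner ℂ (tensor hB φ) f =
      ∫ y in B, inner ℂ φ (slice f y) ∂(volume.restrict (Ioo 0 h)) := by
  rw [inner_eq_integral_slice, ← integral_indicator hB]
  refine integral_congr_ae ?_
  filter_upwards [slice_tensor (h := h) hB φ] with y hy
  rw [hy]
  by_cases hyB : y ∈ B <;> simp [hyB]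

/-- A vector-valued form of the fundamental lemma: it suffices to test slices against elementary
tensors, because `L²(ℝᵈ)` is separable. -/
lemma ae_eq_of_forall_inner {u v : ℝ → L2Horiz d ℂ}
    (hu : ∀ φ, Integrable (fun y => inner ℂ φ (u y)) (volume.restrict (Ioo 0 h)))
    (hv : ∀ φ, Integrable (fun y => inner ℂ φ (v y)) (volume.restrict (Ioo 0 h)))
    (H : ∀ φ B, MeasurableSet B → ∫ y in B, inner ℂ φ (u y) ∂(volume.restrict (Ioo 0 h)) =
      ∫ y in B, inner ℂ φ (v y) ∂(volume.restrict (Ioo 0 h))) :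
    ∀ᵐ y ∂(volume.restrict (Ioo 0 h)), u y = v y := by
  have key : ∀ φ : L2Horiz d ℂ, ∀ᵐ y ∂(volume.restrict (Ioo 0 h)),
      inner ℂ φ (u y) = inner ℂ φ (v y) := fun φ =>
    (hu φ).ae_eq_of_forall_setIntegral_eq _ _ (hv φ) fun B hB _ => H φ B hB
  have : Fact ((2 : ℝ≥0∞) ≠ ⊤) := ⟨by norm_num⟩
  have key2 := ae_all_iff.mpr fun n => key (TopologicalSpace.denseSeq (L2Horiz d ℂ) n)
  filter_upwards [key2] with y hy
  refine ext_inner_left ℂ fun φ => ?_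
  exact congrFun (DenseRange.equalizer (TopologicalSpace.denseRange_denseSeq (L2Horiz d ℂ))
    (g := fun φ => (inner ℂ φ (u y) : ℂ)) (h := fun φ => (inner ℂ φ (v y) : ℂ)) (by fun_prop)
    (by fun_prop) (funext hy)) φ

/-- The elementary tensors `1_B(y) φ(x)`, with `B` measurable and `φ ∈ L²(ℝᵈ)`. -/
def tensors (d : ℕ) (h : ℝ) : Set (L2Slab d h ℂ) :=
  {f | ∃ (B : Set ℝ) (hB : MeasurableSet B) (φ : L2Horiz d ℂ), f = tensor hB φ}

lemma dense_span_tensors : Dense (Submodule.span ℂ (tensors d h) : Set (L2Slab d h ℂ)) := by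
  rw [Submodule.dense_iff_topologicalClosure_eq_top, Submodule.topologicalClosure_eq_top_iff,
    Submodule.eq_bot_iff]
  intro f hf
  have hf' : ∀ (B : Set ℝ) (hB : MeasurableSet B) (φ : L2Horiz d ℂ),
      inner ℂ (tensor hB φ) f = 0 := fun B hB φ =>
    (Submodule.mem_orthogonal _ _).mp hf _ (Submodule.subset_span ⟨B, hB, φ, rfl⟩)
  refine eq_zero_of_slice (ae_eq_of_forall_inner (fun φ => integrable_inner_const_slice φ f)
    (v := fun _ => 0) (by simp) fun φ B hB => ?_)
  rw [← inner_tensor hB, hf' B hB φ]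
  simp

/-- `F(·, y) = L f(·, y)` for almost every `y`. Stated as a relation, since the slicewise image
of `f` is not known in advance to come from an element of `L²` of the slab. -/
def SliceRel (L : L2Horiz d ℂ →L[ℂ] L2Horiz d ℂ) (f F : L2Slab d h ℂ) : Prop :=
  ∀ᵐ y ∂(volume.restrict (Ioo 0 h)), slice F y = L (slice f y)

variable {L : L2Horiz d ℂ →L[ℂ] L2Horiz d ℂ}

lemma SliceRel.add {f F g G : L2Slab d h ℂ} (H : SliceRel L f F) (H' : SliceRel L g G) :
    SliceRel L (f + g) (F + G) := by
  filter_upwards [H, H', slice_add f g, slice_add F G] with y h1 h2 h3 h4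
  rw [h4, h3, h1, h2, map_add]

lemma SliceRel.smul (c : ℂ) {f F : L2Slab d h ℂ} (H : SliceRel L f F) :
    SliceRel L (c • f) (c • F) := by
  filter_upwards [H, slice_smul c f, slice_smul c F] with y h1 h3 h4
  rw [h4, h3, h1, map_smul]

lemma SliceRel.sub {f F g G : L2Slab d h ℂ} (H : SliceRel L f F) (H' : SliceRel L g G) :
    SliceRel L (f - g) (F - G) := by
  have := H.add (H'.smul (-1))
  simpa [sub_eq_add_neg] using this

lemma SliceRel.unique {f F G : L2Slab d h ℂ} (H : SliceRel L f F) (H' : SliceRel L f G) :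
    F = G :=
  eq_of_slice (by filter_upwards [H, H'] with y h1 h2; rw [h1, h2])

lemma SliceRel.norm_le {f F : L2Slab d h ℂ} (H : SliceRel L f F) : ‖F‖ ≤ ‖L‖ * ‖f‖ := by
  have h1 : ‖F‖ₑ ^ 2 ≤ (‖L‖ₑ * ‖f‖ₑ) ^ 2 := by
    rw [mul_pow, ← lintegral_enorm_slice, ← lintegral_enorm_slice,
      ← lintegral_const_mul' _ _ (by finiteness)]
    refine lintegral_mono_ae ?_
    filter_upwards [H] with y hy
    rw [hy, ← mul_pow]
    exact pow_le_pow_left' (L.le_opENorm _) 2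
  rw [ENNReal.pow_le_pow_left_iff two_ne_zero] at h1
  simpa using ENNReal.toReal_mono (by finiteness) h1

lemma sliceRel_tensor {B : Set ℝ} (hB : MeasurableSet B) (φ : L2Horiz d ℂ) :
    SliceRel L (tensor hB φ : L2Slab d h ℂ) (tensor hB (L φ)) := by
  filter_upwards [slice_tensor (h := h) hB φ, slice_tensor (h := h) hB (L φ)] with y h1 h2
  rw [h1, h2, map_smul]

/-- A weak form of `SliceRel`, from which it is seen to be a closed relation. -/
lemma sliceRel_iff {f F : L2Slab d h ℂ} : SliceRel L f F ↔
    ∀ (B : Set ℝ) (hB : MeasurableSet B) (φ : L2Horiz d ℂ),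
      inner ℂ (tensor hB φ) F = inner ℂ (tensor hB (L.adjoint φ)) f := by
  constructor
  · intro H B hB φ
    rw [inner_tensor, inner_tensor]
    refine integral_congr_ae (ae_restrict_of_ae ?_)
    filter_upwards [H] with y hy
    rw [hy, ContinuousLinearMap.adjoint_inner_left]
  · intro H
    refine ae_eq_of_forall_inner (fun φ => integrable_inner_const_slice φ F) (fun φ => ?_)
      fun φ B hB => ?_
    · simpa only [ContinuousLinearMap.adjoint_inner_left] using
        integrable_inner_const_slice (L.adjoint φ) f
    · have := H B hB φ
      rw [inner_tensor, inner_tensor] at this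
      simpa only [ContinuousLinearMap.adjoint_inner_left] using this

lemma isClosed_sliceRel (L : L2Horiz d ℂ →L[ℂ] L2Horiz d ℂ) :
    IsClosed {q : L2Slab d h ℂ × L2Slab d h ℂ | SliceRel L q.1 q.2} := by
  simp only [sliceRel_iff, ofPred_forall]
  refine isClosed_iInter fun B => isClosed_iInter fun hB => isClosed_iInter fun φ => ?_
  exact isClosed_eq (by fun_prop) (by fun_prop)

/-- The slicewise image of `f` exists for elementary tensors, and for their limits because the norm
of the image is at most `‖L‖ ‖f‖`. -/
lemma exists_sliceRel (L : L2Horiz d ℂ →L[ℂ] L2Horiz d ℂ) (f : L2Slab d h ℂ) :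
    ∃ F, SliceRel L f F := by
  let P : Submodule ℂ (L2Slab d h ℂ) :=
    { carrier := {f | ∃ F, SliceRel L f F}
      zero_mem' := ⟨0, by
        filter_upwards [slice_smul (0 : ℂ) (0 : L2Slab d h ℂ)] with y hy
        rw [zero_smul, zero_smul] at hy
        simp only [hy, map_zero]⟩
      add_mem' := fun ⟨F, hF⟩ ⟨G, hG⟩ => ⟨F + G, hF.add hG⟩
      smul_mem' := fun c _ ⟨F, hF⟩ => ⟨c • F, hF.smul c⟩ }
  have hle : Submodule.span ℂ (tensors d h) ≤ P := by
    rw [Submodule.span_le]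
    rintro _ ⟨B, hB, φ, rfl⟩
    exact ⟨_, sliceRel_tensor hB φ⟩
  obtain ⟨u, hu, hlim⟩ := mem_closure_iff_seq_limit.mp (dense_span_tensors f)
  choose F hF using fun n => hle (hu n)
  have hC : CauchySeq F := by
    rw [Metric.cauchySeq_iff']
    intro ε hε
    obtain ⟨N, hN⟩ := Metric.cauchySeq_iff'.mp hlim.cauchySeq (ε / (‖L‖ + 1)) (by positivity)
    refine ⟨N, fun n hn => ?_⟩
    rw [dist_eq_norm]
    refine ((hF n).sub (hF N)).norm_le.trans_lt ?_
    have h1 := hN n hn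
    rw [dist_eq_norm, lt_div_iff₀ (by positivity)] at h1
    nlinarith [norm_nonneg (u n - u N), norm_nonneg L]
  obtain ⟨G, hG⟩ := cauchySeq_tendsto_of_complete hC
  exact ⟨G, (isClosed_sliceRel L).mem_of_tendsto (hlim.prodMk_nhds hG)
    (Eventually.of_forall hF)⟩

/-- The operator on `L²` of the slab that applies `L` to almost every horizontal slice. -/
def sliceMap (L : L2Horiz d ℂ →L[ℂ] L2Horiz d ℂ) : L2Slab d h ℂ →L[ℂ] L2Slab d h ℂ :=
  LinearMap.mkContinuous
    { toFun := fun f => (exists_sliceRel L f).choose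
      map_add' := fun f g => (exists_sliceRel L (f + g)).choose_spec.unique
        ((exists_sliceRel L f).choose_spec.add (exists_sliceRel L g).choose_spec)
      map_smul' := fun c f => (exists_sliceRel L (c • f)).choose_spec.unique
        ((exists_sliceRel L f).choose_spec.smul c) }
    ‖L‖ fun f => (exists_sliceRel L f).choose_spec.norm_le

lemma sliceRel_sliceMap (L : L2Horiz d ℂ →L[ℂ] L2Horiz d ℂ) (f : L2Slab d h ℂ) :
    SliceRel L f (sliceMap L f) := (exists_sliceRel L f).choose_spec

lemma SliceRel.eq_sliceMap {f F : L2Slab d h ℂ} (H : SliceRel L f F) : sliceMap L f = F :=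
  (sliceRel_sliceMap L f).unique H

lemma sliceMap_sliceMap (L L' : L2Horiz d ℂ →L[ℂ] L2Horiz d ℂ) (H : ∀ φ, L (L' φ) = φ)
    (f : L2Slab d h ℂ) : sliceMap L (sliceMap L' f) = f := by
  refine SliceRel.eq_sliceMap ?_
  filter_upwards [sliceRel_sliceMap L' f] with y hy
  rw [hy, H]

lemma coeFn_vertInt {𝕂 : Type*} [RCLike 𝕂] (b : ℝ) (f : L2Slab d h 𝕂) :
    vertInt b f =ᵐ[volume] fun x => ∫ y in Ioo 0 (min b h), f (x, y) :=
  (memLp_vertInt b f).coeFn_toLp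

lemma setIntegral_Ioo_min (b h : ℝ) (u : ℝ → ℂ) : ∫ y in Ioo 0 (min b h), u y =
    ∫ y in Ioo 0 h, (Iio b).indicator (fun _ => (1 : ℂ)) y * u y := by
  have : Ioo 0 (min b h) = Ioo 0 h ∩ Iio b := by
    ext y; simp only [mem_Ioo, mem_inter_iff, mem_Iio, lt_min_iff]; tauto
  rw [this, ← setIntegral_indicator measurableSet_Iio]
  refine integral_congr_ae (Eventually.of_forall fun y => ?_)
  by_cases hy : y ∈ Iio b <;> simp [hy]

lemma continuous_vertInt (b : ℝ) : Continuous (vertInt b : L2Slab d h ℂ →ₗ[ℂ] L2Horiz d ℂ) := by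
  obtain ⟨A, hA⟩ := exists_kernelInt (d := d) (h := h)
    (m := fun p => (Iio b).indicator (fun _ => (1 : ℂ)) p.2) (C := h)
    ((measurable_const.indicator measurableSet_Iio).comp measurable_snd)
    (fun _ => lintegral_indicator_enorm_sq_le _ h)
  refine A.continuous.congr fun f => Lp.ext ?_
  filter_upwards [hA f, coeFn_vertInt b f] with x h1 h2
  rw [h1, h2, setIntegral_Ioo_min]

lemma vertInt_tensor (b : ℝ) {B : Set ℝ} (hB : MeasurableSet B) (φ : L2Horiz d ℂ) :
    vertInt b (tensor hB φ : L2Slab d h ℂ) =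
      (∫ y in Ioo 0 (min b h), B.indicator (fun _ => (1 : ℂ)) y) • φ := by
  refine Lp.ext ?_
  filter_upwards [coeFn_vertInt b (tensor hB φ : L2Slab d h ℂ),
    ae_slab_right (coeFn_tensor (h := h) hB φ), Lp.coeFn_smul
      (∫ y in Ioo 0 (min b h), B.indicator (fun _ => (1 : ℂ)) y) φ] with x h1 h2 h3
  rw [h1, h3, Pi.smul_apply, smul_eq_mul, ← integral_mul_const]
  exact integral_congr_ae (ae_mono (Measure.restrict_mono
    (Ioo_subset_Ioo_right (min_le_right _ _)) le_rfl) h2)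

/-- Operators acting in the horizontal variable commute with vertical integration: it suffices to
check this on elementary tensors. -/
lemma vertInt_sliceMap (b : ℝ) (L : L2Horiz d ℂ →L[ℂ] L2Horiz d ℂ) (f : L2Slab d h ℂ) :
    vertInt b (sliceMap L f) = L (vertInt b f) := by
  let V : L2Slab d h ℂ →L[ℂ] L2Horiz d ℂ := ⟨vertInt b, continuous_vertInt b⟩
  have : V ∘L sliceMap L = L ∘L V := by
    refine ContinuousLinearMap.ext_on dense_span_tensors ?_
    rintro _ ⟨B, hB, φ, rfl⟩
    change vertInt b (sliceMap L (tensor hB φ)) = L (vertInt b (tensor hB φ))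
    rw [(sliceRel_tensor hB φ).eq_sliceMap, vertInt_tensor, vertInt_tensor, map_smul]
  exact congrArg (fun A => A f) this

end Slices

/-! ### Vertical primitives, their traces and weak derivatives -/

section Primitive

variable {d : ℕ} {h : ℝ}

/-- The Volterra operators `f ↦ c(x) ∫_{(0, y)} exp(-k(x) (y - s)) f(x, s) ds`. One
power of `k` is gained, since `k ∫ exp(-k t) dt ≤ 1`: the multiplier `c` may grow like `1 + k`. -/
lemma exists_volterra (hh : 0 ≤ h) {k : Horiz d → ℝ} (hk : Measurable k) (hk0 : ∀ x, 0 ≤ k x)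
    {c : Horiz d → ℂ} (hc : Measurable c) {C : ℝ} (hC : 0 ≤ C)
    (hcC : ∀ x, ‖c x‖ ≤ C * (1 + k x)) :
    ∃ A : L2Slab d h ℂ →L[ℂ] L2Slab d h ℂ, ∀ f, A f =ᵐ[volume.restrict (slab d h)]
      fun p => c p.1 * ∫ s in Ioo 0 p.2, (Real.exp (-(k p.1 * (p.2 - s))) : ℂ) * f (p.1, s) := by
  -- integrating the kernel over `0 < t < h`
  have hexp : ∀ x, ∫⁻ t in Ioo 0 h, ENNReal.ofReal (Real.exp (-(k x * t))) * ‖c x‖ₑ ≤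
        ENNReal.ofReal (C * (1 + h)) := by
    intro x
    have h1 : ∫⁻ t in Ioo 0 h, ENNReal.ofReal (Real.exp (-(k x * t))) =
        ENNReal.ofReal (∫ t in (0)..h, Real.exp (-(k x * t))) := by
      rw [intervalIntegral.integral_of_le hh, integral_Ioc_eq_integral_Ioo,
        ofReal_integral_eq_lintegral_ofReal]
      · exact (Continuous.integrableOn_Icc (by fun_prop)).mono_set Ioo_subset_Icc_self
      · exact Eventually.of_forall fun t => (Real.exp_pos _).le
    rw [lintegral_mul_const' _ _ (by finiteness), h1, ← ofReal_norm, ← ENNReal.ofReal_mul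
      (intervalIntegral.integral_nonneg hh fun t _ => (Real.exp_pos _).le)]
    refine ENNReal.ofReal_le_ofReal ?_
    set J := ∫ t in (0)..h, Real.exp (-(k x * t)) with hJ
    have hJ0 : 0 ≤ J := intervalIntegral.integral_nonneg hh fun t _ => (Real.exp_pos _).le
    have hJb : J ≤ h := by
      have : J ≤ ∫ t in (0)..h, (1 : ℝ) := by
        refine intervalIntegral.integral_mono_on hh
          (Continuous.intervalIntegrable (by fun_prop) _ _) (by simp) fun t ht => ?_
        rw [Real.exp_le_one_iff]
        have := mul_nonneg (hk0 x) ht.1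
        linarith
      simpa using this
    have hJk : k x * J ≤ 1 := by
      have hd : ∀ t ∈ uIcc 0 h, HasDerivAt (fun t => -Real.exp (-(k x * t)))
          (k x * Real.exp (-(k x * t))) t := fun t _ => by
        have := ((hasDerivAt_id t).const_mul (k x)).neg.exp.neg
        exact this.congr_deriv (by simp [mul_comm])
      rw [hJ, ← intervalIntegral.integral_const_mul, intervalIntegral.integral_eq_sub_of_hasDerivAt
        hd (Continuous.intervalIntegrable (by fun_prop) _ _)]
      simp [Real.exp_nonneg]
    calc J * ‖c x‖ ≤ J * (C * (1 + k x)) := by gcongr; exact hcC x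
      _ = C * (J + k x * J) := by ring
      _ ≤ C * (1 + h) := by
        refine mul_le_mul_of_nonneg_left ?_ hC
        linarith
  let κ : Horiz d → ℝ → ℝ → ℂ := fun x y s =>
    c x * (Iio y).indicator (fun s => (Real.exp (-(k x * (y - s))) : ℂ)) s
  have hκn : ∀ x y s, ‖κ x y s‖ₑ = (Iio y).indicator
      (fun s => ENNReal.ofReal (Real.exp (-(k x * (y - s)))) * ‖c x‖ₑ) s := fun x y s => by
    by_cases hs : s ∈ Iio y
    · simp only [κ, indicator_of_mem hs, enorm_mul]
      rw [mul_comm, ← ofReal_norm (Complex.ofReal _), Complex.norm_real,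
        Real.norm_of_nonneg (Real.exp_pos _).le]
    · simp [κ, indicator_of_notMem hs]
  have hκm : Measurable fun q : (Horiz d × ℝ) × ℝ => κ q.1.1 q.1.2 q.2 := by
    have e : (fun q : (Horiz d × ℝ) × ℝ => κ q.1.1 q.1.2 q.2) = fun q => c q.1.1 *
        ({q : (Horiz d × ℝ) × ℝ | q.2 < q.1.2}.indicator
          (fun q => (Real.exp (-(k q.1.1 * (q.1.2 - q.2))) : ℂ)) q) := by
      ext q
      simp only [κ, indicator, mem_Iio, mem_ofPred_eq]
    rw [e]
    refine (hc.comp (measurable_fst.comp measurable_fst)).mul (Measurable.indicator ?_ ?_)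
    · fun_prop
    · exact measurableSet_lt (by fun_prop) (by fun_prop)
  let G : Horiz d → ℝ → ℝ≥0∞ := fun x => (Ioo 0 h).indicator
    fun t => ENNReal.ofReal (Real.exp (-(k x * t))) * ‖c x‖ₑ
  have hG : ∀ x, ∫⁻ t, G x t ≤ ENNReal.ofReal (C * (1 + h)) := fun x => by
    rw [lintegral_indicator measurableSet_Ioo]; exact hexp x
  have hκG : ∀ x, ∀ y ∈ Ioo 0 h, ∀ s ∈ Ioo 0 h, ‖κ x y s‖ₑ ≤ G x (y - s) := fun x y hy s hs => by
    rw [hκn]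
    by_cases hsy : s ∈ Iio y
    · rw [indicator_of_mem hsy]
      have : y - s ∈ Ioo 0 h := ⟨sub_pos.mpr hsy, by linarith [hy.2, hs.1]⟩
      simp only [G]
      rw [indicator_of_mem this]
    · simp [indicator_of_notMem hsy]
  have hbd : ∀ x, ∃ B, ∀ y s, ‖κ x y s‖ ≤ B := fun x => ⟨‖c x‖, fun y s => by
    have h1 := hκn x y s
    rw [← ofReal_norm, ← ofReal_norm] at h1
    refine (ENNReal.ofReal_le_ofReal_iff (norm_nonneg _)).mp ?_
    rw [h1]
    by_cases hs : s ∈ Iio y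
    · rw [indicator_of_mem hs]
      refine mul_le_of_le_one_left' ?_
      rw [ENNReal.ofReal_le_one, Real.exp_le_one_iff]
      have := mul_nonneg (hk0 x) (sub_nonneg.mpr (le_of_lt hs))
      linarith
    · simp [indicator_of_notMem hs]⟩
  obtain ⟨A, hA⟩ := exists_schur (d := d) (h := h) (κ := κ) hκm hbd (C := C * (1 + h))
    (by positivity)
    (fun x y hy => by
      refine (setLIntegral_mono' measurableSet_Ioo fun s hs => hκG x y hy s hs).trans ?_
      refine (setLIntegral_le_lintegral _ _).trans ?_
      rw [lintegral_sub_left_eq_self (G x) y]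
      exact hG x)
    (fun x s hs => by
      refine (setLIntegral_mono' measurableSet_Ioo fun y hy => hκG x y hy s hs).trans ?_
      refine (setLIntegral_le_lintegral _ _).trans ?_
      rw [lintegral_sub_right_eq_self (G x) s]
      exact hG x)
  refine ⟨A, fun f => ?_⟩
  filter_upwards [hA f, ae_restrict_mem (isOpen_slab d h).measurableSet] with p hp hmem
  have hy : p.2 ≤ h := hmem.2.2.le
  have hset : Ioo 0 p.2 = Ioo 0 h ∩ Iio p.2 := by
    ext s; simp only [mem_Ioo, mem_inter_iff, mem_Iio]; constructor
    · rintro ⟨h1, h2⟩; exact ⟨⟨h1, h2.trans_le hy⟩, h2⟩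
    · rintro ⟨⟨h1, _⟩, h3⟩; exact ⟨h1, h3⟩
  rw [hp, ← integral_const_mul, hset, ← setIntegral_indicator measurableSet_Iio]
  refine integral_congr_ae (Eventually.of_forall fun s => ?_)
  by_cases hs : s ∈ Iio p.2
  · simp only [κ, indicator_of_mem hs, mul_assoc]
  · simp [κ, indicator_of_notMem hs]

lemma exists_primitive (d : ℕ) (hh : 0 ≤ h) :
    ∃ A : L2Slab d h ℂ →L[ℂ] L2Slab d h ℂ, ∀ f, A f =ᵐ[volume.restrict (slab d h)]
      fun p => ∫ s in Ioo 0 p.2, f (p.1, s) := by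
  obtain ⟨A, hA⟩ := exists_volterra (d := d) hh (k := fun _ => 0) measurable_const (fun _ => le_rfl)
    (c := fun _ => 1) measurable_const (C := 1) zero_le_one (by simp)
  exact ⟨A, fun f => (hA f).trans (Eventually.of_forall fun p => by simp)⟩

/-- The vertical primitive `(x, y) ↦ ∫_{(0, y)} f(x, s) ds`. -/
def primitive (hh : 0 ≤ h) : L2Slab d h ℂ →L[ℂ] L2Slab d h ℂ := (exists_primitive d hh).choose

lemma coeFn_primitive (hh : 0 ≤ h) (f : L2Slab d h ℂ) :
    primitive hh f =ᵐ[volume.restrict (slab d h)] fun p => ∫ s in Ioo 0 p.2, f (p.1, s) :=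
  (exists_primitive d hh).choose_spec f

lemma slice_primitive (hh : 0 ≤ h) (f : L2Slab d h ℂ) :
    ∀ᵐ y ∂(volume.restrict (Ioo 0 h)), slice (primitive hh f) y = vertInt y f := by
  filter_upwards [slice_ae_eq (coeFn_primitive hh f), ae_restrict_mem measurableSet_Ioo]
    with y hy hmem
  refine Lp.ext ?_
  filter_upwards [hy, coeFn_vertInt y f] with x h1 h2
  rw [h1, h2, min_eq_left hmem.2.le]

lemma sliceMap_primitive (hh : 0 ≤ h) (L : L2Horiz d ℂ →L[ℂ] L2Horiz d ℂ) (f : L2Slab d h ℂ) :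
    sliceMap L (primitive hh f) = primitive hh (sliceMap L f) := by
  refine SliceRel.eq_sliceMap ?_
  filter_upwards [slice_primitive hh f, slice_primitive hh (sliceMap L f)] with y h1 h2
  rw [h1, h2, vertInt_sliceMap]

lemma _root_.AbsolutelyContinuousOnInterval.comp_lipschitz {X Y : Type*} [PseudoMetricSpace X]
    [PseudoMetricSpace Y] {f : ℝ → X} {a b : ℝ} (hf : AbsolutelyContinuousOnInterval f a b)
    {g : X → Y} {K : NNReal} (hg : LipschitzWith K g) :
    AbsolutelyContinuousOnInterval (fun t => g (f t)) a b := by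
  refine squeeze_zero (fun t => Finset.sum_nonneg fun i _ => dist_nonneg) (fun t => ?_)
    (by simpa using Tendsto.const_mul (K : ℝ) hf)
  rw [Finset.mul_sum]
  exact Finset.sum_le_sum fun i _ => hg.dist_le_mul _ _

/-- The primitive of a complex-valued integrable function is absolutely continuous; the real and
the imaginary part are treated separately. -/
lemma absolutelyContinuousOnInterval_primitive {u : ℝ → ℂ} (hh : 0 ≤ h)
    (hu : Integrable u (volume.restrict (Ioo 0 h))) :
    AbsolutelyContinuousOnInterval (fun y => ∫ s in (0)..y, u s) 0 h := by
  have hi : IntervalIntegrable u volume 0 h := by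
    rwa [intervalIntegrable_iff_integrableOn_Ioo_of_le hh]
  have hre := (IntervalIntegrable.absolutelyContinuousOnInterval_intervalIntegral
    (f := fun s => (u s).re) (a := 0) (b := h) (c := 0)
    ⟨hi.1.re, hi.2.re⟩ left_mem_uIcc).comp_lipschitz Complex.ofRealCLM.lipschitz
  have him := ((IntervalIntegrable.absolutelyContinuousOnInterval_intervalIntegral
    (f := fun s => (u s).im) (a := 0) (b := h) (c := 0)
    ⟨hi.1.im, hi.2.im⟩ left_mem_uIcc).comp_lipschitz Complex.ofRealCLM.lipschitz).const_smul
      Complex.I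
  have hsum := hre.add him
  rw [absolutelyContinuousOnInterval_iff] at hsum ⊢
  intro ε hε
  obtain ⟨δ, hδ, H⟩ := hsum ε hε
  refine ⟨δ, hδ, fun E hE hlt => ?_⟩
  have hval : ∀ y ∈ uIcc 0 h, ∫ s in (0)..y, u s = ((fun t => Complex.ofRealCLM
      (∫ s in (0)..t, (u s).re)) + fun t => Complex.I • Complex.ofRealCLM
      (∫ s in (0)..t, (u s).im)) y := fun y hy => by
    have hiy : IntervalIntegrable u volume 0 y :=
      hi.mono_set (uIcc_subset_uIcc left_mem_uIcc hy)
    have e1 := Complex.reCLM.intervalIntegral_comp_comm hiy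
    have e2 := Complex.imCLM.intervalIntegral_comp_comm hiy
    simp only [Complex.reCLM_apply, Complex.imCLM_apply] at e1 e2
    rw [Pi.add_apply, e1, e2]
    apply Complex.ext <;> simp
  refine (Finset.sum_congr rfl fun i hi => ?_).trans_lt (H E hE hlt)
  rw [hval _ (hE.1 i hi).1, hval _ (hE.1 i hi).2]

/-- A vertical primitive vanishes on the bottom of the slab, and its trace at height `b` is the
vertical integral up to `b`. -/
lemma hasTrace_primitive (hh : 0 ≤ h) (f : L2Slab d h ℂ) {b : ℝ} (hb : b ∈ Icc 0 h) :
    HasTrace h b (primitive hh f) (vertInt b f) := by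
  refine ⟨fun p => ∫ s in (0)..p.2, f (p.1, s), ?_, ?_, ?_⟩
  · filter_upwards [coeFn_primitive hh f, ae_restrict_mem (isOpen_slab d h).measurableSet]
      with p hp hmem
    rw [hp, intervalIntegral.integral_of_le hmem.2.1.le, integral_Ioc_eq_integral_Ioo]
  · filter_upwards [integrable_slice_left f] with x hx
    exact absolutelyContinuousOnInterval_primitive hh hx
  · filter_upwards [coeFn_vertInt b f] with x hx
    rw [hx, intervalIntegral.integral_of_le hb.1, integral_Ioc_eq_integral_Ioo, min_eq_left hb.2]

/-- Integration by parts against a primitive of an integrable function, by Fubini's theorem. -/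
lemma integral_deriv_mul_primitive {u : ℝ → ℂ}
    (hu : Integrable u (volume.restrict (Ioo 0 h))) {φ φ' : ℝ → ℝ}
    (hφ : ∀ y, HasDerivAt φ (φ' y) y) (hc : Continuous φ') (h0 : φ h = 0) :
    ∫ y in Ioo 0 h, (φ' y : ℂ) * ∫ s in Ioo 0 y, u s = -∫ s in Ioo 0 h, (φ s : ℂ) * u s := by
  have hφi : Integrable (fun y => (φ' y : ℂ)) (volume.restrict (Ioo 0 h)) :=
    ((Continuous.integrableOn_Icc (by fun_prop)).mono_set Ioo_subset_Icc_self)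
  let T : Set (ℝ × ℝ) := {q | q.2 < q.1}
  have hT : MeasurableSet T := measurableSet_lt measurable_snd measurable_fst
  have hprod : Integrable (T.indicator fun q : ℝ × ℝ => (φ' q.1 : ℂ) * u q.2)
      ((volume.restrict (Ioo 0 h)).prod (volume.restrict (Ioo 0 h))) :=
    (hφi.mul_prod hu).indicator hT
  have hswap := integral_integral_swap (f := fun y s => T.indicator
    (fun q : ℝ × ℝ => (φ' q.1 : ℂ) * u q.2) (y, s)) hprod
  have hl : ∫ y in Ioo 0 h, (φ' y : ℂ) * ∫ s in Ioo 0 y, u s =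
      ∫ y in Ioo 0 h, ∫ s in Ioo 0 h, T.indicator
        (fun q : ℝ × ℝ => (φ' q.1 : ℂ) * u q.2) (y, s) := by
    refine setIntegral_congr_fun measurableSet_Ioo fun y hy => ?_
    have hset : Ioo 0 y = Ioo 0 h ∩ Iio y := by
      ext s; simp only [mem_Ioo, mem_inter_iff, mem_Iio]; constructor
      · rintro ⟨h1, h2⟩; exact ⟨⟨h1, h2.trans hy.2⟩, h2⟩
      · rintro ⟨⟨h1, _⟩, h3⟩; exact ⟨h1, h3⟩
    rw [← integral_const_mul, hset, ← setIntegral_indicator measurableSet_Iio]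
    refine integral_congr_ae (Eventually.of_forall fun s => ?_)
    by_cases hs : s < y <;> simp [T, indicator, hs]
  have hr : ∫ s in Ioo 0 h, ∫ y in Ioo 0 h, T.indicator
        (fun q : ℝ × ℝ => (φ' q.1 : ℂ) * u q.2) (y, s) =
      ∫ s in Ioo 0 h, -((φ s : ℂ) * u s) := by
    refine setIntegral_congr_fun measurableSet_Ioo fun s hs => ?_
    have hset : Ioo s h = Ioo 0 h ∩ Ioi s := by
      ext y; simp only [mem_Ioo, mem_inter_iff, mem_Ioi]; constructor
      · rintro ⟨h1, h2⟩; exact ⟨⟨hs.1.trans h1, h2⟩, h1⟩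
      · rintro ⟨⟨_, h1⟩, h3⟩; exact ⟨h3, h1⟩
    have e : ∫ y in Ioo s h, (φ' y : ℂ) = -(φ s : ℂ) := by
      rw [← integral_Ioc_eq_integral_Ioo, ← intervalIntegral.integral_of_le hs.2.le,
        intervalIntegral.integral_ofReal, intervalIntegral.integral_eq_sub_of_hasDerivAt
          (fun y _ => hφ y) (hc.intervalIntegrable _ _), h0]
      simp
    rw [← neg_mul, ← e, ← integral_mul_const, hset, ← setIntegral_indicator measurableSet_Ioi]
    refine integral_congr_ae (Eventually.of_forall fun y => ?_)
    by_cases hy : s < y <;> simp [T, indicator, hy]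
  rw [hl, hswap, hr, integral_neg]

/-- A vertical primitive has the expected weak vertical derivative. -/
lemma hasWeakDeriv_primitive (hh : 0 ≤ h) (f : L2Slab d h ℂ) :
    HasWeakDeriv (slab d h) (dir d (Fin.last d)) (primitive hh f) f := by
  intro φ h1 h2 h3
  rw [integral_slab (integrable_dtest_smul _ h1 h2 _),
    integral_slab (integrable_test_smul _ h1.continuous h2), ← integral_neg]
  refine integral_congr_ae ?_
  filter_upwards [integrable_slice_left f, ae_slab_right (coeFn_primitive hh f)] with x hx hp
  have hdir : dir d (Fin.last d) = (0, 1) := by simp [dir]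
  have hd : ∀ y, HasDerivAt (fun y => φ (x, y)) (fderiv ℝ φ (x, y) (0, 1)) y := fun y => by
    have h1' := (h1.differentiable (by simp) (x, y)).hasFDerivAt
    exact h1'.comp_hasDerivAt y ((hasDerivAt_const y x).prodMk (hasDerivAt_id y))
  have hcont : Continuous fun y => fderiv ℝ φ (x, y) (0, 1) := by
    have := (h1.continuous_fderiv (by simp)).comp (Continuous.prodMk_right x)
    exact this.clm_apply continuous_const
  have h0 : φ (x, h) = 0 := by
    refine image_eq_zero_of_notMem_tsupport fun hmem => ?_
    exact lt_irrefl _ (h3 hmem).2.2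
  have := integral_deriv_mul_primitive hx hd hcont h0
  simp only [Complex.real_smul, hdir]
  rw [← this]
  refine integral_congr_ae ?_
  filter_upwards [hp] with y hy
  rw [hy]

end Primitive

/-! ### The partial Fourier transform -/

section Fourier

variable {d : ℕ} {h : ℝ}

/-- The Fourier transform in the horizontal variable. -/
def fourierSlice : L2Slab d h ℂ →L[ℂ] L2Slab d h ℂ :=
  sliceMap (Lp.fourierTransformₗᵢ (Horiz d) ℂ).toContinuousLinearEquiv.toContinuousLinearMap

/-- The inverse Fourier transform in the horizontal variable. -/
def fourierInvSlice : L2Slab d h ℂ →L[ℂ] L2Slab d h ℂ :=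
  sliceMap (Lp.fourierTransformₗᵢ (Horiz d) ℂ).symm.toContinuousLinearEquiv.toContinuousLinearMap

lemma fourierInvSlice_fourierSlice (f : L2Slab d h ℂ) : fourierInvSlice (fourierSlice f) = f :=
  sliceMap_sliceMap _ _ (fun φ => (Lp.fourierTransformₗᵢ (Horiz d) ℂ).symm_apply_apply φ) f

lemma vertInt_fourierSlice (b : ℝ) (f : L2Slab d h ℂ) :
    vertInt b (fourierSlice f) = 𝓕 (vertInt b f) := vertInt_sliceMap b _ f

lemma vertInt_fourierInvSlice (b : ℝ) (f : L2Slab d h ℂ) :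
    vertInt b (fourierInvSlice f) = 𝓕⁻ (vertInt b f) := vertInt_sliceMap b _ f

lemma fourierInvSlice_primitive (hh : 0 ≤ h) (f : L2Slab d h ℂ) :
    fourierInvSlice (primitive hh f) = primitive hh (fourierInvSlice f) :=
  sliceMap_primitive hh _ f

lemma slice_fourierInvSlice (f : L2Slab d h ℂ) :
    ∀ᵐ y ∂(volume.restrict (Ioo 0 h)), slice (fourierInvSlice f) y = 𝓕⁻ (slice f y) :=
  sliceRel_sliceMap _ f

lemma inner_fourierInv (φ : SchwartzMap (Horiz d) ℂ) (W : L2Horiz d ℂ) :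
    inner ℂ (φ.toLp 2 volume) (𝓕⁻ W) = inner ℂ ((𝓕 φ).toLp 2 volume) W := by
  rw [← Lp.inner_fourier_eq, FourierTransform.fourier_fourierInv_eq, SchwartzMap.toLp_fourier_eq]

/-- Integration by parts against an inverse Fourier transform, by Parseval's identity with the test
function, for which the formula for the Fourier transform of a derivative is available. -/
lemma integral_fderiv_smul_fourierInv (i : Fin d) {W B : L2Horiz d ℂ}
    (hB : B =ᵐ[volume] fun ξ => 2 * Real.pi * Complex.I * (ξ i : ℂ) * W ξ) {ψ : Horiz d → ℝ}
    (h1 : ContDiff ℝ ∞ ψ) (h2 : HasCompactSupport ψ) :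
    ∫ x, (fderiv ℝ ψ x (EuclideanSpace.single i 1)) • (𝓕⁻ W : L2Horiz d ℂ) x =
      -∫ x, ψ x • (𝓕⁻ B : L2Horiz d ℂ) x := by
  let Ψ : SchwartzMap (Horiz d) ℂ := HasCompactSupport.toSchwartzMap
    (f := fun x => (ψ x : ℂ)) (h2.comp_left Complex.ofReal_zero)
    (Complex.ofRealCLM.contDiff.comp h1)
  let e : Horiz d := EuclideanSpace.single i 1
  have hΨ : ∀ x, Ψ x = ψ x := fun x => rfl
  have hΨ' : ∀ x, (LineDeriv.lineDerivOp e Ψ) x = (fderiv ℝ ψ x e : ℝ) := fun x => by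
    rw [SchwartzMap.lineDerivOp_apply_eq_fderiv]
    have := (Complex.ofRealCLM.hasFDerivAt.comp x (h1.differentiable (by simp) x).hasFDerivAt)
    have h3 : HasFDerivAt (Ψ : Horiz d → ℂ) (Complex.ofRealCLM.comp (fderiv ℝ ψ x)) x := this
    rw [h3.fderiv]; rfl
  have hF : 𝓕 (LineDeriv.lineDerivOp e Ψ) = _ := SchwartzMap.fourier_lineDerivOp_eq Ψ e
  have hFx : ∀ ξ, (𝓕 (LineDeriv.lineDerivOp e Ψ)) ξ =
      2 * Real.pi * Complex.I * (ξ i : ℂ) * (𝓕 Ψ) ξ := fun ξ => by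
    have ht : (inner ℝ · e : Horiz d → ℝ).HasTemperateGrowth :=
      ((innerSL ℝ).flip e).hasTemperateGrowth
    rw [hF, smul_apply, SchwartzMap.smulLeftCLM_apply_apply ht]
    simp [e, EuclideanSpace.inner_single_right, mul_assoc]
  have l1 : ∫ x, (fderiv ℝ ψ x e) • (𝓕⁻ W : L2Horiz d ℂ) x =
      inner ℂ ((LineDeriv.lineDerivOp e Ψ).toLp 2 volume) (𝓕⁻ W) := by
    rw [L2.inner_def]
    refine integral_congr_ae ?_
    filter_upwards [(LineDeriv.lineDerivOp e Ψ).coeFn_toLp 2 volume] with x hx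
    rw [hx, hΨ', RCLike.inner_apply, Complex.conj_ofReal, Complex.real_smul, mul_comm]
  have l2 : ∫ x, ψ x • (𝓕⁻ B : L2Horiz d ℂ) x = inner ℂ (Ψ.toLp 2 volume) (𝓕⁻ B) := by
    rw [L2.inner_def]
    refine integral_congr_ae ?_
    filter_upwards [Ψ.coeFn_toLp 2 volume] with x hx
    rw [hx, hΨ, RCLike.inner_apply, Complex.conj_ofReal, Complex.real_smul, mul_comm]
  rw [l1, l2, inner_fourierInv, inner_fourierInv, L2.inner_def, L2.inner_def, ← integral_neg]
  refine integral_congr_ae ?_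
  filter_upwards [(𝓕 (LineDeriv.lineDerivOp e Ψ)).coeFn_toLp 2 volume,
    (𝓕 Ψ).coeFn_toLp 2 volume, hB] with x e1 e2 e3
  rw [e1, e2, e3, hFx, RCLike.inner_apply, RCLike.inner_apply]
  have h2c : (starRingEnd ℂ) 2 = 2 := Complex.conj_ofNat 2
  simp only [map_mul, h2c, Complex.conj_ofReal, Complex.conj_I]
  ring

/-- On the Fourier side, horizontal differentiation is multiplication by `2πiξ`. -/
lemma hasWeakDeriv_fourierInvSlice (i : Fin d) {W B : L2Slab d h ℂ}
    (hB : B =ᵐ[volume.restrict (slab d h)]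
      fun p => 2 * Real.pi * Complex.I * (p.1 i : ℂ) * W p) :
    HasWeakDeriv (slab d h) (dir d i.castSucc) (fourierInvSlice W) (fourierInvSlice B) := by
  intro φ h1 h2 h3
  rw [integral_slab_symm (integrable_dtest_smul _ h1 h2 _),
    integral_slab_symm (integrable_test_smul _ h1.continuous h2), ← integral_neg]
  refine integral_congr_ae ?_
  filter_upwards [slice_ae_eq hB, coeFn_slice W, slice_fourierInvSlice W, slice_fourierInvSlice B,
    coeFn_slice (fourierInvSlice W), coeFn_slice (fourierInvSlice B)] with y e1 e2 e3 e4 e5 e6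
  have hdir : dir d i.castSucc = (EuclideanSpace.single i 1, 0) := by simp [dir]
  have hψ : ContDiff ℝ ∞ fun x => φ (x, y) := h1.comp (contDiff_prodMk_left y)
  have hψc : HasCompactSupport fun x => φ (x, y) :=
    h2.comp_isClosedEmbedding
      (Isometry.of_dist_eq fun x x' => by simp [Prod.dist_eq]).isClosedEmbedding
  have hB' : slice B y =ᵐ[volume] fun ξ =>
      2 * Real.pi * Complex.I * (ξ i : ℂ) * slice W y ξ := by
    filter_upwards [e1, e2] with ξ h4 h5
    rw [h4, h5]
  have key := integral_fderiv_smul_fourierInv i hB' hψ hψc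
  rw [← e3, ← e4] at key
  refine (integral_congr_ae ?_).trans (key.trans (congrArg Neg.neg (integral_congr_ae ?_)))
  · filter_upwards [e5] with x hx
    rw [hx, hdir]
    congr 1
    have h1' := (h1.differentiable (by simp) (x, y)).hasFDerivAt
    have := h1'.comp x ((hasFDerivAt_id (𝕜 := ℝ) x).prodMk (hasFDerivAt_const y x))
    rw [show (fun x => φ (x, y)) = φ ∘ fun x => (id x, y) from rfl, this.fderiv]
    rfl
  · filter_upwards [e6] with x hx
    rw [hx]

end Fourier

/-! ### The vertical ordinary differential equation on the Fourier side -/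

section VerticalODE

/-- Duhamel's integral `∫_{(0, y)} exp(-k (y - s)) u(s) ds`, the solution of `E' = u - k E`,
`E(0) = 0`. -/
def duhamel (k : ℝ) (u : ℝ → ℂ) (y : ℝ) : ℂ :=
  ∫ s in Ioo 0 y, (Real.exp (-(k * (y - s))) : ℂ) * u s

lemma integrable_exp_mul (k : ℝ) {h : ℝ} {u : ℝ → ℂ}
    (hu : Integrable u (volume.restrict (Ioo 0 h))) :
    Integrable (fun s => (Real.exp (k * s) : ℂ) * u s) (volume.restrict (Ioo 0 h)) := by
  refine hu.bdd_mul (c := Real.exp (|k| * |h|)) (by fun_prop) ?_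
  filter_upwards [ae_restrict_mem measurableSet_Ioo] with s hs
  rw [Complex.norm_real, Real.norm_of_nonneg (Real.exp_pos _).le, Real.exp_le_exp]
  refine (le_abs_self _).trans ?_
  rw [abs_mul]
  gcongr
  exacts [hs.1.le, hs.2.le]

lemma duhamel_eq (k : ℝ) (u : ℝ → ℂ) (y : ℝ) : duhamel k u y =
    (Real.exp (-(k * y)) : ℂ) * ∫ s in Ioo 0 y, (Real.exp (k * s) : ℂ) * u s := by
  rw [duhamel, ← integral_const_mul]
  refine integral_congr_ae (Eventually.of_forall fun s => ?_)
  simp only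
  rw [← mul_assoc, ← Complex.ofReal_mul, ← Real.exp_add]
  ring_nf

lemma integrable_duhamel (k : ℝ) {y : ℝ} (hy : 0 ≤ y) {u : ℝ → ℂ}
    (hu : Integrable u (volume.restrict (Ioo 0 y))) :
    Integrable (duhamel k u) (volume.restrict (Ioo 0 y)) := by
  have h1 := absolutelyContinuousOnInterval_primitive hy (integrable_exp_mul k hu)
  have h2 := h1.continuousOn
  rw [uIcc_of_le hy] at h2
  have h3 : ContinuousOn (fun t => (Real.exp (-(k * t)) : ℂ) *
      ∫ s in (0)..t, (Real.exp (k * s) : ℂ) * u s) (Icc 0 y) :=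
    ContinuousOn.mul (by fun_prop) h2
  refine (h3.integrableOn_Icc.mono_set Ioo_subset_Icc_self).congr ?_
  filter_upwards [ae_restrict_mem measurableSet_Ioo] with t ht
  rw [duhamel_eq, intervalIntegral.integral_of_le ht.1.le, integral_Ioc_eq_integral_Ioo]

/-- The integrated form of the equation `E' = u - k E`, `E(0) = 0`. -/
lemma integral_sub_duhamel (k : ℝ) {y : ℝ} (hy : 0 ≤ y) {u : ℝ → ℂ}
    (hu : Integrable u (volume.restrict (Ioo 0 y))) :
    ∫ t in Ioo 0 y, (u t - k * duhamel k u t) = duhamel k u y := by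
  have hv := integrable_exp_mul k hu
  have hd : ∀ t, HasDerivAt (fun t => Real.exp (-(k * y)) - Real.exp (-(k * t)))
      (k * Real.exp (-(k * t))) t := fun t => by
    have := (((hasDerivAt_id t).const_mul k).neg.exp).const_sub (Real.exp (-(k * y)))
    exact this.congr_deriv (by simp [mul_comm])
  -- `k exp(-k t)` is the derivative of a function that vanishes at the upper end `y`
  have key := integral_deriv_mul_primitive hv hd (by fun_prop) (sub_self _)
  rw [integral_sub hu ((integrable_duhamel k hy hu).const_mul _)]
  have e1 : ∫ t in Ioo 0 y, (k : ℂ) * duhamel k u t = ∫ t in Ioo 0 y,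
      ((k * Real.exp (-(k * t)) : ℝ) : ℂ) *
        ∫ s in Ioo 0 t, (Real.exp (k * s) : ℂ) * u s := by
    refine integral_congr_ae (Eventually.of_forall fun t => ?_)
    simp only [duhamel_eq]
    push_cast
    ring
  have e2 : ∫ s in Ioo 0 y, ((Real.exp (-(k * y)) - Real.exp (-(k * s)) : ℝ) : ℂ) *
      ((Real.exp (k * s) : ℂ) * u s) = duhamel k u y - ∫ s in Ioo 0 y, u s := by
    rw [duhamel_eq, ← integral_const_mul, ← integral_sub (hv.const_mul _) hu]
    refine integral_congr_ae (Eventually.of_forall fun s => ?_)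
    have : (Real.exp (-(k * s)) : ℂ) * (Real.exp (k * s) : ℂ) = 1 := by
      rw [← Complex.ofReal_mul, ← Real.exp_add]; simp
    simp only
    push_cast at this ⊢
    linear_combination (-u s) * this
  rw [e1, key, e2]
  ring

end VerticalODE

/-! ### Boundary layers -/

section Layer

variable {d : ℕ} {h : ℝ}

/-- The vertical decay rate `2π|ξ|` at horizontal frequency `ξ`. -/
def rate (ξ : Horiz d) : ℝ := 2 * Real.pi * ‖ξ‖

lemma rate_nonneg (ξ : Horiz d) : 0 ≤ rate ξ := by unfold rate; positivity

@[fun_prop]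
lemma measurable_rate : Measurable (rate : Horiz d → ℝ) := by unfold rate; fun_prop

/-- The kernel `√K β(ξ) ψ(K (y - b) / δ)` with `K = 1 + 2π|ξ|`: a profile of height `√K` that is
concentrated in a layer of thickness comparable to `1 / K` around height `b`. -/
def layerKernel (δ b : ℝ) (β : Horiz d → ℂ) (ψ : ℝ → ℝ) (ξ : Horiz d) (y : ℝ) : ℂ :=
  (√(1 + rate ξ) : ℂ) * β ξ * (ψ ((1 + rate ξ) * (y - b) / δ) : ℂ)

/-- The height `√K` of a layer and its thickness `2δ / K` balance in `L²`. -/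
lemma lintegral_layerKernel_le {δ : ℝ} (hδ : 0 < δ) (b : ℝ) {β : Horiz d → ℂ} {C : ℝ}
    (hβ : ∀ ξ, ‖β ξ‖ ≤ C) {ψ : ℝ → ℝ} {M : ℝ} (hψM : ∀ t, |ψ t| ≤ M)
    (hψ0 : ∀ t, 1 ≤ |t| → ψ t = 0) (ξ : Horiz d) :
    ∫⁻ y, ‖layerKernel δ b β ψ ξ y‖ₑ ^ 2 ≤ ENNReal.ofReal (2 * δ * (C * M) ^ 2) := by
  set K := 1 + rate ξ with hK
  have hK1 : 1 ≤ K := by have := rate_nonneg ξ; linarith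
  have hM : 0 ≤ M := (abs_nonneg _).trans (hψM 0)
  have hC : 0 ≤ C := (norm_nonneg _).trans (hβ 0)
  have hpt : ∀ y, ‖layerKernel δ b β ψ ξ y‖ₑ ^ 2 ≤
      (Icc (b - δ / K) (b + δ / K)).indicator (fun _ => ENNReal.ofReal (K * (C * M) ^ 2)) y := by
    intro y
    by_cases hy : y ∈ Icc (b - δ / K) (b + δ / K)
    · rw [indicator_of_mem hy, ← ofReal_norm, ← ENNReal.ofReal_pow (norm_nonneg _)]
      refine ENNReal.ofReal_le_ofReal ?_
      rw [layerKernel, norm_mul, norm_mul, Complex.norm_real, Complex.norm_real, mul_pow, mul_pow,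
        Real.norm_of_nonneg (Real.sqrt_nonneg _), Real.sq_sqrt (by linarith), mul_assoc, ← mul_pow]
      gcongr
      · exact hβ ξ
      · exact hψM _
    · have : ψ (K * (y - b) / δ) = 0 := by
        refine hψ0 _ ?_
        by_contra! hlt
        rw [abs_div, abs_mul, abs_of_pos (by linarith : 0 < K), abs_of_pos hδ,
          div_lt_one hδ] at hlt
        have h2 : |y - b| < δ / K := by
          rw [lt_div_iff₀ (by linarith), mul_comm]; exact hlt
        rw [abs_lt] at h2
        exact hy ⟨by linarith [h2.1], by linarith [h2.2]⟩
      rw [layerKernel, ← hK, this]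
      simp
  refine (lintegral_mono hpt).trans ?_
  rw [lintegral_indicator_const measurableSet_Icc, Real.volume_Icc, ← ENNReal.ofReal_mul
    (by positivity)]
  refine ENNReal.ofReal_le_ofReal (le_of_eq ?_)
  field_simp
  ring

lemma exists_layer {δ : ℝ} (hδ : 0 < δ) (b : ℝ) {β : Horiz d → ℂ} (hβm : Measurable β) {C : ℝ}
    (hβ : ∀ ξ, ‖β ξ‖ ≤ C) {ψ : ℝ → ℝ} (hψ : Continuous ψ)
    (hψ0 : ∀ t, 1 ≤ |t| → ψ t = 0) :
    ∃ A : L2Horiz d ℂ →L[ℂ] L2Slab d h ℂ, ∀ φ, A φ =ᵐ[volume.restrict (slab d h)]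
      fun p => layerKernel δ b β ψ p.1 p.2 * φ p.1 := by
  obtain ⟨M, hM⟩ : ∃ M, ∀ t, |ψ t| ≤ M := by
    obtain ⟨M, hM⟩ := (isCompact_Icc (a := (-1 : ℝ)) (b := 1)).exists_bound_of_continuousOn
      hψ.continuousOn
    refine ⟨max M 0, fun t => ?_⟩
    by_cases ht : 1 ≤ |t|
    · simp [hψ0 t ht]
    · push Not at ht
      exact (hM t ⟨(abs_lt.mp ht).1.le, (abs_lt.mp ht).2.le⟩).trans (le_max_left _ _)
  refine exists_kernelMul (m := fun p => layerKernel δ b β ψ p.1 p.2) ?_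
    (C := 2 * δ * (C * M) ^ 2) fun ξ => ?_
  · unfold layerKernel
    have := hψ.measurable
    fun_prop
  · exact (setLIntegral_le_lintegral _ _).trans (lintegral_layerKernel_le hδ b hβ hM hψ0 ξ)

lemma coeFn_sum_Lp {α ι V : Type*} [MeasurableSpace α] [NormedAddCommGroup V] {μ : Measure α}
    (s : Finset ι) (f : ι → Lp V 2 μ) :
    (∑ i ∈ s, f i : Lp V 2 μ) =ᵐ[μ] fun x => ∑ i ∈ s, f i x := by
  classical
  induction s using Finset.induction_on with
  | empty => simp only [Finset.sum_empty]; exact Lp.coeFn_zero V 2 μ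
  | insert i s hi ih =>
    rw [Finset.sum_insert hi]
    filter_upwards [Lp.coeFn_add (f i) (∑ j ∈ s, f j), ih] with x h1 h2
    rw [h1, Pi.add_apply, h2, Finset.sum_insert hi]

/-- The kernel with profile `ψ` is the primitive of the one with profile `ψ'` and an additional
factor `K / δ`. There is no boundary term: as `δ ≤ b`, the layer does not reach the bottom of the
slab. -/
lemma integral_layerKernel {δ b : ℝ} (hδ : 0 < δ) (hb : δ ≤ b) (β : Horiz d → ℂ) {ψ ψ' : ℝ → ℝ}
    (hψ : ∀ t, HasDerivAt ψ (ψ' t) t) (hψ' : Continuous ψ') (hψ0 : ∀ t, 1 ≤ |t| → ψ t = 0)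
    (ξ : Horiz d) {y : ℝ} (hy : 0 ≤ y) :
    ∫ s in Ioo 0 y, layerKernel δ b (fun ξ => β ξ * ((1 + rate ξ) / δ : ℝ)) ψ' ξ s =
      layerKernel δ b β ψ ξ y := by
  set K := 1 + rate ξ with hK
  have hK1 : 1 ≤ K := by have := rate_nonneg ξ; linarith
  have hd : ∀ s, HasDerivAt (fun s => ψ (K * (s - b) / δ)) ((K / δ) * ψ' (K * (s - b) / δ)) s :=
    fun s => by
    have h1 : HasDerivAt (fun s => K * (s - b) / δ) (K / δ) s := by
      have := (((hasDerivAt_id s).sub_const b).const_mul K).div_const δ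
      simpa using this
    exact ((hψ _).comp s h1).congr_deriv (mul_comm _ _)
  -- here `K ≥ 1` and `δ ≤ b` place the argument outside the support of `ψ`
  have h0 : ψ (K * (0 - b) / δ) = 0 := by
    refine hψ0 _ ?_
    rw [abs_div, abs_mul, abs_of_pos (by linarith : 0 < K), abs_of_pos hδ, le_div_iff₀ hδ,
      zero_sub, abs_neg, abs_of_pos (by linarith)]
    nlinarith
  have e : ∫ s in Ioo 0 y, (K / δ) * ψ' (K * (s - b) / δ) = ψ (K * (y - b) / δ) := by
    rw [← integral_Ioc_eq_integral_Ioo, ← intervalIntegral.integral_of_le hy,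
      intervalIntegral.integral_eq_sub_of_hasDerivAt (fun s _ => hd s)
        (Continuous.intervalIntegrable (by fun_prop) _ _), h0, sub_zero]
  unfold layerKernel
  rw [← hK, ← e, ← integral_complex_ofReal, ← integral_const_mul]
  refine integral_congr_ae (Eventually.of_forall fun s => ?_)
  simp only [← hK]
  push_cast
  ring

end Layer

/-! ### Solving the divergence equation on the Fourier side -/

section FourierSide

variable {d : ℕ} {h : ℝ} {ι : Type*} [Fintype ι]

/-- The data on the Fourier side: a divergence and a family of layer amplitudes. -/
abbrev FourierData (d : ℕ) (h : ℝ) (ι : Type*) := L2Slab d h ℂ × (ι → L2Horiz d ℂ)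

/-- A scalar component of the solution on the Fourier side: a multiple of Duhamel's integral of the
divergence, plus one boundary layer for each of the heights. -/
def profile (δ : ℝ) (a : ι → ℝ) (c β : Horiz d → ℂ) (ψ : ℝ → ℝ)
    (z : FourierData d h ι) (ξ : Horiz d) (y : ℝ) : ℂ :=
  c ξ * duhamel (rate ξ) (fun s => z.1 (ξ, s)) y +
    ∑ ℓ, layerKernel δ (a ℓ) β ψ ξ y * z.2 ℓ ξ

/-- The vertical derivative of `profile`, where `ψ'` is the derivative of `ψ`. -/
def profileDeriv (δ : ℝ) (a : ι → ℝ) (c β : Horiz d → ℂ) (ψ' : ℝ → ℝ)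
    (z : FourierData d h ι) (ξ : Horiz d) (y : ℝ) : ℂ :=
  c ξ * (z.1 (ξ, y) - rate ξ * duhamel (rate ξ) (fun s => z.1 (ξ, s)) y) +
    ∑ ℓ, layerKernel δ (a ℓ) (fun ξ => β ξ * ((1 + rate ξ) / δ : ℝ)) ψ' ξ y * z.2 ℓ ξ

lemma integral_profileDeriv {δ : ℝ} (hδ : 0 < δ) {a : ι → ℝ} (ha : ∀ ℓ, δ ≤ a ℓ)
    (c β : Horiz d → ℂ) {ψ ψ' : ℝ → ℝ} (hψ : ∀ t, HasDerivAt ψ (ψ' t) t) (hψ' : Continuous ψ')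
    (hψ0 : ∀ t, 1 ≤ |t| → ψ t = 0) (z : FourierData d h ι) {ξ : Horiz d}
    (hξ : Integrable (fun s => z.1 (ξ, s)) (volume.restrict (Ioo 0 h))) {y : ℝ}
    (hy : y ∈ Icc 0 h) :
    ∫ s in Ioo 0 y, profileDeriv δ a c β ψ' z ξ s = profile δ a c β ψ z ξ y := by
  have hi : Integrable (fun s => z.1 (ξ, s)) (volume.restrict (Ioo 0 y)) :=
    hξ.mono_measure (Measure.restrict_mono (Ioo_subset_Ioo_right hy.2) le_rfl)
  have hlay : ∀ ℓ, Integrable (fun s => layerKernel δ (a ℓ)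
      (fun ξ => β ξ * ((1 + rate ξ) / δ : ℝ)) ψ' ξ s * z.2 ℓ ξ) (volume.restrict (Ioo 0 y)) :=
    fun ℓ => by
      unfold layerKernel
      exact (Continuous.integrableOn_Icc (by fun_prop)).mono_set Ioo_subset_Icc_self
  have hd : Integrable (fun s => c ξ * (z.1 (ξ, s) -
      rate ξ * duhamel (rate ξ) (fun s => z.1 (ξ, s)) s)) (volume.restrict (Ioo 0 y)) :=
    (hi.sub ((integrable_duhamel _ hy.1 hi).const_mul _)).const_mul _
  unfold profileDeriv profile
  rw [integral_add hd (integrable_finsetSum _ fun ℓ _ => hlay ℓ),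
    integral_finsetSum _ fun ℓ _ => hlay ℓ, integral_const_mul, integral_sub_duhamel _ hy.1 hi]
  congr 1
  refine Finset.sum_congr rfl fun ℓ _ => ?_
  rw [integral_mul_const, integral_layerKernel hδ (ha ℓ) β hψ hψ' hψ0 ξ hy.1]

/-- The multiplier `c` of Duhamel's integral may grow like `1 + rate`. -/
lemma exists_profile (hh : 0 ≤ h) {δ : ℝ} (hδ : 0 < δ) (a : ι → ℝ) {c β : Horiz d → ℂ}
    (hc : Measurable c) (hβ : Measurable β) {C C' : ℝ} (hC0 : 0 ≤ C)
    (hcC : ∀ ξ, ‖c ξ‖ ≤ C * (1 + rate ξ))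
    (hβC : ∀ ξ, ‖β ξ‖ ≤ C') {ψ : ℝ → ℝ} (hψ : Continuous ψ) (hψ0 : ∀ t, 1 ≤ |t| → ψ t = 0) :
    ∃ U : FourierData d h ι →L[ℂ] L2Slab d h ℂ, ∀ z,
      U z =ᵐ[volume.restrict (slab d h)] fun p => profile δ a c β ψ z p.1 p.2 := by
  obtain ⟨V, hV⟩ := exists_volterra (d := d) hh measurable_rate rate_nonneg hc hC0 hcC
  choose Λ hΛ using fun ℓ => exists_layer (h := h) hδ (a ℓ) hβ hβC hψ hψ0
  let U : FourierData d h ι →L[ℂ] L2Slab d h ℂ := V ∘L ContinuousLinearMap.fst ℂ _ _ +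
    (∑ ℓ, Λ ℓ ∘L ContinuousLinearMap.proj ℓ) ∘L ContinuousLinearMap.snd ℂ _ _
  refine ⟨U, fun z => ?_⟩
  have e : U z = V z.1 + ∑ ℓ, Λ ℓ (z.2 ℓ) := by simp [U]
  rw [e]
  filter_upwards [Lp.coeFn_add (V z.1) (∑ ℓ, Λ ℓ (z.2 ℓ)), hV z.1,
    coeFn_sum_Lp Finset.univ fun ℓ => Λ ℓ (z.2 ℓ), ae_all_iff.mpr fun ℓ => hΛ ℓ (z.2 ℓ)]
    with p h1 h2 h3 h4
  rw [h1, Pi.add_apply, h2, h3]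
  simp only [h4]
  rfl

/-- The Fourier side of a scalar field `profile`: its vertical derivative `A` depends boundedly on
the data, and so do its horizontal derivatives `B i`. The field itself is recovered from `A` as a
vertical primitive. -/
lemma exists_component (hh : 0 ≤ h) {δ : ℝ} (hδ : 0 < δ) {a : ι → ℝ} (ha : ∀ ℓ, δ ≤ a ℓ)
    {c β : Horiz d → ℂ} (hc : Measurable c) (hβ : Measurable β) {C : ℝ}
    (hcC : ∀ ξ, ‖c ξ‖ ≤ C) (hβC : ∀ ξ, ‖β ξ‖ * (1 + rate ξ) ≤ C)
    {ψ ψ' : ℝ → ℝ} (hψ : ∀ t, HasDerivAt ψ (ψ' t) t) (hψ' : Continuous ψ')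
    (hψ0 : ∀ t, 1 ≤ |t| → ψ t = 0) (hψ0' : ∀ t, 1 ≤ |t| → ψ' t = 0) :
    ∃ (A : FourierData d h ι →L[ℂ] L2Slab d h ℂ)
      (B : Fin d → FourierData d h ι →L[ℂ] L2Slab d h ℂ), ∀ z,
      (A z =ᵐ[volume.restrict (slab d h)] fun p => profileDeriv δ a c β ψ' z p.1 p.2) ∧
      (∀ b ∈ Icc 0 h, vertInt b (A z) =ᵐ[volume] fun ξ => profile δ a c β ψ z ξ b) ∧
      (primitive hh (A z) =ᵐ[volume.restrict (slab d h)]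
        fun p => profile δ a c β ψ z p.1 p.2) ∧
      ∀ i, B i z =ᵐ[volume.restrict (slab d h)] fun p =>
        2 * Real.pi * Complex.I * (p.1 i : ℂ) * profile δ a c β ψ z p.1 p.2 := by
  have hC0 : 0 ≤ C := (norm_nonneg _).trans (hcC 0)
  have hr : ∀ ξ : Horiz d, 1 ≤ 1 + rate ξ := fun ξ => by linarith [rate_nonneg ξ]
  obtain ⟨Mc, hMc⟩ := exists_mul_clm (μ := volume.restrict (slab d h))
    (c := fun p : Horiz d × ℝ => c p.1) (hc.comp measurable_fst) (fun p => hcC p.1)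
  -- `profileDeriv` is `c F` plus another profile, in which a factor `1 + rate` has been absorbed
  obtain ⟨U, hU⟩ := exists_profile (d := d) hh hδ a (c := fun ξ => -(c ξ * rate ξ))
    (β := fun ξ => β ξ * ((1 + rate ξ) / δ : ℝ)) (by fun_prop) (by fun_prop) hC0 (C' := C / δ)
    (fun ξ => by
      rw [norm_neg, norm_mul, Complex.norm_real, Real.norm_of_nonneg (rate_nonneg ξ)]
      exact mul_le_mul (hcC ξ) (by linarith) (rate_nonneg ξ) hC0)
    (fun ξ => by
      rw [norm_mul, Complex.norm_real, Real.norm_of_nonneg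
        (div_nonneg (by linarith [hr ξ]) hδ.le), ← mul_div_assoc]
      exact div_le_div_of_nonneg_right (hβC ξ) hδ.le)
    hψ' hψ0'
  have hfreq : ∀ (i : Fin d) (ξ : Horiz d),
      ‖(2 * Real.pi * Complex.I * (ξ i : ℂ) : ℂ)‖ ≤ rate ξ := fun i ξ => by
    have h1 : ‖ξ i‖ ≤ ‖ξ‖ := PiLp.norm_apply_le ξ i
    have h2 : ‖(2 * Real.pi * Complex.I * (ξ i : ℂ) : ℂ)‖ = 2 * Real.pi * ‖ξ i‖ := by
      simp [abs_of_pos Real.pi_pos]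
    rw [h2, rate]
    gcongr
  have hψc : Continuous ψ := continuous_iff_continuousAt.mpr fun t => (hψ t).continuousAt
  choose B hB using fun i : Fin d => exists_profile (d := d) hh hδ a
    (c := fun ξ => 2 * Real.pi * Complex.I * (ξ i : ℂ) * c ξ)
    (β := fun ξ => 2 * Real.pi * Complex.I * (ξ i : ℂ) * β ξ) (by fun_prop) (by fun_prop) hC0
    (C' := C)
    (fun ξ => by
      rw [norm_mul, mul_comm]
      exact mul_le_mul (hcC ξ) ((hfreq i ξ).trans (by linarith)) (norm_nonneg _) hC0)
    (fun ξ => by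
      rw [norm_mul, mul_comm]
      refine le_trans ?_ (hβC ξ)
      gcongr
      exact (hfreq i ξ).trans (by linarith))
    hψc hψ0
  let A : FourierData d h ι →L[ℂ] L2Slab d h ℂ := Mc ∘L ContinuousLinearMap.fst ℂ _ _ + U
  refine ⟨A, B, fun z => ?_⟩
  have hA : A z =ᵐ[volume.restrict (slab d h)]
      fun p => profileDeriv δ a c β ψ' z p.1 p.2 := by
    have e : A z = Mc z.1 + U z := rfl
    rw [e]
    filter_upwards [Lp.coeFn_add (Mc z.1) (U z), hU z, hMc z.1] with p h1 h2 h3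
    rw [h1, Pi.add_apply, h2, h3]
    unfold profile profileDeriv
    ring
  have hint : ∀ᵐ ξ : Horiz d, ∀ y ∈ Icc 0 h, ∫ s in Ioo 0 y,
      A z (ξ, s) = profile δ a c β ψ z ξ y := by
    filter_upwards [integrable_slice_left z.1, ae_slab_right hA] with ξ h1 h2 y hy
    rw [← integral_profileDeriv hδ ha c β hψ hψ' hψ0 z h1 hy]
    exact integral_congr_ae (ae_mono (Measure.restrict_mono (Ioo_subset_Ioo_right hy.2) le_rfl) h2)
  refine ⟨hA, fun b hb => ?_, ?_, fun i => ?_⟩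
  · filter_upwards [hint, coeFn_vertInt b (A z)]
      with ξ h1 h2
    rw [h2, min_eq_left hb.2, h1 b hb]
  · filter_upwards [ae_slab_fst hint, ae_restrict_mem (isOpen_slab d h).measurableSet,
      coeFn_primitive hh (A z)] with p h1 h2 h3
    rw [h3, h1 p.2 ⟨h2.2.1.le, h2.2.2.le⟩]
  · filter_upwards [hB i z] with p hp
    rw [hp]
    simp only [profile, layerKernel, mul_add, Finset.mul_sum]
    congr 1
    · ring
    · exact Finset.sum_congr rfl fun ℓ _ => by ring

end FourierSide

section FourierSolution

variable {d : ℕ} {h : ℝ} {ι : Type*} [Fintype ι]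

lemma exists_bump : ∃ θ θ' θ'' : ℝ → ℝ, (∀ t, HasDerivAt θ (θ' t) t) ∧
    (∀ t, HasDerivAt θ' (θ'' t) t) ∧ Continuous θ'' ∧ θ 0 = 1 ∧ (∀ t, 1 ≤ |t| → θ t = 0) ∧
    (∀ t, 1 ≤ |t| → θ' t = 0) ∧ ∀ t, 1 ≤ |t| → θ'' t = 0 := by
  let θ : ContDiffBump (0 : ℝ) := ⟨1 / 4, 1 / 2, by norm_num, by norm_num⟩
  have hθ : ContDiff ℝ ∞ (θ : ℝ → ℝ) := θ.contDiff
  have hθ' : ContDiff ℝ ∞ (deriv θ) := (contDiff_infty_iff_deriv.mp hθ).2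
  have hθ'' : ContDiff ℝ ∞ (deriv (deriv θ)) := (contDiff_infty_iff_deriv.mp hθ').2
  have hout : ∀ t : ℝ, 1 ≤ |t| → t ∉ tsupport θ := fun t ht hmem => by
    rw [θ.tsupport_eq, Metric.mem_closedBall, dist_zero_right, Real.norm_eq_abs] at hmem
    norm_num [θ] at hmem
    linarith
  refine ⟨θ, deriv θ, deriv (deriv θ), fun t => (hθ.differentiable (by simp) t).hasDerivAt,
    fun t => (hθ'.differentiable (by simp) t).hasDerivAt, hθ''.continuous,
    θ.one_of_mem_closedBall ?_,
    fun t ht => image_eq_zero_of_notMem_tsupport (hout t ht),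
    fun t ht => image_eq_zero_of_notMem_tsupport fun hm => hout t ht (tsupport_deriv_subset hm),
    fun t ht => image_eq_zero_of_notMem_tsupport fun hm => hout t ht
      (tsupport_deriv_subset (tsupport_deriv_subset hm))⟩
  simp [θ]

/-- Half-widths of layers that keep away from the bottom of the slab and from the other heights. -/
lemma exists_gap {a : ι → ℝ} (ha : ∀ ℓ, 0 < a ℓ) (hinj : Function.Injective a) :
    ∃ δ > 0, (∀ ℓ, δ ≤ a ℓ) ∧ ∀ j ℓ, j ≠ ℓ → δ ≤ |a j - a ℓ| := by
  let u : ι ⊕ {q : ι × ι // q.1 ≠ q.2} → ℝ := Sum.elim a fun q => |a q.1.1 - a q.1.2|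
  have hu : ∀ i, (0 : ι ⊕ {q : ι × ι // q.1 ≠ q.2} → ℝ) i < u i := by
    rintro (ℓ | ⟨q, hq⟩)
    · exact ha ℓ
    · exact abs_pos.mpr (sub_ne_zero.mpr fun e => hq (hinj e))
  obtain ⟨δ, hδ, H⟩ := Pi.exists_forall_pos_add_lt hu
  simp only [Pi.zero_apply, zero_add] at H
  exact ⟨δ, hδ, fun ℓ => (H (.inl ℓ)).le, fun j ℓ hj => (H (.inr ⟨(j, ℓ), hj⟩)).le⟩

/-- The value `√K · k / K² = k K^{-3/2}`, with `k` the rate and `K = 1 + k`, that a layer of unit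
amplitude contributes to the vertical component at the height around which it is concentrated. -/
def layerHeight (ξ : Horiz d) : ℝ := √(1 + rate ξ) * (rate ξ / (1 + rate ξ) ^ 2)

/-- The divergence equation on the Fourier side: `A j` is the vertical derivative of the `j`-th
component, and `B i j` is its derivative in the horizontal direction `i`. The components are a
common Duhamel integral, times `-i ξ_j / |ξ|` for the horizontal ones, plus boundary layers that do
not contribute to the divergence. -/
lemma exists_fourier_solution (hh : 0 ≤ h) {a : ι → ℝ} (ha : ∀ ℓ, 0 < a ℓ)
    (hah : ∀ ℓ, a ℓ ≤ h) (hinj : Function.Injective a) :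
    ∃ (A : Fin (d + 1) → FourierData d h ι →L[ℂ] L2Slab d h ℂ)
      (B : Fin d → Fin (d + 1) → FourierData d h ι →L[ℂ] L2Slab d h ℂ), ∀ z,
      (∀ i j, B i j z =ᵐ[volume.restrict (slab d h)] fun p =>
        2 * Real.pi * Complex.I * (p.1 i : ℂ) * primitive hh (A j z) p) ∧
      (∑ i, B i i.castSucc z) + A (Fin.last d) z = z.1 ∧
      ∀ ℓ, vertInt (a ℓ) (A (Fin.last d) z) =ᵐ[volume] fun ξ =>
        duhamel (rate ξ) (fun s => z.1 (ξ, s)) (a ℓ) + layerHeight ξ * z.2 ℓ ξ := by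
  obtain ⟨δ, hδ, hδa, hδab⟩ := exists_gap ha hinj
  obtain ⟨θ, θ', θ'', hθ, hθ', hcont, hθ0, hs, hs', hs''⟩ := exists_bump
  have hr : ∀ ξ : Horiz d, 0 < 1 + rate ξ := fun ξ => by linarith [rate_nonneg ξ]
  -- the vertical component `w`, with layers of profile `θ`
  obtain ⟨An, Bn, hn⟩ := exists_component (d := d) hh hδ hδa (c := fun _ => 1)
    (β := fun ξ => ((rate ξ / (1 + rate ξ) ^ 2 : ℝ) : ℂ)) measurable_const (by fun_prop) (C := 1)
    (by simp)
    (fun ξ => by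
      have h0 := rate_nonneg ξ
      rw [Complex.norm_real, Real.norm_of_nonneg (by positivity), div_mul_eq_mul_div,
        div_le_one (by have := hr ξ; positivity)]
      nlinarith [hr ξ])
    hθ (continuous_iff_continuousAt.mpr fun t => (hθ' t).continuousAt) hs hs'
  have hdirn : ∀ (j : Fin d) (ξ : Horiz d), |ξ j / ‖ξ‖| ≤ 1 := fun j ξ => by
    rw [abs_div, abs_norm]
    exact div_le_one_of_le₀ (PiLp.norm_apply_le ξ j) (norm_nonneg _)
  have hδ1 : (0 : ℝ) ≤ 1 / δ := by positivity
  -- the horizontal components `-i (ξ_j / |ξ|) v`, with layers of profile `θ'`; at the frequency `0`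
  -- the quotient `ξ_j / |ξ|` is zero, which is harmless since `k v` vanishes there
  choose Ah Bh hhz using fun j : Fin d => exists_component (d := d) hh hδ hδa
    (c := fun ξ => -Complex.I * ((ξ j / ‖ξ‖ : ℝ) : ℂ))
    (β := fun ξ => Complex.I * ((ξ j / ‖ξ‖ * (1 / (δ * (1 + rate ξ))) : ℝ) : ℂ)) (by fun_prop)
    (by fun_prop) (C := 1 + 1 / δ)
    (fun ξ => by
      rw [norm_mul, norm_neg, Complex.norm_I, one_mul, Complex.norm_real, Real.norm_eq_abs]
      linarith [hdirn j ξ])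
    (fun ξ => by
      rw [norm_mul, Complex.norm_I, one_mul, Complex.norm_real, Real.norm_eq_abs, abs_mul,
        abs_of_pos (by have := hr ξ; positivity : 0 < 1 / (δ * (1 + rate ξ))), mul_assoc]
      have e : 1 / (δ * (1 + rate ξ)) * (1 + rate ξ) = 1 / δ := by
        have := (hr ξ).ne'
        field_simp
      rw [e]
      nlinarith [hdirn j ξ])
    hθ' hcont hs' hs''
  refine ⟨Fin.lastCases An Ah, fun i => Fin.lastCases (Bn i) fun j => Bh j i, fun z =>
    ⟨fun i j => ?_, ?_, fun ℓ => ?_⟩⟩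
  · refine Fin.lastCases ?_ (fun j => ?_) j
    · simp only [Fin.lastCases_last]
      filter_upwards [(hn z).2.2.1, (hn z).2.2.2 i] with p h1 h2
      rw [h1, h2]
    · simp only [Fin.lastCases_castSucc]
      filter_upwards [(hhz j z).2.2.1, (hhz j z).2.2.2 i] with p h1 h2
      rw [h1, h2]
  · simp only [Fin.lastCases_last, Fin.lastCases_castSucc]
    refine Lp.ext ?_
    filter_upwards [Lp.coeFn_add (∑ i, Bh i i z) (An z), coeFn_sum_Lp Finset.univ fun i => Bh i i z,
      (hn z).1, ae_all_iff.mpr fun i => (hhz i z).2.2.2 i] with p h1 h2 h3 h4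
    rw [h1, Pi.add_apply, h2, h3]
    simp only [h4]
    obtain ⟨ξ, y⟩ := p
    simp only
    -- the horizontal divergence is `2π |ξ| v = k v`
    have hsum : ∑ i, (ξ i : ℂ) * ((ξ i / ‖ξ‖ : ℝ) : ℂ) = (‖ξ‖ : ℂ) := by
      have h5 : ∑ i, ξ i * (ξ i / ‖ξ‖) = ‖ξ‖ := by
        rcases eq_or_ne ξ 0 with rfl | hξ
        · simp
        have h6 := EuclideanSpace.real_norm_sq_eq ξ
        simp only [← mul_div_assoc, ← Finset.sum_div, ← sq]
        rw [← h6, sq, mul_div_cancel_right₀ _ (norm_ne_zero_iff.mpr hξ)]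
      exact_mod_cast h5
    set T : ℂ := ∑ ℓ, (√(1 + rate ξ) : ℂ) * (θ' ((1 + rate ξ) * (y - a ℓ) / δ) : ℂ) * z.2 ℓ ξ
      with hT
    set E := duhamel (rate ξ) (fun s => z.1 (ξ, s)) y with hE
    have hK : ((1 + rate ξ : ℝ) : ℂ) ≠ 0 := by exact_mod_cast (hr ξ).ne'
    have hδc : (δ : ℂ) ≠ 0 := by exact_mod_cast hδ.ne'
    have e1 : ∀ i : Fin d, 2 * Real.pi * Complex.I * (ξ i : ℂ) *
        profile δ a (fun ξ => -Complex.I * ((ξ i / ‖ξ‖ : ℝ) : ℂ))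
          (fun ξ => Complex.I * ((ξ i / ‖ξ‖ * (1 / (δ * (1 + rate ξ))) : ℝ) : ℂ)) θ' z ξ y =
        ((ξ i : ℂ) * ((ξ i / ‖ξ‖ : ℝ) : ℂ)) *
          (2 * Real.pi * (E - T / (δ * ((1 + rate ξ : ℝ) : ℂ)))) := fun i => by
      have e2 : ∑ ℓ, layerKernel δ (a ℓ) (fun ξ => Complex.I *
          ((ξ i / ‖ξ‖ * (1 / (δ * (1 + rate ξ))) : ℝ) : ℂ)) θ' ξ y * z.2 ℓ ξ =
          Complex.I * ((ξ i / ‖ξ‖ : ℝ) : ℂ) / (δ * ((1 + rate ξ : ℝ) : ℂ)) * T := by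
        rw [hT, Finset.mul_sum]
        refine Finset.sum_congr rfl fun ℓ _ => ?_
        simp only [layerKernel]
        push_cast at hK ⊢
        field_simp
      rw [profile, e2, ← hE]
      linear_combination (-2 * Real.pi * (ξ i : ℂ) * ((ξ i / ‖ξ‖ : ℝ) : ℂ) *
        (E - T / (δ * ((1 + rate ξ : ℝ) : ℂ)))) * Complex.I_sq
    have e3 : ∑ ℓ, layerKernel δ (a ℓ) (fun ξ => ((rate ξ / (1 + rate ξ) ^ 2 : ℝ) : ℂ) *
        ((1 + rate ξ) / δ : ℝ)) θ' ξ y * z.2 ℓ ξ =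
        (rate ξ : ℂ) / (δ * ((1 + rate ξ : ℝ) : ℂ)) * T := by
      rw [hT, Finset.mul_sum]
      refine Finset.sum_congr rfl fun ℓ _ => ?_
      simp only [layerKernel]
      push_cast at hK ⊢
      field_simp
    rw [Finset.sum_congr rfl fun i _ => e1 i, ← Finset.sum_mul, hsum, profileDeriv, e3, ← hE]
    have hrate : (rate ξ : ℂ) = 2 * Real.pi * ‖ξ‖ := by simp [rate]
    rw [hrate]
    ring
  · simp only [Fin.lastCases_last]
    filter_upwards [(hn z).2.1 (a ℓ) ⟨(ha ℓ).le, hah ℓ⟩] with ξ hξ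
    rw [hξ, profile, Finset.sum_eq_single ℓ]
    · simp [layerKernel, hθ0, layerHeight]
    -- the layers around the other heights `a j` vanish at `a ℓ`, by the choice of `δ`
    · intro j _ hj
      have : θ ((1 + rate ξ) * (a ℓ - a j) / δ) = 0 := by
        refine hs _ ?_
        rw [abs_div, abs_mul, abs_of_pos (hr ξ), abs_of_pos hδ, le_div_iff₀ hδ, one_mul]
        nlinarith [hδab ℓ j hj.symm, rate_nonneg ξ, abs_nonneg (a ℓ - a j)]
      simp [layerKernel, this]
    · simp

/-- The Sobolev weight `(1 + |ξ|²)^{1/4}` dominates the square root of the vertical decay rate. -/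
lemma sqrt_one_add_rate_le (ξ : Horiz d) :
    √(1 + rate ξ) ≤ 3 * (1 + ‖ξ‖ ^ 2) ^ ((1 / 2 : ℝ) / 2) := by
  set r := ‖ξ‖ with hr
  have h0 : 0 ≤ 1 + r ^ 2 := by positivity
  have h1 : ((1 + r ^ 2) ^ ((1 / 2 : ℝ) / 2)) ^ 2 = √(1 + r ^ 2) := by
    rw [← Real.rpow_natCast, ← Real.rpow_mul h0, Real.sqrt_eq_rpow]; norm_num
  refine Real.sqrt_le_iff.mpr ⟨by positivity, ?_⟩
  rw [mul_pow, h1, rate, ← hr]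
  have h2 : 1 ≤ √(1 + r ^ 2) := Real.one_le_sqrt.mpr (by nlinarith [norm_nonneg ξ])
  have h3 : r ≤ √(1 + r ^ 2) := Real.le_sqrt_of_sq_le (by linarith)
  nlinarith [Real.pi_lt_d2, Real.pi_pos]

lemma layerHeight_nonneg (ξ : Horiz d) : 0 ≤ layerHeight ξ := by
  have := rate_nonneg ξ
  unfold layerHeight; positivity

@[fun_prop]
lemma measurable_layerHeight : Measurable (layerHeight : Horiz d → ℝ) := by
  unfold layerHeight; fun_prop

/-- At high frequency the layer height decays like `rate^(-1/2)`. -/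
lemma inv_layerHeight_le_of_one_le {ξ : Horiz d} (h : 1 ≤ rate ξ) :
    (layerHeight ξ)⁻¹ ≤ 2 * √(1 + rate ξ) := by
  set k := rate ξ with hk
  have hs : √(1 + k) ^ 2 = 1 + k := Real.sq_sqrt (by linarith)
  have hs0 : 0 < √(1 + k) := Real.sqrt_pos.mpr (by linarith)
  rw [layerHeight, ← hk, inv_le_iff_one_le_mul₀ (by positivity)]
  have e : 2 * √(1 + k) * (√(1 + k) * (k / (1 + k) ^ 2)) = 2 * k / (1 + k) := by
    have : 2 * √(1 + k) * (√(1 + k) * (k / (1 + k) ^ 2)) =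
      √(1 + k) ^ 2 * (2 * k / (1 + k) ^ 2) := by ring
    rw [this, hs]
    field_simp
  rw [e, le_div_iff₀ (by linarith)]
  linarith

/-- At low frequency the layer height is comparable to the rate. -/
lemma rate_mul_inv_layerHeight_le {ξ : Horiz d} (h : rate ξ < 1) :
    rate ξ * (layerHeight ξ)⁻¹ ≤ 4 := by
  set k := rate ξ with hk
  have hk0 : 0 ≤ k := rate_nonneg ξ
  rcases hk0.eq_or_lt with h0 | hpos
  · rw [← h0]; norm_num
  have hs1 : 1 ≤ √(1 + k) := Real.one_le_sqrt.mpr (by linarith)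
  rw [layerHeight, ← hk, ← div_eq_mul_inv, div_le_iff₀ (by positivity)]
  have : 4 * (√(1 + k) * (k / (1 + k) ^ 2)) = k * (4 * √(1 + k) / (1 + k) ^ 2) := by ring
  rw [this]
  refine le_mul_of_one_le_right hpos.le ?_
  rw [le_div_iff₀ (by positivity)]
  nlinarith

end FourierSolution

/-! ### Layer amplitudes -/

section Amplitude

variable {d : ℕ} {h : ℝ}

/-- The kernel of the contribution of the divergence to the layer amplitude. At low
frequency the exponential is subtracted from `1`, which makes the kernel small: the term `1` is
accounted for by the vertical integral of the divergence in the defect. -/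
def amplitudeKernel (b : ℝ) (ξ : Horiz d) (s : ℝ) : ℂ :=
  (Iio b).indicator (fun s => ((((if rate ξ < 1 then 1 else 0) - Real.exp (-(rate ξ * (b - s)))) *
    (layerHeight ξ)⁻¹ : ℝ) : ℂ)) s

lemma measurable_amplitudeKernel (b : ℝ) :
    Measurable fun p : Horiz d × ℝ => amplitudeKernel b p.1 p.2 := by
  have e : (fun p : Horiz d × ℝ => amplitudeKernel b p.1 p.2) =
      {p : Horiz d × ℝ | p.2 < b}.indicator (fun p => ((((if rate p.1 < 1 then 1 else 0) -
        Real.exp (-(rate p.1 * (b - p.2)))) * (layerHeight p.1)⁻¹ : ℝ) : ℂ)) := by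
    ext p
    simp only [amplitudeKernel, indicator, mem_Iio, mem_ofPred_eq]
  rw [e]
  refine Measurable.indicator ?_ (measurableSet_lt measurable_snd measurable_const)
  have h1 : Measurable fun p : Horiz d × ℝ => if rate p.1 < 1 then (1 : ℝ) else 0 :=
    Measurable.ite (measurableSet_lt (by fun_prop) measurable_const) measurable_const
      measurable_const
  fun_prop

lemma lintegral_rate_mul_exp_le (k b h : ℝ) (hk : 0 ≤ k) (hb : 0 ≤ b) :
    ∫⁻ s in Ioo 0 h, ENNReal.ofReal ((Iio b).indicator
      (fun s => k * Real.exp (-(k * (b - s)))) s) ≤ 1 := by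
  have h1 : ∫⁻ s in Ioo 0 h, ENNReal.ofReal ((Iio b).indicator
      (fun s => k * Real.exp (-(k * (b - s)))) s) ≤
      ∫⁻ s in Ioo 0 b, ENNReal.ofReal (k * Real.exp (-(k * (b - s)))) := by
    rw [← lintegral_indicator measurableSet_Ioo, ← lintegral_indicator measurableSet_Ioo]
    refine lintegral_mono fun s => ?_
    by_cases hs : s ∈ Ioo 0 h
    · by_cases hsb : s ∈ Iio b
      · rw [indicator_of_mem hs, indicator_of_mem hsb,
          indicator_of_mem (show s ∈ Ioo 0 b from ⟨hs.1, hsb⟩)]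
      · rw [indicator_of_mem hs, indicator_of_notMem hsb]
        simp
    · simp [indicator_of_notMem hs]
  refine h1.trans ?_
  rw [← ofReal_integral_eq_lintegral_ofReal
    ((Continuous.integrableOn_Icc (by fun_prop)).mono_set Ioo_subset_Icc_self)
    (Eventually.of_forall fun s => by positivity), ← integral_Ioc_eq_integral_Ioo,
    ← intervalIntegral.integral_of_le hb]
  have hd : ∀ s ∈ uIcc 0 b, HasDerivAt (fun s => Real.exp (-(k * (b - s))))
      (k * Real.exp (-(k * (b - s)))) s := fun s _ => by
    have := ((((hasDerivAt_id s).const_sub b).const_mul k).neg).exp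
    exact this.congr_deriv (by simp [mul_comm])
  rw [intervalIntegral.integral_eq_sub_of_hasDerivAt hd
    (Continuous.intervalIntegrable (by fun_prop) _ _), ENNReal.ofReal_le_one]
  simp [Real.exp_nonneg]

lemma lintegral_amplitudeKernel_le {b : ℝ} (hb : 0 ≤ b) (hh : 0 ≤ h) (ξ : Horiz d) :
    ∫⁻ s in Ioo 0 h, ‖amplitudeKernel b ξ s‖ₑ ^ 2 ≤ ENNReal.ofReal ((4 * b) ^ 2 * h + 8) := by
  have hk0 := rate_nonneg ξ
  have hL0 : 0 ≤ (layerHeight ξ)⁻¹ := inv_nonneg.mpr (layerHeight_nonneg ξ)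
  have hsq : ∀ s, ‖amplitudeKernel b ξ s‖ₑ ^ 2 =
      ENNReal.ofReal (‖amplitudeKernel b ξ s‖ ^ 2) := fun s => by
    rw [← ofReal_norm, ENNReal.ofReal_pow (norm_nonneg _)]
  simp only [hsq]
  -- low frequency: `1 - exp(-k t) ≤ k t` compensates the factor `k⁻¹`; high frequency: the square
  -- of the kernel is at most a multiple of `k exp(-k t)`, which is integrable uniformly in `k`
  rcases lt_or_ge (rate ξ) 1 with hlt | hge
  · have hpt : ∀ s ∈ Ioo 0 h, ENNReal.ofReal (‖amplitudeKernel b ξ s‖ ^ 2) ≤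
        ENNReal.ofReal ((4 * b) ^ 2) := fun s hs => by
      refine ENNReal.ofReal_le_ofReal (pow_le_pow_left₀ (norm_nonneg _) ?_ 2)
      by_cases hsb : s ∈ Iio b
      · rw [amplitudeKernel, indicator_of_mem hsb, Complex.norm_real, if_pos hlt, norm_mul,
          Real.norm_of_nonneg hL0]
        have hsb' : s < b := hsb
        have hkb : 0 ≤ rate ξ * (b - s) := mul_nonneg hk0 (by linarith)
        have h1 : ‖1 - Real.exp (-(rate ξ * (b - s)))‖ ≤ rate ξ * b := by
          rw [Real.norm_of_nonneg (by
            have := Real.exp_le_one_iff.mpr (neg_nonpos.mpr hkb); linarith)]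
          have := Real.add_one_le_exp (-(rate ξ * (b - s)))
          nlinarith [hs.1]
        calc _ ≤ rate ξ * b * (layerHeight ξ)⁻¹ := by gcongr
          _ = (rate ξ * (layerHeight ξ)⁻¹) * b := by ring
          _ ≤ 4 * b := by gcongr; exact rate_mul_inv_layerHeight_le hlt
      · rw [amplitudeKernel, indicator_of_notMem hsb, norm_zero]; positivity
    refine (setLIntegral_mono' measurableSet_Ioo hpt).trans ?_
    rw [setLIntegral_const, Real.volume_Ioo, sub_zero, ← ENNReal.ofReal_mul (by positivity)]
    exact ENNReal.ofReal_le_ofReal (by linarith)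
  · have hpt : ∀ s, ENNReal.ofReal (‖amplitudeKernel b ξ s‖ ^ 2) ≤ ENNReal.ofReal 8 *
        ENNReal.ofReal ((Iio b).indicator
          (fun s => rate ξ * Real.exp (-(rate ξ * (b - s)))) s) := fun s => by
      by_cases hsb : s ∈ Iio b
      · rw [amplitudeKernel, indicator_of_mem hsb, indicator_of_mem hsb, Complex.norm_real,
          if_neg (not_lt.mpr hge), zero_sub, norm_mul, norm_neg,
          Real.norm_of_nonneg (Real.exp_pos _).le, Real.norm_of_nonneg hL0,
          ← ENNReal.ofReal_mul (by norm_num)]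
        refine ENNReal.ofReal_le_ofReal ?_
        have hsb' : s < b := hsb
        have h1 : Real.exp (-(rate ξ * (b - s))) ≤ 1 := by
          rw [Real.exp_le_one_iff, neg_nonpos]
          exact mul_nonneg hk0 (by linarith)
        have h2 := inv_layerHeight_le_of_one_le hge
        have h3 : (layerHeight ξ)⁻¹ ^ 2 ≤ 8 * rate ξ := by
          refine (pow_le_pow_left₀ hL0 h2 2).trans ?_
          rw [mul_pow, Real.sq_sqrt (by linarith)]
          linarith
        set e := Real.exp (-(rate ξ * (b - s)))
        have he : 0 ≤ e := (Real.exp_pos _).le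
        calc (e * (layerHeight ξ)⁻¹) ^ 2 = e * e * (layerHeight ξ)⁻¹ ^ 2 := by ring
          _ ≤ e * 1 * (8 * rate ξ) := by gcongr
          _ = 8 * (rate ξ * e) := by ring
      · simp [amplitudeKernel, indicator_of_notMem hsb]
    refine (lintegral_mono hpt).trans ?_
    rw [lintegral_const_mul' _ _ ENNReal.ofReal_ne_top]
    refine (mul_le_mul_right (lintegral_rate_mul_exp_le _ b h hk0 hb) _).trans ?_
    rw [mul_one]
    exact ENNReal.ofReal_le_ofReal (by nlinarith [mul_nonneg (sq_nonneg (4 * b)) hh])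

/-- The layer amplitude that corrects the trace of Duhamel's integral at height `b` to `ĝ`. It is
bounded by `G = (1 + |ξ|²)^{1/4} ĝ` at high frequency, and by the weighted defect
`D = |ξ|⁻¹ (ĝ - ∫_{(0, b)} F)` at low frequency. -/
lemma exists_amplitude (hd : 1 ≤ d) (hh : 0 ≤ h) {b : ℝ} (hb : 0 < b) (hbh : b ≤ h) :
    ∃ R : L2Slab d h ℂ × L2Horiz d ℂ × L2Horiz d ℂ →L[ℂ] L2Horiz d ℂ,
      ∀ (F : L2Slab d h ℂ) (g G D : L2Horiz d ℂ),
        (G =ᵐ[volume] fun ξ => (1 + ‖ξ‖ ^ 2) ^ ((1 / 2 : ℝ) / 2) • g ξ) →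
        (D =ᵐ[volume] fun ξ => ‖ξ‖ ^ (-1 : ℝ) • (g - vertInt b F) ξ) →
        ∀ᵐ ξ, layerHeight ξ * R (F, G, D) ξ =
          g ξ - duhamel (rate ξ) (fun s => F (ξ, s)) b := by
  -- the amplitude is `c₁ G + c₂ D` plus the integral of `F` against `amplitudeKernel`
  let c₁ : Horiz d → ℂ := fun ξ => ((if rate ξ < 1 then 0 else
    (layerHeight ξ)⁻¹ * ((1 + ‖ξ‖ ^ 2) ^ ((1 / 2 : ℝ) / 2))⁻¹ : ℝ) : ℂ)
  let c₂ : Horiz d → ℂ := fun ξ => ((if rate ξ < 1 then ‖ξ‖ * (layerHeight ξ)⁻¹ else 0 : ℝ) : ℂ)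
  have hset : MeasurableSet {ξ : Horiz d | rate ξ < 1} :=
    measurableSet_lt (by fun_prop) measurable_const
  have hc₁ : Measurable c₁ := Complex.measurable_ofReal.comp
    (Measurable.ite hset measurable_const (by fun_prop))
  have hc₂ : Measurable c₂ := Complex.measurable_ofReal.comp
    (Measurable.ite hset (by fun_prop) measurable_const)
  have hw : ∀ ξ : Horiz d, 0 < (1 + ‖ξ‖ ^ 2) ^ ((1 / 2 : ℝ) / 2) := fun ξ => by positivity
  obtain ⟨M₁, hM₁⟩ := exists_mul_clm (μ := (volume : Measure (Horiz d))) hc₁ (C := 6) fun ξ => by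
    simp only [c₁, Complex.norm_real]
    split_ifs with hlt
    · norm_num
    · rw [norm_mul, norm_inv, norm_inv, Real.norm_of_nonneg (layerHeight_nonneg ξ),
        Real.norm_of_nonneg (hw ξ).le, ← div_eq_mul_inv, div_le_iff₀ (hw ξ)]
      have h1 := inv_layerHeight_le_of_one_le (not_lt.mp hlt)
      have h2 := sqrt_one_add_rate_le ξ
      linarith
  obtain ⟨M₂, hM₂⟩ := exists_mul_clm (μ := (volume : Measure (Horiz d))) hc₂ (C := 4) fun ξ => by
    simp only [c₂, Complex.norm_real]
    split_ifs with hlt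
    · have h1 := rate_mul_inv_layerHeight_le hlt
      have h2 : ‖ξ‖ ≤ rate ξ := by
        rw [rate]; nlinarith [Real.pi_gt_three, norm_nonneg ξ]
      have h3 := inv_nonneg.mpr (layerHeight_nonneg ξ)
      rw [norm_mul, norm_norm, Real.norm_of_nonneg h3]
      nlinarith
    · norm_num
  obtain ⟨M₃, hM₃⟩ := exists_kernelInt (d := d) (h := h) (measurable_amplitudeKernel b)
    (lintegral_amplitudeKernel_le hb.le hh)
  let R : L2Slab d h ℂ × L2Horiz d ℂ × L2Horiz d ℂ →L[ℂ] L2Horiz d ℂ :=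
    M₃ ∘L ContinuousLinearMap.fst ℂ _ _ +
      (M₁ ∘L ContinuousLinearMap.fst ℂ _ _ + M₂ ∘L ContinuousLinearMap.snd ℂ _ _) ∘L
        ContinuousLinearMap.snd ℂ _ _
  refine ⟨R, fun F g G D hG hD => ?_⟩
  have hR : R (F, G, D) = M₃ F + (M₁ G + M₂ D) := rfl
  rw [hR]
  -- division by `|ξ|` is legitimate almost everywhere, as `ℝᵈ` has positive dimension
  have : Nonempty (Fin d) := ⟨⟨0, hd⟩⟩
  have hne : ∀ᵐ ξ : Horiz d, ξ ≠ 0 := by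
    rw [ae_iff]; simp
  filter_upwards [hG, hD, hne, Lp.coeFn_add (M₃ F) (M₁ G + M₂ D), Lp.coeFn_add (M₁ G) (M₂ D),
    hM₁ G, hM₂ D, hM₃ F, Lp.coeFn_sub g (vertInt b F), coeFn_vertInt b F, integrable_slice_left F]
    with ξ e1 e2 hξ e3 e4 e5 e6 e7 e8 e9 hFi
  rw [e3, Pi.add_apply, e4, Pi.add_apply, e5, e6, e7, e1, e2, e8, Pi.sub_apply, e9,
    min_eq_left hbh]
  have hi : Integrable (fun s => F (ξ, s)) (volume.restrict (Ioo 0 b)) :=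
    hFi.mono_measure (Measure.restrict_mono (Ioo_subset_Ioo_right hbh) le_rfl)
  have hset : Ioo 0 b = Ioo 0 h ∩ Iio b := by
    ext s; simp only [mem_Ioo, mem_inter_iff, mem_Iio]; constructor
    · rintro ⟨h1, h2⟩; exact ⟨⟨h1, h2.trans_le hbh⟩, h2⟩
    · rintro ⟨⟨h1, _⟩, h3⟩; exact ⟨h1, h3⟩
  have hei : Integrable (fun s => (Real.exp (-(rate ξ * (b - s))) : ℂ) * F (ξ, s))
      (volume.restrict (Ioo 0 b)) := by
    refine hi.bdd_mul (c := 1) (by fun_prop) ?_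
    filter_upwards [ae_restrict_mem measurableSet_Ioo] with s hs
    rw [Complex.norm_real, Real.norm_of_nonneg (Real.exp_pos _).le, Real.exp_le_one_iff,
      neg_nonpos]
    exact mul_nonneg (rate_nonneg ξ) (by linarith [hs.2])
  have hker : ∫ s in Ioo 0 h, amplitudeKernel b ξ s * F (ξ, s) =
      ((layerHeight ξ : ℂ))⁻¹ * ((if rate ξ < 1 then 1 else 0) * (∫ s in Ioo 0 b, F (ξ, s)) -
        duhamel (rate ξ) (fun s => F (ξ, s)) b) := by
    rw [duhamel, ← integral_const_mul, ← integral_sub (hi.const_mul _) hei, ← integral_const_mul,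
      hset, ← setIntegral_indicator measurableSet_Iio]
    refine integral_congr_ae (Eventually.of_forall fun s => ?_)
    by_cases hs : s ∈ Iio b
    · simp only [amplitudeKernel, indicator_of_mem hs]
      push_cast
      split_ifs <;> simp <;> ring
    · simp [amplitudeKernel, indicator_of_notMem hs]
  have hn : 0 < ‖ξ‖ := norm_pos_iff.mpr hξ
  have hrate : 0 < rate ξ := by unfold rate; positivity
  have hLH : layerHeight ξ ≠ 0 := by
    have : 0 < layerHeight ξ := by unfold layerHeight; positivity
    exact this.ne'
  have hLc : (layerHeight ξ : ℂ) ≠ 0 := by exact_mod_cast hLH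
  have hnc : (‖ξ‖ : ℂ) ≠ 0 := by exact_mod_cast hn.ne'
  have hwc : (((1 + ‖ξ‖ ^ 2) ^ ((1 / 2 : ℝ) / 2) : ℝ) : ℂ) ≠ 0 := by exact_mod_cast (hw ξ).ne'
  rw [hker]
  simp only [c₁, c₂, Complex.real_smul, Real.rpow_neg_one]
  set w : ℝ := (1 + ‖ξ‖ ^ 2) ^ ((1 / 2 : ℝ) / 2)
  split_ifs with hlt
  · push_cast
    field_simp
    ring
  · push_cast
    field_simp
    ring

end Amplitude

/-! ### Vector fields assembled from scalar components -/

section Assembly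

variable {d : ℕ} {h b : ℝ}

section Target

variable {V : Type*} [NormedAddCommGroup V] [NormedSpace ℝ V]

lemma HasWeakDeriv.compLp [CompleteSpace V] (T : ℂ →L[ℝ] V) {v : Horiz d × ℝ}
    {u w : L2Slab d h ℂ} (H : HasWeakDeriv (slab d h) v u w) :
    HasWeakDeriv (slab d h) v (T.compLp u) (T.compLp w) := by
  refine HasWeakDeriv.congr (u := fun p => T (u p)) (w := fun p => T (w p)) ?_
    (T.coeFn_compLp u) (T.coeFn_compLp w)
  intro φ h1 h2 h3
  simp only [← map_smul]
  rw [T.integral_comp_comm (integrable_dtest_smul u h1 h2 v),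
    T.integral_comp_comm (integrable_test_smul w h1.continuous h2), H φ h1 h2 h3, map_neg]

lemma HasTrace.compLp (T : ℂ →L[ℝ] V) {u : L2Slab d h ℂ} {g : L2Horiz d ℂ}
    (H : HasTrace h b u g) : HasTrace h b (T.compLp u) (T.compLp g) := by
  obtain ⟨u', h1, h2, h3⟩ := H
  refine ⟨fun p => T (u' p), ?_, ?_, ?_⟩
  · filter_upwards [T.coeFn_compLp u, h1] with p e1 e2
    rw [e1, e2]
  · filter_upwards [h2] with x hx
    exact hx.comp_lipschitz T.lipschitz
  · filter_upwards [h3, T.coeFn_compLp g] with x e1 e2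
    rw [e1, e2]

end Target

lemma HasTrace.sum {ι V : Type*} [NormedAddCommGroup V] (s : Finset ι)
    {u : ι → L2Slab d h V} {g : ι → L2Horiz d V}
    (H : ∀ i, HasTrace h b (u i) (g i)) :
    HasTrace h b (∑ i ∈ s, u i : L2Slab d h V) (∑ i ∈ s, g i : L2Horiz d V) := by
  classical
  induction s using Finset.induction_on with
  | empty =>
    simp only [Finset.sum_empty]
    exact hasTrace_zero.congr (Lp.coeFn_zero _ _ _) (Lp.coeFn_zero _ _ _).symm
  | insert i s hi ih =>
    rw [Finset.sum_insert hi, Finset.sum_insert hi]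
    exact ((H i).add ih).congr (Lp.coeFn_add _ _) (Lp.coeFn_add _ _).symm

variable (𝕂 : Type*) [RCLike 𝕂]

/-- The scalar field `z` as the `j`-th component of a vector field; for `𝕂 = ℝ` this takes the
real part. -/
def component (d : ℕ) (j : Fin (d + 1)) : ℂ →L[ℝ] Vec 𝕂 d :=
  ((PiLp.continuousLinearEquiv 2 ℝ (fun _ : Fin (d + 1) => 𝕂)).symm.toContinuousLinearMap).comp
    ((ContinuousLinearMap.single ℝ (fun _ : Fin (d + 1) => 𝕂) j).comp (RCLike.map ℂ 𝕂))

variable {𝕂}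

lemma component_apply (j i : Fin (d + 1)) (z : ℂ) :
    component 𝕂 d j z i = if i = j then RCLike.map ℂ 𝕂 z else 0 := by
  change (Pi.single j (RCLike.map ℂ 𝕂 z) : Fin (d + 1) → 𝕂) i = _
  rw [Pi.single_apply]

lemma map_map_complex (c : 𝕂) : RCLike.map ℂ 𝕂 (RCLike.map 𝕂 ℂ c) = c := by
  rw [RCLike.map_apply, RCLike.map_apply]
  simp

lemma map_mul_map_complex (c : 𝕂) (z : ℂ) :
    RCLike.map ℂ 𝕂 (RCLike.map 𝕂 ℂ c * z) = c * RCLike.map ℂ 𝕂 z := by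
  rcases RCLike.I_eq_zero_or_im_I_eq_one (K := 𝕂) with hI | hI
  · apply RCLike.ext <;> simp [RCLike.map_apply, RCLike.im_eq_zero hI]
  · apply RCLike.ext <;> simp [RCLike.map_apply, hI]

lemma component_map_mul (c : 𝕂) (j : Fin (d + 1)) (z : ℂ) :
    component 𝕂 d j (RCLike.map 𝕂 ℂ c * z) = c • component 𝕂 d j z := by
  ext i
  rw [PiLp.smul_apply, component_apply, component_apply, map_mul_map_complex]
  split_ifs <;> simp

lemma compLp_component_smul (c : 𝕂) (j : Fin (d + 1)) (u : L2Slab d h ℂ) :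
    (component 𝕂 d j).compLp (RCLike.map 𝕂 ℂ c • u) = c • (component 𝕂 d j).compLp u := by
  refine Lp.ext ?_
  filter_upwards [(component 𝕂 d j).coeFn_compLp (RCLike.map 𝕂 ℂ c • u),
    (component 𝕂 d j).coeFn_compLp u, Lp.coeFn_smul (RCLike.map 𝕂 ℂ c) u,
    Lp.coeFn_smul c ((component 𝕂 d j).compLp u)] with p e1 e2 e3 e4
  rw [e1, e3, e4, Pi.smul_apply, Pi.smul_apply, e2, smul_eq_mul, component_map_mul]

lemma sum_compLp_component {X : Type*} {_ : MeasurableSpace X} {μ : Measure X}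
    (u : Fin (d + 1) → Lp ℂ 2 μ) (i : Fin (d + 1)) :
    (fun p => (∑ j, (component 𝕂 d j).compLp (u j) : Lp (Vec 𝕂 d) 2 μ) p i) =ᵐ[μ]
      fun p => RCLike.map ℂ 𝕂 (u i p) := by
  have hs := coeFn_sum_Lp Finset.univ (fun j => (component 𝕂 d j).compLp (u j))
  filter_upwards [hs, eventually_all.mpr fun j => (component 𝕂 d j).coeFn_compLp (u j)]
    with p e1 e2
  rw [e1]
  simp [e2, component_apply]

/-- Scalar fields `u_j` with weak derivatives `D i j` and vanishing trace at the bottom are the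
components of a vector field in `₀H¹`. -/
lemma exists_vectorField {E : Type*} [NormedAddCommGroup E] [NormedSpace ℝ E] [NormedSpace ℂ E]
    [IsScalarTower ℝ ℂ E] (u : Fin (d + 1) → E →L[ℂ] L2Slab d h ℂ)
    (D : Fin (d + 1) → Fin (d + 1) → E →L[ℂ] L2Slab d h ℂ)
    (hD : ∀ i j z, HasWeakDeriv (slab d h) (dir d i) (u j z) (D i j z))
    (h0 : ∀ j z, HasTrace h 0 (u j z) 0) :
    ∃ J : E →L[ℝ] Jet 𝕂 d h, (∀ (c : 𝕂) z, J (RCLike.map 𝕂 ℂ c • z) = c • J z) ∧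
      ∀ z, J z ∈ ZeroH1 𝕂 d h ∧
        (fun p => ∑ j, (J z).snd j p j) =ᵐ[volume.restrict (slab d h)]
          (fun p => RCLike.map ℂ 𝕂 ((∑ j, D j j z : L2Slab d h ℂ) p)) ∧
        ∀ (b : ℝ) (g : Fin (d + 1) → L2Horiz d ℂ), (∀ j, HasTrace h b (u j z) (g j)) →
          ∃ G : L2Horiz d (Vec 𝕂 d), HasTrace h b (J z).fst G ∧
            (fun x => G x (Fin.last d)) =ᵐ[volume] fun x => RCLike.map ℂ 𝕂 (g (Fin.last d) x) := by
  let T : Fin (d + 1) → L2Slab d h ℂ →L[ℝ] L2Slab d h (Vec 𝕂 d) := fun j =>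
    (component 𝕂 d j).compLpL 2 _
  let J : E →L[ℝ] Jet 𝕂 d h :=
    ((WithLp.prodContinuousLinearEquiv 2 ℝ _ _).symm.toContinuousLinearMap).comp
      ((∑ j, (T j).comp ((u j).restrictScalars ℝ)).prod
        (((PiLp.continuousLinearEquiv 2 ℝ _).symm.toContinuousLinearMap).comp
          (ContinuousLinearMap.pi fun i => ∑ j, (T j).comp ((D i j).restrictScalars ℝ))))
  have hJ1 : ∀ z, (J z).fst = ∑ j, (component 𝕂 d j).compLp (u j z) := fun z => by
    change (∑ j, (T j).comp ((u j).restrictScalars ℝ)) z = _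
    rw [sum_apply]; rfl
  have hJ2 : ∀ z i, (J z).snd i = ∑ j, (component 𝕂 d j).compLp (D i j z) := fun z i => by
    change (∑ j, (T j).comp ((D i j).restrictScalars ℝ)) z = _
    rw [sum_apply]; rfl
  refine ⟨J, fun c z => ?_, fun z => ⟨⟨fun i => ?_, ?_⟩, ?_, fun b g hg => ?_⟩⟩
  · refine WithLp.ofLp_injective 2 (Prod.ext ?_ (WithLp.ofLp_injective 2 (funext fun i => ?_)))
    · change (J _).fst = c • (J z).fst
      rw [hJ1, hJ1, Finset.smul_sum]
      exact Finset.sum_congr rfl fun j _ => by rw [map_smul, compLp_component_smul]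
    · change (J _).snd i = c • (J z).snd i
      rw [hJ2, hJ2, Finset.smul_sum]
      exact Finset.sum_congr rfl fun j _ => by rw [map_smul, compLp_component_smul]
  · rw [hJ1, hJ2]
    generalize (Finset.univ : Finset (Fin (d + 1))) = s
    induction s using Finset.induction_on with
    | empty => simpa using hasWeakDeriv_zero _
    | insert j s hj ih =>
      rw [Finset.sum_insert hj, Finset.sum_insert hj]
      exact ((hD i j z).compLp _).add ih
  · rw [hJ1]
    have h00 : ∀ j, HasTrace h 0 (u j z) (0 : L2Horiz d ℂ) := fun j =>
      (h0 j z).congr .rfl (Lp.coeFn_zero _ _ _).symm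
    refine (HasTrace.sum Finset.univ fun j => (h00 j).compLp (component 𝕂 d j)).congr .rfl ?_
    have : ∑ j, (component 𝕂 d j).compLp (0 : L2Horiz d ℂ) = 0 :=
      Finset.sum_eq_zero fun j _ => ((component 𝕂 d j).compLpL 2 volume).map_zero
    rw [this]
    exact Lp.coeFn_zero _ _ _
  · have e : ∀ i, (fun p => (J z).snd i p i) =ᵐ[volume.restrict (slab d h)]
        fun p => RCLike.map ℂ 𝕂 (D i i z p) := fun i => by
      rw [hJ2]; exact sum_compLp_component (fun j => D i j z) i
    filter_upwards [eventually_all.mpr e, coeFn_sum_Lp Finset.univ (fun j => D j j z)] with p e1 e2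
    rw [e2, map_sum]
    exact Finset.sum_congr rfl fun j _ => e1 j
  · refine ⟨∑ j, (component 𝕂 d j).compLp (g j), ?_, sum_compLp_component g _⟩
    rw [hJ1]
    exact HasTrace.sum Finset.univ fun j => (hg j).compLp _

end Assembly

/-! ### The data space -/

section Complexification

variable {𝕂 : Type*} [RCLike 𝕂] {d : ℕ} {h : ℝ}

/-- The inclusion of `𝕂`-valued into complex-valued functions in `L²`. -/
def complexify {X : Type*} {_ : MeasurableSpace X} (μ : Measure X) : Lp 𝕂 2 μ →L[ℝ] Lp ℂ 2 μ :=
  (RCLike.map 𝕂 ℂ).compLpL 2 μ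

section

variable {X : Type*} {_ : MeasurableSpace X} {μ : Measure X}

lemma coeFn_complexify (f : Lp 𝕂 2 μ) :
    complexify μ f =ᵐ[μ] fun p => RCLike.map 𝕂 ℂ (f p) := (RCLike.map 𝕂 ℂ).coeFn_compLp f

lemma norm_complexify (f : Lp 𝕂 2 μ) : ‖complexify μ f‖ = ‖f‖ := by
  refine le_antisymm (Lp.norm_le_norm_of_ae_le ?_) (Lp.norm_le_norm_of_ae_le ?_) <;>
  · filter_upwards [coeFn_complexify f] with p hp
    rw [hp, norm_map_complex]

lemma complexify_smul (c : 𝕂) (f : Lp 𝕂 2 μ) :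
    complexify μ (c • f) = RCLike.map 𝕂 ℂ c • complexify μ f := by
  refine Lp.ext ?_
  filter_upwards [coeFn_complexify (c • f), coeFn_complexify f, Lp.coeFn_smul c f,
    Lp.coeFn_smul (RCLike.map 𝕂 ℂ c) (complexify μ f)] with p e1 e2 e3 e4
  rw [e1, e3, e4, Pi.smul_apply, Pi.smul_apply, e2, smul_eq_mul, map_mul_complex, smul_eq_mul]

end

lemma vertInt_complexify (b : ℝ) (f : L2Slab d h 𝕂) :
    vertInt b (complexify _ f) = complexify _ (vertInt b f) := by
  refine Lp.ext ?_
  filter_upwards [coeFn_vertInt b (complexify _ f), coeFn_complexify (vertInt b f),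
    coeFn_vertInt b f, integrable_slice b f, ae_slab_right (coeFn_complexify f)]
    with x e1 e2 e3 e4 e5
  rw [e1, e2, e3, ← (RCLike.map 𝕂 ℂ).integral_comp_comm e4]
  exact integral_congr_ae (ae_mono
    (Measure.restrict_mono (Ioo_subset_Ioo_right (min_le_right _ _)) le_rfl) e5)

lemma hat_eq (g : L2Horiz d 𝕂) : hat g = 𝓕 (complexify volume g) := rfl

lemma hat_sub (g k : L2Horiz d 𝕂) : hat (g - k) = hat g - hat k := by
  rw [hat_eq, map_sub]
  exact map_sub (Lp.fourierTransformₗᵢ (Horiz d) ℂ) _ _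

lemma norm_hat (g : L2Horiz d 𝕂) : ‖hat g‖ = ‖g‖ := by
  rw [hat_eq, Lp.norm_fourier_eq, norm_complexify]

lemma continuous_hat : Continuous (hat : L2Horiz d 𝕂 → L2Horiz d ℂ) := by
  refine (Isometry.of_dist_eq fun g k => ?_).continuous
  rw [dist_eq_norm, dist_eq_norm, ← hat_sub, norm_hat]

lemma continuous_vertInt_rclike (b : ℝ) :
    Continuous (vertInt b : L2Slab d h 𝕂 → L2Horiz d 𝕂) := by
  have hiso : Isometry (complexify (𝕂 := 𝕂) (volume : Measure (Horiz d))) :=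
    Isometry.of_dist_eq fun g k => by
      rw [dist_eq_norm, dist_eq_norm, ← map_sub, norm_complexify]
  rw [hiso.isUniformInducing.isInducing.continuous_iff]
  have : (complexify volume) ∘ (vertInt b : L2Slab d h 𝕂 → L2Horiz d 𝕂) =
      (vertInt b : L2Slab d h ℂ → L2Horiz d ℂ) ∘ complexify _ :=
    funext fun f => (vertInt_complexify b f).symm
  rw [this]
  exact (continuous_vertInt b).comp (complexify _).continuous

/-- Multiplication by a weight is a closed operator in `L²`, since a subsequence converges almost
everywhere. -/
lemma ae_eq_smul_of_tendsto {wt : Horiz d → ℝ} {u v : ℕ → L2Horiz d ℂ} {u₀ v₀ : L2Horiz d ℂ}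
    (huv : ∀ n, v n =ᵐ[volume] fun ξ => wt ξ • u n ξ) (hu : Tendsto u atTop (nhds u₀))
    (hv : Tendsto v atTop (nhds v₀)) : v₀ =ᵐ[volume] fun ξ => wt ξ • u₀ ξ := by
  obtain ⟨n₁, hn₁, h1⟩ := (tendstoInMeasure_of_tendsto_Lp hu).exists_seq_tendsto_ae
  obtain ⟨n₂, hn₂, h2⟩ := (tendstoInMeasure_of_tendsto_Lp
    (hv.comp hn₁.tendsto_atTop)).exists_seq_tendsto_ae
  filter_upwards [h1, h2, ae_all_iff.mpr huv] with ξ e1 e2 e3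
  refine tendsto_nhds_unique e2 ?_
  have := (e1.comp hn₂.tendsto_atTop).const_smul (wt ξ)
  exact this.congr fun k => (e3 _).symm

end Complexification

namespace DataSpace

variable {𝕂 : Type*} [RCLike 𝕂] {d m : ℕ} {a : Fin (m + 1) → ℝ}

section

variable {wt : Horiz d → ℝ}

lemma memLp_smul_hat (hwt : Measurable wt) {g : L2Horiz d 𝕂} (hg : weightedNorm wt g < ⊤) :
    MemLp (fun ξ => wt ξ • hat g ξ) 2 volume :=
  ⟨hwt.aestronglyMeasurable.smul (Lp.aestronglyMeasurable _), hg⟩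

/-- The Fourier transform, multiplied by a weight, of a datum depending linearly on a point of
the data space, as an element of `L²`. -/
def weightedHat (hwt : Measurable wt) (P : DataSpace 𝕂 d a →ₗ[𝕂] L2Horiz d 𝕂)
    (hP : ∀ x, weightedNorm wt (P x) < ⊤) : DataSpace 𝕂 d a →+ L2Horiz d ℂ :=
  AddMonoidHom.mk' (fun x => (memLp_smul_hat hwt (hP x)).toLp _) fun x y => by
    rw [← MemLp.toLp_add]
    refine MemLp.toLp_congr _ _ ?_
    rw [map_add, hat_add]
    filter_upwards [Lp.coeFn_add (hat (P x)) (hat (P y))] with ξ hξ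
    rw [hξ, Pi.add_apply, Pi.add_apply, smul_add]

variable (hwt : Measurable wt) (P : DataSpace 𝕂 d a →ₗ[𝕂] L2Horiz d 𝕂)
    (hP : ∀ x, weightedNorm wt (P x) < ⊤)

lemma coeFn_weightedHat (x : DataSpace 𝕂 d a) :
    weightedHat hwt P hP x =ᵐ[volume] fun ξ => wt ξ • hat (P x) ξ :=
  MemLp.coeFn_toLp (memLp_smul_hat hwt (hP x))

lemma norm_weightedHat (x : DataSpace 𝕂 d a) :
    ‖weightedHat hwt P hP x‖ = (weightedNorm wt (P x)).toReal :=
  Lp.norm_toLp _ (memLp_smul_hat hwt (hP x))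

lemma weightedHat_smul (c : 𝕂) (x : DataSpace 𝕂 d a) :
    weightedHat hwt P hP (c • x) = RCLike.map 𝕂 ℂ c • weightedHat hwt P hP x := by
  refine Lp.ext ?_
  have e1 := coeFn_weightedHat hwt P hP (c • x)
  rw [P.map_smul, hat_smul] at e1
  filter_upwards [e1, coeFn_weightedHat hwt P hP x, Lp.coeFn_smul (RCLike.map 𝕂 ℂ c) (hat (P x)),
    Lp.coeFn_smul (RCLike.map 𝕂 ℂ c) (weightedHat hwt P hP x)] with ξ e1 e2 e3 e4
  rw [e1, e3, e4, Pi.smul_apply, Pi.smul_apply, e2, smul_comm]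

end

/-- The function `(1 + |ξ|²)^{1/4} ĝ_ℓ`. -/
def sobolevPart (ℓ : Fin (m + 1)) : DataSpace 𝕂 d a →+ L2Horiz d ℂ :=
  weightedHat (sobolevWeight_measurable (1 / 2))
    ⟨⟨fun x => x.g ℓ, fun x y => g_add x y ℓ⟩, fun c x => g_smul c x ℓ⟩ fun x => (x.2 ℓ).1

/-- The function `|ξ|⁻¹` times the Fourier transform of `g_ℓ - ∫_{(0, a_ℓ)} f`. -/
def defectPart (ℓ : Fin (m + 1)) : DataSpace 𝕂 d a →+ L2Horiz d ℂ :=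
  weightedHat (homWeight_measurable (-1))
    ⟨⟨fun x => x.defect ℓ, fun x y => defect_add x y ℓ⟩, fun c x => defect_smul c x ℓ⟩
      fun x => (x.2 ℓ).2

lemma coeFn_sobolevPart (ℓ : Fin (m + 1)) (x : DataSpace 𝕂 d a) :
    sobolevPart ℓ x =ᵐ[volume] fun ξ => (1 + ‖ξ‖ ^ 2) ^ ((1 / 2 : ℝ) / 2) • hat (x.g ℓ) ξ :=
  coeFn_weightedHat _ _ _ x

lemma coeFn_defectPart (ℓ : Fin (m + 1)) (x : DataSpace 𝕂 d a) :
    defectPart ℓ x =ᵐ[volume] fun ξ => ‖ξ‖ ^ (-1 : ℝ) • hat (x.defect ℓ) ξ :=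
  coeFn_weightedHat _ _ _ x

lemma sobolevPart_smul (ℓ : Fin (m + 1)) (c : 𝕂) (x : DataSpace 𝕂 d a) :
    sobolevPart ℓ (c • x) = RCLike.map 𝕂 ℂ c • sobolevPart ℓ x := weightedHat_smul _ _ _ c x

lemma defectPart_smul (ℓ : Fin (m + 1)) (c : 𝕂) (x : DataSpace 𝕂 d a) :
    defectPart ℓ (c • x) = RCLike.map 𝕂 ℂ c • defectPart ℓ x := weightedHat_smul _ _ _ c x

lemma norm_sobolevPart (ℓ : Fin (m + 1)) (x : DataSpace 𝕂 d a) :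
    ‖sobolevPart ℓ x‖ = (sobolevNorm (1 / 2) (x.g ℓ)).toReal := norm_weightedHat _ _ _ x

lemma norm_defectPart (ℓ : Fin (m + 1)) (x : DataSpace 𝕂 d a) :
    ‖defectPart ℓ x‖ = (homSeminorm (-1) (x.defect ℓ)).toReal := norm_weightedHat _ _ _ x

lemma norm_sq_eq (x : DataSpace 𝕂 d a) :
    ‖x‖ ^ 2 = ‖x.f‖ ^ 2 + ∑ ℓ, (‖sobolevPart ℓ x‖ ^ 2 + ‖defectPart ℓ x‖ ^ 2) := by
  rw [norm_def, Real.sq_sqrt (by positivity)]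
  congr 1
  refine Finset.sum_congr rfl fun ℓ _ => ?_
  rw [norm_sobolevPart, norm_defectPart]

lemma norm_f_le (x : DataSpace 𝕂 d a) : ‖x.f‖ ≤ ‖x‖ := by
  refine abs_le_of_sq_le_sq' ?_ (norm_nonneg x) |>.2
  rw [norm_sq_eq]
  exact le_add_of_nonneg_right (by positivity)

lemma norm_parts_sq_le (ℓ : Fin (m + 1)) (x : DataSpace 𝕂 d a) :
    ‖sobolevPart ℓ x‖ ^ 2 + ‖defectPart ℓ x‖ ^ 2 ≤ ‖x‖ ^ 2 := by
  rw [norm_sq_eq]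
  exact (Finset.single_le_sum (f := fun ℓ => ‖sobolevPart ℓ x‖ ^ 2 + ‖defectPart ℓ x‖ ^ 2)
    (fun _ _ => by positivity) (Finset.mem_univ ℓ)).trans
      (le_add_of_nonneg_left (by positivity))

lemma norm_sobolevPart_le (ℓ : Fin (m + 1)) (x : DataSpace 𝕂 d a) : ‖sobolevPart ℓ x‖ ≤ ‖x‖ :=
  (abs_le_of_sq_le_sq' ((le_add_of_nonneg_right (sq_nonneg _)).trans (norm_parts_sq_le ℓ x))
    (norm_nonneg x)).2

lemma norm_defectPart_le (ℓ : Fin (m + 1)) (x : DataSpace 𝕂 d a) : ‖defectPart ℓ x‖ ≤ ‖x‖ :=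
  (abs_le_of_sq_le_sq' ((le_add_of_nonneg_left (sq_nonneg _)).trans (norm_parts_sq_le ℓ x))
    (norm_nonneg x)).2

/-- The Sobolev weight is at least `1`. -/
lemma norm_g_le (ℓ : Fin (m + 1)) (x : DataSpace 𝕂 d a) : ‖x.g ℓ‖ ≤ ‖sobolevPart ℓ x‖ := by
  rw [← norm_hat]
  refine Lp.norm_le_norm_of_ae_le ?_
  filter_upwards [coeFn_sobolevPart ℓ x] with ξ hξ
  rw [hξ, norm_smul]
  have h1 : (1 : ℝ) ≤ (1 + ‖ξ‖ ^ 2) ^ ((1 / 2 : ℝ) / 2) :=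
    Real.one_le_rpow (le_add_of_nonneg_right (sq_nonneg _)) (by norm_num)
  exact le_mul_of_one_le_left (norm_nonneg _) (h1.trans (le_abs_self _))

lemma f_sub (x y : DataSpace 𝕂 d a) : (x - y).f = x.f - y.f := rfl

lemma innerProductSpaceable : InnerProductSpaceable (DataSpace 𝕂 d a) := by
  refine ⟨fun x y => ?_⟩
  have key : ∀ u v : L2Horiz d ℂ, ‖u + v‖ ^ 2 + ‖u - v‖ ^ 2 = 2 * (‖u‖ ^ 2 + ‖v‖ ^ 2) :=
    fun u v => by simpa only [sq] using parallelogram_law_with_norm ℂ u v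
  have keyf : ‖x.f + y.f‖ ^ 2 + ‖x.f - y.f‖ ^ 2 = 2 * (‖x.f‖ ^ 2 + ‖y.f‖ ^ 2) := by
    simpa only [sq] using parallelogram_law_with_norm 𝕂 x.f y.f
  simp only [← sq, norm_sq_eq, map_add, map_sub, f_add, f_sub]
  have h1 := Finset.sum_congr rfl fun (ℓ : Fin (m + 1)) (_ : ℓ ∈ Finset.univ) =>
    congrArg₂ (· + ·) (key (sobolevPart ℓ x) (sobolevPart ℓ y))
      (key (defectPart ℓ x) (defectPart ℓ y))
  simp only [Finset.sum_add_distrib, ← Finset.mul_sum] at h1 ⊢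
  linarith

lemma cauchySeq_of_norm_le {V : Type*} [NormedAddCommGroup V] {x : ℕ → DataSpace 𝕂 d a}
    (hx : CauchySeq x) (P : DataSpace 𝕂 d a →+ V) (hP : ∀ x, ‖P x‖ ≤ ‖x‖) :
    CauchySeq fun n => P (x n) := by
  have hL : LipschitzWith 1 P := by
    refine LipschitzWith.of_dist_le_mul fun x y => ?_
    rw [dist_eq_norm, dist_eq_norm, ← map_sub, NNReal.coe_one, one_mul]
    exact hP _
  exact hx.map hL.uniformContinuous

/-- Along a Cauchy sequence the prescribed divergences, the normal traces and their weighted Fourier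
transforms converge in `L²`; the limits fit together since multiplication by a weight is closed. -/
lemma completeSpace : CompleteSpace (DataSpace 𝕂 d a) := by
  refine Metric.complete_of_cauchySeq_tendsto fun x hx => ?_
  obtain ⟨f, hf⟩ := cauchySeq_tendsto_of_complete
    (cauchySeq_of_norm_le hx (AddMonoidHom.mk' DataSpace.f f_add) norm_f_le)
  choose γ hγ using fun ℓ => cauchySeq_tendsto_of_complete
    (cauchySeq_of_norm_le hx (sobolevPart ℓ) (norm_sobolevPart_le ℓ))
  choose δ hδ using fun ℓ => cauchySeq_tendsto_of_complete
    (cauchySeq_of_norm_le hx (defectPart ℓ) (norm_defectPart_le ℓ))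
  choose g hg using fun ℓ => cauchySeq_tendsto_of_complete
    (cauchySeq_of_norm_le hx (AddMonoidHom.mk' (fun x : DataSpace 𝕂 d a => x.g ℓ)
      fun x y => g_add x y ℓ) fun x => (norm_g_le ℓ x).trans (norm_sobolevPart_le ℓ x))
  simp only [AddMonoidHom.mk'_apply] at hf hg
  have hγ' : ∀ ℓ, γ ℓ =ᵐ[volume] fun ξ => (1 + ‖ξ‖ ^ 2) ^ ((1 / 2 : ℝ) / 2) • hat (g ℓ) ξ :=
    fun ℓ => ae_eq_smul_of_tendsto (fun n => coeFn_sobolevPart ℓ (x n))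
      ((continuous_hat.tendsto _).comp (hg ℓ)) (hγ ℓ)
  have hδ' : ∀ ℓ, δ ℓ =ᵐ[volume] fun ξ => ‖ξ‖ ^ (-1 : ℝ) • hat (g ℓ - vertInt (a ℓ) f) ξ :=
    fun ℓ => ae_eq_smul_of_tendsto (fun n => coeFn_defectPart ℓ (x n))
      ((continuous_hat.tendsto _).comp
        ((hg ℓ).sub (((continuous_vertInt_rclike (a ℓ)).tendsto _).comp hf))) (hδ ℓ)
  let x₀ : DataSpace 𝕂 d a := ⟨(f, g), fun ℓ =>
    ⟨(eLpNorm_congr_ae (hγ' ℓ)).symm.trans_lt (Lp.memLp (γ ℓ)).2,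
      (eLpNorm_congr_ae (hδ' ℓ)).symm.trans_lt (Lp.memLp (δ ℓ)).2⟩⟩
  have hγ₀ : ∀ ℓ, sobolevPart ℓ x₀ = γ ℓ := fun ℓ =>
    Lp.ext ((coeFn_sobolevPart ℓ x₀).trans (hγ' ℓ).symm)
  have hδ₀ : ∀ ℓ, defectPart ℓ x₀ = δ ℓ := fun ℓ =>
    Lp.ext ((coeFn_defectPart ℓ x₀).trans (hδ' ℓ).symm)
  refine ⟨x₀, ?_⟩
  rw [tendsto_iff_norm_sub_tendsto_zero]
  have hsq : Tendsto (fun n => ‖x n - x₀‖ ^ 2) atTop (nhds 0) := by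
    have hf₀ : x₀.f = f := rfl
    simp only [norm_sq_eq, map_sub, f_sub, hf₀, hγ₀, hδ₀]
    have l : ∀ {u : ℕ → L2Horiz d ℂ} {u₀ : L2Horiz d ℂ}, Tendsto u atTop (nhds u₀) →
        Tendsto (fun n => ‖u n - u₀‖ ^ 2) atTop (nhds 0) := fun hu => by
      simpa using (tendsto_iff_norm_sub_tendsto_zero.mp hu).pow 2
    have l1 : Tendsto (fun n => ‖(x n).f - f‖ ^ 2) atTop (nhds 0) := by
      simpa using (tendsto_iff_norm_sub_tendsto_zero.mp hf).pow 2
    simpa using l1.add (tendsto_finsetSum Finset.univ fun ℓ _ => (l (hγ ℓ)).add (l (hδ ℓ)))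
  simpa [Real.sqrt_sq] using hsq.sqrt

end DataSpace

/-! ### The solution operator -/

section Solution

variable {𝕂 : Type*} [RCLike 𝕂] {d m : ℕ} {h : ℝ}

lemma hasTrace_primitive_zero (hh : 0 ≤ h) (f : L2Slab d h ℂ) :
    HasTrace h 0 (primitive hh f) 0 := by
  refine (hasTrace_primitive hh f ⟨le_rfl, hh⟩).congr .rfl ?_
  filter_upwards [coeFn_vertInt 0 f] with x hx
  rw [hx, min_eq_left hh]
  simp

/-- The solution of the divergence equation with prescribed normal traces, in terms of data on
the Fourier side. -/
lemma exists_field (𝕂 : Type*) [RCLike 𝕂] {ι : Type*} [Fintype ι] (hh : 0 ≤ h) {a : ι → ℝ}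
    (ha : ∀ ℓ, 0 < a ℓ) (hah : ∀ ℓ, a ℓ ≤ h) (hinj : Function.Injective a) :
    ∃ J : FourierData d h ι →L[ℝ] Jet 𝕂 d h, (∀ (c : 𝕂) z, J (RCLike.map 𝕂 ℂ c • z) = c • J z) ∧
      ∀ z, J z ∈ ZeroH1 𝕂 d h ∧
        (fun p => ∑ j, (J z).snd j p j) =ᵐ[volume.restrict (slab d h)]
          (fun p => RCLike.map ℂ 𝕂 (fourierInvSlice z.1 p)) ∧
        ∀ (ℓ : ι) (g : L2Horiz d ℂ), (g =ᵐ[volume] fun ξ =>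
            duhamel (rate ξ) (fun s => z.1 (ξ, s)) (a ℓ) + layerHeight ξ * z.2 ℓ ξ) →
          ∃ G : L2Horiz d (Vec 𝕂 d), HasTrace h (a ℓ) (J z).fst G ∧
            (fun x => G x (Fin.last d)) =ᵐ[volume]
              fun x => RCLike.map ℂ 𝕂 ((𝓕⁻ g : L2Horiz d ℂ) x) := by
  obtain ⟨A, B, H⟩ := exists_fourier_solution (d := d) hh ha hah hinj
  obtain ⟨J, hJc, hJ⟩ := exists_vectorField (𝕂 := 𝕂)
    (fun j => fourierInvSlice.comp ((primitive hh).comp (A j)))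
    (fun i j => Fin.lastCases (motive := fun _ => FourierData d h ι →L[ℂ] L2Slab d h ℂ)
      (fourierInvSlice.comp (A j)) (fun i => fourierInvSlice.comp (B i j)) i)
    (fun i j z => by
      induction i using Fin.lastCases with
      | last =>
        simp only [Fin.lastCases_last, ContinuousLinearMap.comp_apply, fourierInvSlice_primitive]
        exact hasWeakDeriv_primitive hh _
      | cast i =>
        simp only [Fin.lastCases_castSucc, ContinuousLinearMap.comp_apply]
        exact hasWeakDeriv_fourierInvSlice i ((H z).1 i j))
    (fun j z => by
      simp only [ContinuousLinearMap.comp_apply, fourierInvSlice_primitive]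
      exact hasTrace_primitive_zero hh _)
  refine ⟨J, hJc, fun z => ⟨(hJ z).1, (hJ z).2.1.trans (Eventually.of_forall fun p => ?_),
    fun ℓ g hg => ?_⟩⟩
  · have e := congrArg fourierInvSlice (H z).2.1
    rw [map_add, map_sum] at e
    simp only [Fin.sum_univ_castSucc, Fin.lastCases_last, Fin.lastCases_castSucc,
      ContinuousLinearMap.comp_apply]
    rw [e]
  · obtain ⟨G, hG, hGn⟩ := (hJ z).2.2 (a ℓ) (fun j => 𝓕⁻ (vertInt (a ℓ) (A j z))) fun j => by
      simp only [ContinuousLinearMap.comp_apply, fourierInvSlice_primitive]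
      rw [← vertInt_fourierInvSlice]
      exact hasTrace_primitive hh _ ⟨(ha ℓ).le, hah ℓ⟩
    have e : vertInt (a ℓ) (A (Fin.last d) z) = g := Lp.ext (((H z).2.2 ℓ).trans hg.symm)
    exact ⟨G, hG, by rw [← e]; exact hGn⟩

lemma exists_clm_submodule {X Y : Type*} [NormedAddCommGroup X] [NormedSpace 𝕂 X]
    [NormedAddCommGroup Y] [NormedSpace 𝕂 Y] (S : Submodule 𝕂 Y) (T : X → Y)
    (hadd : ∀ x y, T (x + y) = T x + T y) (hsmul : ∀ (c : 𝕂) x, T (c • x) = c • T x)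
    (hS : ∀ x, T x ∈ S) {C : ℝ} (hC : ∀ x, ‖T x‖ ≤ C * ‖x‖) :
    ∃ Q : X →L[𝕂] S, ∀ x, (Q x : Y) = T x :=
  ⟨LinearMap.mkContinuous
    { toFun := fun x => ⟨T x, hS x⟩
      map_add' := fun x y => Subtype.ext (hadd x y)
      map_smul' := fun c x => Subtype.ext (hsmul c x) } C hC, fun _ => rfl⟩

namespace DataSpace

variable {a : Fin (m + 1) → ℝ}

lemma hat_defect (x : DataSpace 𝕂 d a) (ℓ : Fin (m + 1)) : hat (x.defect ℓ) =
    hat (x.g ℓ) - vertInt (a ℓ) (fourierSlice (complexify _ x.f)) := by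
  rw [defect, hat_sub, vertInt_fourierSlice, vertInt_complexify]
  rfl

/-- The divergence datum, complexified, and the weighted Fourier transforms of the trace data,
in the product of complex `L²` spaces on which the operators of the construction act. -/
def rawData (x : DataSpace 𝕂 d a) : L2Slab d (a (Fin.last m)) ℂ ×
    (Fin (m + 1) → L2Horiz d ℂ) × (Fin (m + 1) → L2Horiz d ℂ) :=
  (complexify _ x.f, fun ℓ => sobolevPart ℓ x, fun ℓ => defectPart ℓ x)

lemma rawData_add (x y : DataSpace 𝕂 d a) : rawData (x + y) = rawData x + rawData y := by
  refine Prod.ext (map_add (complexify _) x.f y.f)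
    (Prod.ext (funext fun ℓ => ?_) (funext fun ℓ => ?_))
  · exact map_add (sobolevPart ℓ) x y
  · exact map_add (defectPart ℓ) x y

lemma rawData_smul (c : 𝕂) (x : DataSpace 𝕂 d a) :
    rawData (c • x) = RCLike.map 𝕂 ℂ c • rawData x :=
  Prod.ext (complexify_smul c x.f) (Prod.ext (funext fun ℓ => sobolevPart_smul ℓ c x)
    (funext fun ℓ => defectPart_smul ℓ c x))

lemma norm_rawData_le (x : DataSpace 𝕂 d a) : ‖rawData x‖ ≤ ‖x‖ := by
  refine max_le ?_ (max_le ?_ ?_)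
  · exact (norm_complexify x.f).trans_le (norm_f_le x)
  · exact (pi_norm_le_iff_of_nonneg (norm_nonneg x)).mpr fun ℓ => norm_sobolevPart_le ℓ x
  · exact (pi_norm_le_iff_of_nonneg (norm_nonneg x)).mpr fun ℓ => norm_defectPart_le ℓ x

/-- The data on the Fourier side for which the normal traces are the prescribed ones. -/
lemma exists_fourierData (hd : 1 ≤ d) (ha : ∀ ℓ, 0 < a ℓ) (hah : ∀ ℓ, a ℓ ≤ a (Fin.last m)) :
    ∃ Z : L2Slab d (a (Fin.last m)) ℂ × (Fin (m + 1) → L2Horiz d ℂ) ×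
        (Fin (m + 1) → L2Horiz d ℂ) →L[ℂ] FourierData d (a (Fin.last m)) (Fin (m + 1)),
      (∀ z, (Z z).1 = fourierSlice z.1) ∧ ∀ (x : DataSpace 𝕂 d a) ℓ,
        hat (x.g ℓ) =ᵐ[volume] fun ξ => duhamel (rate ξ) (fun s => (Z (rawData x)).1 (ξ, s)) (a ℓ) +
          layerHeight ξ * (Z (rawData x)).2 ℓ ξ := by
  choose R hR using fun ℓ => exists_amplitude hd (ha (Fin.last m)).le (ha ℓ) (hah ℓ)
  let F : L2Slab d (a (Fin.last m)) ℂ × (Fin (m + 1) → L2Horiz d ℂ) ×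
      (Fin (m + 1) → L2Horiz d ℂ) →L[ℂ] L2Slab d (a (Fin.last m)) ℂ :=
    fourierSlice.comp (.fst ℂ _ _)
  refine ⟨F.prod (.pi fun ℓ => (R ℓ).comp (F.prod
    (((ContinuousLinearMap.proj ℓ).comp ((ContinuousLinearMap.fst ℂ _ _).comp (.snd ℂ _ _))).prod
      ((ContinuousLinearMap.proj ℓ).comp ((ContinuousLinearMap.snd ℂ _ _).comp (.snd ℂ _ _)))))),
    fun z => rfl, fun x ℓ => ?_⟩
  have hD := coeFn_defectPart ℓ x
  rw [hat_defect] at hD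
  filter_upwards [hR ℓ (fourierSlice (complexify _ x.f)) (hat (x.g ℓ)) (sobolevPart ℓ x)
    (defectPart ℓ x) (coeFn_sobolevPart ℓ x) hD] with ξ hξ
  exact eq_add_of_sub_eq' hξ.symm

/-- The solution as a map from the data space into the space of jets. -/
lemma exists_solutionMap (hd : 1 ≤ d) (ha : ∀ ℓ, 0 < a ℓ) (hah : ∀ ℓ, a ℓ ≤ a (Fin.last m))
    (hinj : Function.Injective a) :
    ∃ (T : DataSpace 𝕂 d a → Jet 𝕂 d (a (Fin.last m))) (C : ℝ),
      (∀ x y, T (x + y) = T x + T y) ∧ (∀ (c : 𝕂) x, T (c • x) = c • T x) ∧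
      (∀ x, ‖T x‖ ≤ C * ‖x‖) ∧ ∀ x, T x ∈ ZeroH1 𝕂 d (a (Fin.last m)) ∧
        (fun p => ∑ j, (T x).snd j p j) =ᵐ[volume.restrict (slab d (a (Fin.last m)))] x.f ∧
        ∀ ℓ, ∃ G : L2Horiz d (Vec 𝕂 d), HasTrace (a (Fin.last m)) (a ℓ) (T x).fst G ∧
          (fun z => G z (Fin.last d)) =ᵐ[volume] x.g ℓ := by
  obtain ⟨J, hJc, hJ⟩ := exists_field (d := d) 𝕂 (ha (Fin.last m)).le ha hah hinj
  obtain ⟨Z, hZf, hZg⟩ := exists_fourierData (𝕂 := 𝕂) hd ha hah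
  refine ⟨fun x => J (Z x.rawData), ‖J‖ * ‖Z‖, fun x y => ?_, fun c x => ?_, fun x => ?_,
    fun x => ⟨(hJ _).1, ?_, fun ℓ => ?_⟩⟩
  · dsimp only
    rw [rawData_add, map_add, map_add]
  · dsimp only
    rw [rawData_smul, map_smul, hJc]
  · rw [mul_assoc]
    exact J.le_opNorm_of_le ((Z.le_opNorm _).trans
      (mul_le_mul_of_nonneg_left x.norm_rawData_le (norm_nonneg Z)))
  · refine (hJ (Z x.rawData)).2.1.trans ?_
    rw [hZf, rawData, fourierInvSlice_fourierSlice]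
    filter_upwards [coeFn_complexify x.f] with p hp
    rw [hp, map_map_complex]
  · obtain ⟨G, hG, hGn⟩ := (hJ (Z x.rawData)).2.2 ℓ _ (hZg x ℓ)
    refine ⟨G, hG, hGn.trans ?_⟩
    rw [hat_eq, FourierTransform.fourierInv_fourier_eq]
    filter_upwards [coeFn_complexify (x.g ℓ)] with p hp
    rw [hp, map_map_complex]

end DataSpace

end Solution

end Multilayer

end

open Multilayer

theorem mainTheorem7 {𝕂 : Type*} [RCLike 𝕂] (d : ℕ) (hd : 1 ≤ d) (m : ℕ)
    (a : Fin (m + 1) → ℝ) (ha_pos : 0 < a 0) (ha : StrictMono a) :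
    (InnerProductSpaceable (Multilayer.DataSpace 𝕂 d a) ∧
      CompleteSpace (Multilayer.DataSpace 𝕂 d a)) ∧
    ∃ Q : Multilayer.DataSpace 𝕂 d a →L[𝕂] Multilayer.ZeroH1 𝕂 d (a (Fin.last m)),
      ∀ x : Multilayer.DataSpace 𝕂 d a,
        Multilayer.ZeroH1.divergence (Q x) =ᵐ[volume.restrict (Multilayer.slab d (a (Fin.last m)))] x.f ∧
        ∀ ℓ : Fin (m + 1), ∃ G : Multilayer.L2Horiz d (Multilayer.Vec 𝕂 d),
          Multilayer.HasTrace (a (Fin.last m)) (a ℓ) (Multilayer.ZeroH1.field (Q x)) G ∧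
          (fun z => G z (Fin.last d)) =ᵐ[volume] x.g ℓ := by
  refine ⟨⟨DataSpace.innerProductSpaceable, DataSpace.completeSpace⟩, ?_⟩
  have hpos : ∀ ℓ, 0 < a ℓ := fun ℓ => ha_pos.trans_le (ha.monotone (Fin.zero_le ℓ))
  have hle : ∀ ℓ, a ℓ ≤ a (Fin.last m) := fun ℓ => ha.monotone (Fin.le_last ℓ)
  obtain ⟨T, C, hadd, hsmul, hbound, hT⟩ :=
    DataSpace.exists_solutionMap (𝕂 := 𝕂) hd hpos hle ha.injective
  obtain ⟨Q, hQ⟩ := exists_clm_submodule _ T hadd hsmul (fun x => (hT x).1) hbound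
  refine ⟨Q, fun x => ?_⟩
  have hdiv : ZeroH1.divergence (Q x) = fun p => ∑ j, (T x).snd j p j := by
    rw [← hQ]; rfl
  have hfield : ZeroH1.field (Q x) = (T x).fst := by
    rw [← hQ]; rfl
  rw [hdiv, hfield]
  exact (hT x).2
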